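/- **Setting.** Fix $\sigma\in C^3(\mathbb R)$ whose derivatives $\sigma',\sigma'',\sigma'''$ are bounded and with $\mathbb E\,\sigma(G)=0$ for $G\sim\mathcal N(0,1)$. Fix $\mathsf R,\mathsf K>0$, integers $\mathsf k,\mathsf k^\star\ge 1$, a function $\mathsf K_r:\mathbb R_{\ge0}\to\mathbb R_{>0}$, and $\gamma,\tilde\gamma\in(0,\infty)$. Let $p=p(n)$ and $d=d(n)\ge1$ satisfy $p/n\to\gamma$ and $d/p\to\tilde\gamma$ as $n\to\infty$. Put $\mathcal S_p=\{\theta\in\mathbb R^p:\|\theta\|_\infty\le \mathsf R/\sqrt p\}$. For every $n$ let the following be given (all of them may vary with $n$): * a nonnegative loss $\ell:\mathbb R^{\mathsf k+1}\to\mathbb R$ and a labeling function $\eta:\mathbb R^{\mathsf k^\star+1}\to\mathbb R$, both Lipschitz with constant at most $\mathsf K$ for the Euclidean norm; * a (non-random) compact set $\mathcal C_p\subseteq\mathcal S_p$ and a (non-random) matrix $\Theta^\star=(\theta^\star_1,\dots,\theta^\star_{\mathsf k^\star})\in\mathbb R^{p\times\mathsf k^\star}$ with all columns $\theta^\star_l\in\mathcal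 S_p$; * a regularizer $r:\mathbb R^{p\times\mathsf k}\to\mathbb R$ with $|r(\Theta_0)-r(\Theta_1)|\le\mathsf K_r(B)\|\Theta_0-\Theta_1\|_F$ whenever $B>0$ and $\|\Theta_0\|_F,\|\Theta_1\|_F\le B$; * i.i.d. weights $w_1,\dots,w_p$, uniform on the unit sphere of $\mathbb R^d$, $W=(w_1,\dots,w_p)$; i.i.d. covariates $z_1,\dots,z_n\sim\mathcal N(0,I_d)$ independent of $W$; and i.i.d. real noise variables $\epsilon_1,\dots,\epsilon_n$ with $\|\epsilon_i\|_{\psi_2}\le\mathsf K$, where $\|V\|_{\psi_2}=\inf\{t>0:\mathbb E\,e^{V^2/t^2}\le2\}$, independent of $(W,z_1,\dots,z_n)$; * the random features $x_i=(\sigma(w_1^{\mathsf T}z_i),\dots,\sigma(w_p^{\mathsf T}z_i))\in\mathbb R^p$; * Gaussian features $g_1,\dots,g_n\in\mathbb R^p$ that, conditionally on $W$, are i.i.d. $\mathcal N(0,\Sigma_W)$ with $\Sigma_W=\mathbb E[x_1x_1^{\mathsf T}\mid W]$, and such that $(\epsilon_i)_{i\le n}$ is independent of $(W,g_1,\dots,g_n)$.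 For $X=(x_1,\dots,x_n)^{\mathsf T}$ define the labels $y_i(X)=\eta(\Theta^{\star\mathsf T}x_i,\epsilon_i)$ and the training error $$\widehat R_n^\star(X,y(X))=\inf_{\Theta=(\theta_1,\dots,\theta_{\mathsf k}),\ \theta_l\in\mathcal C_p}\Big\{\frac1n\sum_{i=1}^n\ell\big(\Theta^{\mathsf T}x_i;\,y_i(X)\big)+r(\Theta)\Big\},$$ and define $\widehat R_n^\star(G,y(G))$ in the same way from $G=(g_1,\dots,g_n)^{\mathsf T}$ and the same noise. **Claim.** 1. For every bounded Lipschitz $\psi:\mathbb R\to\mathbb R$, $$\lim_{n\to\infty}\Big|\mathbb E\,\psi\big(\widehat R_n^\star(X,y(X))\big)-\mathbb E\,\psi\big(\widehat R_n^\star(G,y(G))\big)\Big|=0 .$$ 2. For all $\rho\in\mathbb R$, $\delta>0$ and $\tau>0$, for all sufficiently large $n$, $$\mathbb P\big(\widehat R_n^\star(X,y(X))\ge\rho+\delta\big)\le\mathbb P\big(\widehat R_n^\star(G,y(G))\ge\rho\big)+\tau,$$ $$\mathbb P\big(\widehat R_n^\star(X,y(X))\le\rho-\delta\big)\le\mathbb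 P\big(\widehat R_n^\star(G,y(G))\le\rho\big)+\tau .$$ (In particular, without $\tau$, the inequalities hold between the upper limits, between the lower limits, and between the limits as $n\to\infty$ whenever these exist.) 3. For every $\rho\in\mathbb R$, $\widehat R_n^\star(X,y(X))\to\rho$ in probability if and only if $\widehat R_n^\star(G,y(G))\to\rho$ in probability. -/

import Mathlib

open MeasureTheory ProbabilityTheory Filter Topology
open scoped ENNReal NNReal

noncomputable section

namespace RandomFeatures

/-- Matrices `Θ = (θ₁, …, θ_k) ∈ ℝ^{p × k}`, given by their columns `Θ l = θ_l ∈ ℝ^p`.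
The norm of `PiLp 2` of Euclidean spaces is the Frobenius norm. -/
abbrev Params (p k : ℕ) : Type := PiLp 2 (fun _ : Fin k => EuclideanSpace ℝ (Fin p))

/-- Euclidean `ℝ^{k + 1}`, with points written `(u, y)` for `u ∈ ℝ^k` and `y ∈ ℝ`. -/
abbrev LossDomain (k : ℕ) : Type := WithLp 2 (EuclideanSpace ℝ (Fin k) × ℝ)

/-- The projections `Θᵀ x ∈ ℝ^k`. -/
def proj {p k : ℕ} (Θ : Params p k) (x : EuclideanSpace ℝ (Fin p)) : EuclideanSpace ℝ (Fin k) :=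
  WithLp.toLp 2 (fun l => inner ℝ (Θ l) x)

/-- The labels `y_i = η(Θ⋆ᵀ x_i, ε_i)`. -/
def labels {n p k : ℕ} (η : LossDomain k → ℝ) (Θs : Params p k)
    (X : Fin n → EuclideanSpace ℝ (Fin p)) (ε : Fin n → ℝ) : Fin n → ℝ :=
  fun i => η (WithLp.toLp 2 (proj Θs (X i), ε i))

/-- The regularized empirical risk `n⁻¹ ∑ᵢ ℓ(Θᵀ x_i; y_i) + r(Θ)`. -/
def empRisk {n p k : ℕ} (ℓ : LossDomain k → ℝ) (r : Params p k → ℝ)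
    (X : Fin n → EuclideanSpace ℝ (Fin p)) (y : Fin n → ℝ) (Θ : Params p k) : ℝ :=
  (1 / (n : ℝ)) * ∑ i, ℓ (WithLp.toLp 2 (proj Θ (X i), y i)) + r Θ

/-- The training error: the infimum of the empirical risk over `Θ ∈ C^k`, that is, over the
matrices all of whose columns lie in `C`. -/
def minRisk {n p k : ℕ} (ℓ : LossDomain k → ℝ) (r : Params p k → ℝ)
    (C : Set (EuclideanSpace ℝ (Fin p)))
    (X : Fin n → EuclideanSpace ℝ (Fin p)) (y : Fin n → ℝ) : ℝ :=
  sInf (empRisk ℓ r X y '' {Θ : Params p k | ∀ l, Θ l ∈ C})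

/-- The random-features map `φ(z) = (σ(w₁ᵀ z), …, σ(w_pᵀ z))`. -/
def feature {d p : ℕ} (σ : ℝ → ℝ) (W : Fin p → EuclideanSpace ℝ (Fin d))
    (z : EuclideanSpace ℝ (Fin d)) : EuclideanSpace ℝ (Fin p) :=
  WithLp.toLp 2 (fun j => σ (inner ℝ (W j) z))

/-- The conditional second-moment matrix `Σ_W = E[x xᵀ | W]` of `x = φ(z)`, where `z` is a
standard Gaussian vector independent of `W`. -/
def condCov {d p : ℕ} (σ : ℝ → ℝ) (W : Fin p → EuclideanSpace ℝ (Fin d)) :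
    Matrix (Fin p) (Fin p) ℝ :=
  Matrix.of fun a b =>
    ∫ z, feature σ W z a * feature σ W z b ∂(stdGaussian (EuclideanSpace ℝ (Fin d)))

/-- The uniform distribution on the unit sphere of `ℝ^d` (`d ≥ 1`): normalized surface measure. -/
def uniformSphere (d : ℕ) : Measure (EuclideanSpace ℝ (Fin d)) :=
  let S := (volume : Measure (EuclideanSpace ℝ (Fin d))).toSphere
  (S Set.univ)⁻¹ • S.map Subtype.val

/-- The `ℓ∞` ball of radius `R / √p` in `ℝ^p`. -/
def linftyBall (p : ℕ) (R : ℝ) : Set (EuclideanSpace ℝ (Fin p)) :=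
  {θ | ∀ j, |θ j| ≤ R / √(p : ℝ)}

/-- The subgaussian norm `‖V‖_{ψ₂} = inf {t > 0 : E exp(V² / t²) ≤ 2}` (`∞` if there is no
such `t`). -/
def psiTwoNorm {Ω : Type*} [MeasurableSpace Ω] (P : Measure Ω) (V : Ω → ℝ) : ℝ≥0∞ :=
  ⨅ (t : ℝ) (_ : 0 < t)
    (_ : ∫⁻ ω, ENNReal.ofReal (Real.exp (V ω ^ 2 / t ^ 2)) ∂P ≤ 2), ENNReal.ofReal t

end RandomFeatures

end

set_option linter.unusedSectionVars false

namespace RandomFeatures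

/-! ### Exponential Jensen inequalities -/

section Jensen

variable {α : Type*} [MeasurableSpace α] {μ : Measure α}

/-! The method is a Lindeberg exchange, applied to a smooth substitute of the training error. The
weights `W` and the noise are fixed at first; all bounds are uniform in the noise, which is
integrated out at the end.

Smoothing. The minimum over the constraint set is replaced by the free energy `softRisk` at inverse
temperature `nβ` over a `δ`-net, with mollified loss and mollified test function. When the feature
matrix has operator norm at most `c√n`, this costs at most `τ + log |net| / (nβ) + (Kc + D) δ`
(`abs_minRisk_sub_softRisk_le`). A volume bound makes `log |net|` at most a multiple of `p`, hence
of `n`, for fixed `δ`, so the middle term is small once `β` is large.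

One exchange. With the other samples frozen, the free energy is a function `H` of the projections
`F_j(z) = ⟨θ_j, φ(z)⟩`. The Gaussian counterparts `⟨a_j, ξ⟩`, `a_j = Σ_W^{1/2} θ_j`, have the same
covariances. Differentiate `E H` along `sin t · F + cos t · ⟨a, ξ⟩`. Gaussian integration by parts
turns the `ξ` term into `⟨a_j, a_j'⟩ E ∂_jj' H`. For the `F` term the covariance formula `E[F K] =
∫_0^{π/2} sin θ E⟨∇F(z), ∇K(z_θ)⟩ dθ` (`integral_mul_eq_intervalIntegral`) gives the same
expression, except that the random product `⟨∇F_j(z), ∇F_j'(z_θ)⟩` stands inside the expectation. By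
the same formula its mean, integrated against `sin θ`, is `⟨a_j, a_j'⟩`. Hence only the covariance
of `∂_jj' H` with that product survives, and Cauchy–Schwarz together with a Gaussian Poincaré
inequality bounds it by `‖∂_jj' H‖_{L²}` times a multiple of `sup |∇F| · Lip(∇F)`. For good weights
`Lip(∇F)` is at most `Λ² M ‖θ‖_∞`, which is of order `1/√p`: this is where the `ℓ∞` constraint
enters.

Size of the net. The second derivatives of the soft minimum are at most `C/n` times Gibbs weights.
These are dominated by deterministic weights of total mass one, times a factor with bounded moments
(`softWeight_le`). So the `L²` norms sum to `O(1/n)` whatever the cardinality of the net, and all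
`n` exchanges together cost `O(1/√p)` (`MatchedFeatures.abs_integral_softRisk_sub_le`).

Probability. A net argument for matrices with independent subgaussian rows
(`measure_frame_compl_le`) gives the frame bound for `W` and the operator norm bounds for both
feature matrices, outside events of exponentially small probability. The constants are chosen before
`n → ∞` (`eventually_compError_le`). The statements on probabilities and on convergence in
probability follow by testing with ramp functions. -/

theorem ofReal_integral_le_lintegral_ofReal {f : α → ℝ} (hf : Integrable f μ) :
    ENNReal.ofReal (∫ x, f x ∂μ) ≤ ∫⁻ x, ENNReal.ofReal (f x) ∂μ := by
  rw [integral_eq_lintegral_pos_part_sub_lintegral_neg_part hf]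
  refine ENNReal.ofReal_le_of_le_toReal ?_
  have : 0 ≤ (∫⁻ x, ENNReal.ofReal (-f x) ∂μ).toReal := ENNReal.toReal_nonneg
  linarith

/-- The tangent line of `exp` at the mean lies below `exp`. Stating the bound with a lower integral
avoids assuming that `exp f` is integrable. -/
theorem ofReal_exp_integral_le [IsProbabilityMeasure μ] {f : α → ℝ} (hf : Integrable f μ) :
    ENNReal.ofReal (Real.exp (∫ x, f x ∂μ)) ≤ ∫⁻ x, ENNReal.ofReal (Real.exp (f x)) ∂μ := by
  set m := ∫ x, f x ∂μ with hm
  have hs : Integrable (fun x => f x - m) μ := hf.sub (integrable_const m)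
  have hint : Integrable (fun x => Real.exp m * (f x - m + 1)) μ :=
    (hs.add (integrable_const 1)).const_mul _
  have h1 : ∫ x, Real.exp m * (f x - m + 1) ∂μ = Real.exp m := by
    rw [integral_const_mul, integral_add hs (integrable_const 1),
      integral_sub hf (integrable_const m)]
    simp [← hm]
  calc ENNReal.ofReal (Real.exp m) = ENNReal.ofReal (∫ x, Real.exp m * (f x - m + 1) ∂μ) := by
        rw [h1]
    _ ≤ ∫⁻ x, ENNReal.ofReal (Real.exp m * (f x - m + 1)) ∂μ :=
        ofReal_integral_le_lintegral_ofReal hint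
    _ ≤ _ := by
        refine lintegral_mono fun x => ENNReal.ofReal_le_ofReal ?_
        have := Real.add_one_le_exp (f x - m)
        calc Real.exp m * (f x - m + 1) ≤ Real.exp m * Real.exp (f x - m) := by gcongr
          _ = Real.exp (f x) := by rw [← Real.exp_add]; ring_nf

/-- The parabola lies above its tangent, `f² ≥ m² + 2m(f - m)`; apply the exponential Jensen
inequality to the tangent, which is integrable as soon as `f` is. -/
theorem ofReal_exp_sq_integral_le [IsProbabilityMeasure μ] {f : α → ℝ} (hf : Integrable f μ)
    {c : ℝ} (hc : 0 ≤ c) :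
    ENNReal.ofReal (Real.exp (c * (∫ x, f x ∂μ) ^ 2)) ≤
      ∫⁻ x, ENNReal.ofReal (Real.exp (c * f x ^ 2)) ∂μ := by
  set m := ∫ x, f x ∂μ with hm
  have hs : Integrable (fun x => f x - m) μ := hf.sub (integrable_const m)
  have hint : Integrable (fun x => c * (m ^ 2 + 2 * m * (f x - m))) μ :=
    ((integrable_const _).add (hs.const_mul _)).const_mul _
  have h1 : ∫ x, c * (m ^ 2 + 2 * m * (f x - m)) ∂μ = c * m ^ 2 := by
    rw [integral_const_mul, integral_add (integrable_const _)
      (hs.const_mul _), integral_const_mul,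
      integral_sub hf (integrable_const m)]
    simp [← hm]
  rw [← h1]
  refine (ofReal_exp_integral_le hint).trans (lintegral_mono fun x => ?_)
  refine ENNReal.ofReal_le_ofReal (Real.exp_le_exp.2 ?_)
  refine mul_le_mul_of_nonneg_left ?_ hc
  nlinarith [sq_nonneg (f x - m)]

end Jensen

/-! ### Square-exponential integrability -/

/-- `f` is subgaussian with parameter `c`: `E exp (c f²) ≤ 2`. -/
def SubG {α : Type*} [MeasurableSpace α] (μ : Measure α) (f : α → ℝ) (c : ℝ) : Prop :=
  ∫⁻ x, ENNReal.ofReal (Real.exp (c * f x ^ 2)) ∂μ ≤ 2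

section SubG

variable {α : Type*} [MeasurableSpace α] {μ : Measure α} {f : α → ℝ} {c : ℝ}

/-- Integrate `1 + c f² ≤ exp (c f²)` and cancel the `1`. -/
theorem SubG.lintegral_sq_le [IsProbabilityMeasure μ] (h : SubG μ f c) (hc : 0 < c)
    (hf : AEMeasurable f μ) : ∫⁻ x, ENNReal.ofReal (f x ^ 2) ∂μ ≤ ENNReal.ofReal (1 / c) := by
  have h1 : 1 + ∫⁻ x, ENNReal.ofReal (c * f x ^ 2) ∂μ ≤ 2 := by
    calc 1 + ∫⁻ x, ENNReal.ofReal (c * f x ^ 2) ∂μ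
        = ∫⁻ x, (1 + ENNReal.ofReal (c * f x ^ 2)) ∂μ := by
          rw [lintegral_add_left measurable_const]; simp
      _ ≤ ∫⁻ x, ENNReal.ofReal (Real.exp (c * f x ^ 2)) ∂μ := by
          refine lintegral_mono fun x => ?_
          rw [← ENNReal.ofReal_one, ← ENNReal.ofReal_add zero_le_one (by positivity)]
          refine ENNReal.ofReal_le_ofReal ?_
          linarith [Real.add_one_le_exp (c * f x ^ 2)]
      _ ≤ 2 := h
  have h2 : ∫⁻ x, ENNReal.ofReal (c * f x ^ 2) ∂μ ≤ 1 := by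
    have : (2 : ℝ≥0∞) = 1 + 1 := by norm_num
    rw [this] at h1
    exact (ENNReal.add_le_add_iff_left ENNReal.one_ne_top).1 h1
  calc ∫⁻ x, ENNReal.ofReal (f x ^ 2) ∂μ
      = ∫⁻ x, ENNReal.ofReal (1 / c) * ENNReal.ofReal (c * f x ^ 2) ∂μ := by
        refine lintegral_congr fun x => ?_
        rw [← ENNReal.ofReal_mul (by positivity)]
        congr 1; field_simp
    _ = ENNReal.ofReal (1 / c) * ∫⁻ x, ENNReal.ofReal (c * f x ^ 2) ∂μ :=
        lintegral_const_mul'' _ (by fun_prop)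
    _ ≤ ENNReal.ofReal (1 / c) * 1 := by gcongr
    _ = _ := mul_one _

theorem integral_le_of_lintegral_ofReal_le {g : α → ℝ} (hg : AEStronglyMeasurable g μ)
    (hg0 : ∀ x, 0 ≤ g x) {C : ℝ} (hC : 0 ≤ C)
    (h : ∫⁻ x, ENNReal.ofReal (g x) ∂μ ≤ ENNReal.ofReal C) :
    Integrable g μ ∧ ∫ x, g x ∂μ ≤ C := by
  refine ⟨⟨hg, ?_⟩, ?_⟩
  · rw [hasFiniteIntegral_iff_ofReal (Eventually.of_forall hg0)]
    exact h.trans_lt ENNReal.ofReal_lt_top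
  · rw [integral_eq_lintegral_of_nonneg_ae (Eventually.of_forall hg0) hg]
    exact ENNReal.toReal_le_of_le_ofReal hC h

theorem SubG.integral_sq_le [IsProbabilityMeasure μ] (h : SubG μ f c) (hc : 0 < c)
    (hf : AEMeasurable f μ) : Integrable (fun x => f x ^ 2) μ ∧ ∫ x, f x ^ 2 ∂μ ≤ 1 / c :=
  integral_le_of_lintegral_ofReal_le (by fun_prop) (fun _ => sq_nonneg _) (by positivity)
    (h.lintegral_sq_le hc hf)

/-- Completing the square gives `a|f| ≤ a²/(4c) + c f²`. -/
theorem SubG.lintegral_exp_abs_le (h : SubG μ f c) (hc : 0 < c) (a : ℝ) :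
    ∫⁻ x, ENNReal.ofReal (Real.exp (a * |f x|)) ∂μ ≤
      ENNReal.ofReal (2 * Real.exp (a ^ 2 / (4 * c))) := by
  calc ∫⁻ x, ENNReal.ofReal (Real.exp (a * |f x|)) ∂μ
      ≤ ∫⁻ x, ENNReal.ofReal (Real.exp (a ^ 2 / (4 * c))) *
          ENNReal.ofReal (Real.exp (c * f x ^ 2)) ∂μ := by
        refine lintegral_mono fun x => ?_
        rw [← ENNReal.ofReal_mul (by positivity), ← Real.exp_add]
        refine ENNReal.ofReal_le_ofReal (Real.exp_le_exp.2 ?_)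
        have h0 : a ^ 2 / (4 * c) + c * f x ^ 2 - a * |f x| = (a / 2 - c * |f x|) ^ 2 / c := by
          rw [← sq_abs (f x)]; field_simp; ring
        have : 0 ≤ (a / 2 - c * |f x|) ^ 2 / c := by positivity
        linarith
    _ = ENNReal.ofReal (Real.exp (a ^ 2 / (4 * c))) *
          ∫⁻ x, ENNReal.ofReal (Real.exp (c * f x ^ 2)) ∂μ :=
        lintegral_const_mul' _ _ ENNReal.ofReal_ne_top
    _ ≤ ENNReal.ofReal (Real.exp (a ^ 2 / (4 * c))) * 2 := by gcongr; exact h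
    _ = _ := by
        rw [mul_comm 2, ENNReal.ofReal_mul (by positivity)]; simp

end SubG

/-! ### Standard Gaussian measures -/

section Gaussian

variable {E : Type*} [NormedAddCommGroup E] [InnerProductSpace ℝ E] [FiniteDimensional ℝ E]
  [MeasurableSpace E] [BorelSpace E]

theorem stdGaussian_map_inner (a : E) :
    (stdGaussian E).map (fun z => inner ℝ a z) = gaussianReal 0 (‖a‖ ^ 2).toNNReal := by
  have := IsGaussian.map_eq_gaussianReal (μ := stdGaussian E) (innerSL ℝ a)
  rw [integral_strongDual_stdGaussian, variance_dual_stdGaussian, innerSL_apply_norm] at this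
  exact this

/-- Against the Gaussian density the integrand is at most `exp (-x²/4) / √(2π)`, whose integral is
`√2`. -/
theorem gaussianReal_zero_one_lintegral_exp_sq_le {s : ℝ} (hs : s ≤ 1 / 4) :
    ∫⁻ x, ENNReal.ofReal (Real.exp (s * x ^ 2)) ∂(gaussianReal 0 1) ≤ 2 := by
  have hint : Integrable (fun x : ℝ => Real.exp (-(1 / 4) * x ^ 2)) :=
    integrable_exp_neg_mul_sq (by norm_num)
  rw [gaussianReal_of_var_ne_zero _ one_ne_zero,
    lintegral_withDensity_eq_lintegral_mul _ (measurable_gaussianPDF _ _) (by fun_prop)]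
  calc ∫⁻ x, (gaussianPDF 0 1 * fun x => ENNReal.ofReal (Real.exp (s * x ^ 2))) x
      ≤ ∫⁻ x : ℝ, ENNReal.ofReal ((√(2 * Real.pi))⁻¹ * Real.exp (-(1 / 4) * x ^ 2)) := by
        refine lintegral_mono fun x => ?_
        simp only [Pi.mul_apply, gaussianPDF]
        rw [← ENNReal.ofReal_mul (gaussianPDFReal_nonneg _ _ _)]
        refine ENNReal.ofReal_le_ofReal ?_
        rw [gaussianPDFReal_def]
        simp only [NNReal.coe_one, mul_one, sub_zero]
        rw [mul_assoc, ← Real.exp_add]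
        gcongr
        nlinarith [sq_nonneg x]
    _ = ENNReal.ofReal (∫ x : ℝ, (√(2 * Real.pi))⁻¹ * Real.exp (-(1 / 4) * x ^ 2)) := by
        rw [ofReal_integral_eq_lintegral_ofReal (hint.const_mul _)
          (Eventually.of_forall fun x => by positivity)]
    _ ≤ ENNReal.ofReal 2 := by
        refine ENNReal.ofReal_le_ofReal ?_
        rw [integral_const_mul, integral_gaussian]
        rw [inv_mul_le_iff₀ (by positivity), mul_comm]
        have h2 : (2 : ℝ) = √4 := by
          rw [show (4 : ℝ) = 2 ^ 2 by norm_num, Real.sqrt_sq (by norm_num)]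
        conv_rhs => rw [h2]
        rw [← Real.sqrt_mul (by norm_num)]
        refine Real.sqrt_le_sqrt ?_
        have := Real.pi_pos
        rw [div_div_eq_mul_div]; linarith
    _ = 2 := by simp

theorem subG_inner {a : E} {c : ℝ} (h : c * ‖a‖ ^ 2 ≤ 1 / 4) :
    SubG (stdGaussian E) (fun z => inner ℝ a z) c := by
  have h1 : (stdGaussian E).map (fun z => inner ℝ a z) =
      (gaussianReal 0 1).map (fun x => ‖a‖ * x) := by
    rw [stdGaussian_map_inner, gaussianReal_map_const_mul]
    congr 1
    · simp
    · ext; simp [Real.coe_toNNReal _ (sq_nonneg ‖a‖)]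
  have h2 : ∫⁻ z, ENNReal.ofReal (Real.exp (c * (inner ℝ a z) ^ 2)) ∂(stdGaussian E) =
      ∫⁻ x, ENNReal.ofReal (Real.exp (c * x ^ 2))
        ∂((stdGaussian E).map (fun z => inner ℝ a z)) := by
    rw [lintegral_map (by fun_prop) (by fun_prop)]
  rw [SubG, h2, h1, lintegral_map (by fun_prop) (by fun_prop)]
  simp_rw [mul_pow, ← mul_assoc]
  exact gaussianReal_zero_one_lintegral_exp_sq_le h

theorem integral_inner_stdGaussian (a : E) : ∫ z, inner ℝ a z ∂(stdGaussian E) = 0 :=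
  integral_strongDual_stdGaussian (innerSL ℝ a)

theorem memLp_inner_stdGaussian (a : E) :
    MemLp (fun z => inner ℝ a z) 2 (stdGaussian E) :=
  (IsGaussian.memLp_two_id (μ := stdGaussian E)).const_inner a

theorem integral_inner_mul_inner_stdGaussian (a b : E) :
    ∫ z, inner ℝ a z * inner ℝ b z ∂(stdGaussian E) = inner ℝ a b := by
  have h := covarianceBilin_apply_eq_cov (μ := stdGaussian E) IsGaussian.memLp_two_id a b
  rw [covarianceBilin_stdGaussian, covariance_eq_sub (memLp_inner_stdGaussian a)
    (memLp_inner_stdGaussian b), integral_inner_stdGaussian] at h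
  rw [innerSL_apply_apply] at h
  simpa using h.symm

theorem integrable_norm_stdGaussian : Integrable (fun z => ‖z‖) (stdGaussian E) :=
  (IsGaussian.integrable_id (μ := stdGaussian E)).norm

theorem integrable_norm_sq_stdGaussian : Integrable (fun z => ‖z‖ ^ 2) (stdGaussian E) :=
  (IsGaussian.memLp_two_id (μ := stdGaussian E)).integrable_norm_pow two_ne_zero

theorem measurePreserving_rotation (θ : ℝ) :
    MeasurePreserving (fun z : E × E => (Real.cos θ • z.1 + Real.sin θ • z.2,
      -Real.sin θ • z.1 + Real.cos θ • z.2))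
      ((stdGaussian E).prod (stdGaussian E)) ((stdGaussian E).prod (stdGaussian E)) := by
  refine ⟨by fun_prop, ?_⟩
  exact IsGaussian.map_rotation_eq_self_of_forall_strongDual_eq_zero
    (fun L => integral_strongDual_stdGaussian L) θ

theorem measurePreserving_rotate_fst (θ : ℝ) :
    MeasurePreserving (fun z : E × E => Real.cos θ • z.1 - Real.sin θ • z.2)
      ((stdGaussian E).prod (stdGaussian E)) (stdGaussian E) := by
  have := (measurePreserving_fst (μ := stdGaussian E) (ν := stdGaussian E)).comp
    (measurePreserving_rotation (E := E) (-θ))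
  convert this using 1
  ext z
  simp [sub_eq_add_neg]

end Gaussian

end RandomFeatures

namespace RandomFeatures

section GaussianCalculus

variable {E : Type*} [NormedAddCommGroup E] [InnerProductSpace ℝ E] [FiniteDimensional ℝ E]
  [MeasurableSpace E] [BorelSpace E]

/-! ### Concentration and integration by parts for the standard Gaussian measure -/

theorem abs_sub_le_of_gradient {F : E → ℝ} {gF : E → E} {A : ℝ}
    (hF : ∀ x, HasFDerivAt F (innerSL ℝ (gF x)) x) (hA : ∀ x, ‖gF x‖ ≤ A) (x y : E) :
    |F x - F y| ≤ A * ‖x - y‖ := by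
  have := Convex.norm_image_sub_le_of_norm_hasFDerivWithin_le (f := F)
    (f' := fun x => innerSL ℝ (gF x)) (C := A) (s := Set.univ) (x := y) (y := x)
    (fun x _ => (hF x).hasFDerivWithinAt) (fun x _ => by rw [innerSL_apply_norm]; exact hA x)
    convex_univ (Set.mem_univ _) (Set.mem_univ _)
  simpa using this

theorem abs_le_of_gradient {F : E → ℝ} {gF : E → E} {A : ℝ}
    (hF : ∀ x, HasFDerivAt F (innerSL ℝ (gF x)) x) (hA : ∀ x, ‖gF x‖ ≤ A) (x : E) :
    |F x| ≤ |F 0| + A * ‖x‖ := by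
  have := abs_sub_le_of_gradient hF hA x 0
  rw [sub_zero] at this
  have h2 := abs_sub_abs_le_abs_sub (F x) (F 0)
  linarith

theorem continuous_of_gradient {F : E → ℝ} {gF : E → E}
    (hF : ∀ x, HasFDerivAt F (innerSL ℝ (gF x)) x) : Continuous F :=
  continuous_iff_continuousAt.2 fun x => (hF x).continuousAt

theorem integrable_of_gradient {F : E → ℝ} {gF : E → E} {A : ℝ}
    (hF : ∀ x, HasFDerivAt F (innerSL ℝ (gF x)) x) (hA : ∀ x, ‖gF x‖ ≤ A) :
    Integrable F (stdGaussian E) := by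
  refine Integrable.mono' ((integrable_const |F 0|).add (integrable_norm_stdGaussian.const_mul A))
    (continuous_of_gradient hF).aestronglyMeasurable (Eventually.of_forall fun x => ?_)
  exact abs_le_of_gradient hF hA x

theorem hasDerivAt_rotation (z : E × E) (θ : ℝ) :
    HasDerivAt (fun θ : ℝ => Real.cos θ • z.1 + Real.sin θ • z.2)
      (-Real.sin θ • z.1 + Real.cos θ • z.2) θ :=
  ((Real.hasDerivAt_cos θ).smul_const z.1).add ((Real.hasDerivAt_sin θ).smul_const z.2)

theorem hasDerivAt_comp_rotation {F : E → ℝ} {gF : E → E}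
    (hF : ∀ x, HasFDerivAt F (innerSL ℝ (gF x)) x) (z : E × E) (θ : ℝ) :
    HasDerivAt (fun θ : ℝ => F (Real.cos θ • z.1 + Real.sin θ • z.2))
      (inner ℝ (gF (Real.cos θ • z.1 + Real.sin θ • z.2))
        (-Real.sin θ • z.1 + Real.cos θ • z.2)) θ :=
  (hF _).comp_hasDerivAt θ (hasDerivAt_rotation z θ)

theorem norm_rotation_le (z : E × E) (θ : ℝ) :
    ‖Real.cos θ • z.1 + Real.sin θ • z.2‖ ≤ ‖z.1‖ + ‖z.2‖ := by
  refine (norm_add_le _ _).trans ?_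
  rw [norm_smul, norm_smul, Real.norm_eq_abs, Real.norm_eq_abs]
  have h1 := mul_le_mul_of_nonneg_right (Real.abs_cos_le_one θ) (norm_nonneg z.1)
  have h2 := mul_le_mul_of_nonneg_right (Real.abs_sin_le_one θ) (norm_nonneg z.2)
  linarith

theorem norm_rotation_deriv_le (z : E × E) (θ : ℝ) :
    ‖-Real.sin θ • z.1 + Real.cos θ • z.2‖ ≤ ‖z.1‖ + ‖z.2‖ := by
  refine (norm_add_le _ _).trans ?_
  rw [norm_smul, norm_smul, Real.norm_eq_abs, Real.norm_eq_abs, abs_neg]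
  have h1 := mul_le_mul_of_nonneg_right (Real.abs_sin_le_one θ) (norm_nonneg z.1)
  have h2 := mul_le_mul_of_nonneg_right (Real.abs_cos_le_one θ) (norm_nonneg z.2)
  linarith

/-- The Maurey–Pisier argument. Join `z.1` to `z.2` by a quarter of a circle and write the increment
of `F` as the integral of its derivative. By rotation invariance, position and velocity at each time
are independent standard Gaussians, so the derivative is conditionally a centred Gaussian. The
factor `π/2` from the speed turns the threshold `1/4` of `subG_inner` into `c A² π² ≤ 1`. -/
theorem subG_sub_of_gradient {F : E → ℝ} {gF : E → E} {A c : ℝ}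
    (hF : ∀ x, HasFDerivAt F (innerSL ℝ (gF x)) x) (hg : Continuous gF) (hA : ∀ x, ‖gF x‖ ≤ A)
    (hc0 : 0 ≤ c) (hc : c * A ^ 2 * Real.pi ^ 2 ≤ 1) :
    SubG ((stdGaussian E).prod (stdGaussian E)) (fun z => F z.2 - F z.1) c := by
  set μ := stdGaussian E
  have hpath : ∀ z : E × E, ∀ s : ℝ, HasDerivAt
      (fun s : ℝ => F (Real.cos (Real.pi / 2 * s) • z.1 + Real.sin (Real.pi / 2 * s) • z.2))
      (inner ℝ (gF (Real.cos (Real.pi / 2 * s) • z.1 + Real.sin (Real.pi / 2 * s) • z.2))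
        (-Real.sin (Real.pi / 2 * s) • z.1 + Real.cos (Real.pi / 2 * s) • z.2)
        * (Real.pi / 2)) s := by
    intro z s
    have h2 : HasDerivAt (fun s : ℝ => Real.pi / 2 * s) (Real.pi / 2) s := by
      simpa using (hasDerivAt_id s).const_mul (Real.pi / 2)
    exact (hasDerivAt_comp_rotation hF z (Real.pi / 2 * s)).comp s h2
  have hcont : Continuous (fun q : (E × E) × ℝ =>
      (inner ℝ (gF (Real.cos (Real.pi / 2 * q.2) • q.1.1 + Real.sin (Real.pi / 2 * q.2) • q.1.2))
        (-Real.sin (Real.pi / 2 * q.2) • q.1.1 + Real.cos (Real.pi / 2 * q.2) • q.1.2)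
        * (Real.pi / 2) : ℝ)) := by fun_prop
  obtain ⟨k, hk⟩ : ∃ k : E × E → ℝ → ℝ, ∀ z s, k z s =
      (inner ℝ (gF (Real.cos (Real.pi / 2 * s) • z.1 + Real.sin (Real.pi / 2 * s) • z.2))
        (-Real.sin (Real.pi / 2 * s) • z.1 + Real.cos (Real.pi / 2 * s) • z.2)
        * (Real.pi / 2)) := ⟨_, fun _ _ => rfl⟩
  simp_rw [← hk] at hcont hpath
  have hkc : ∀ z, Continuous (k z) := fun z =>
    hcont.comp (Continuous.prodMk continuous_const continuous_id)
  have hkm : Measurable (fun q : (E × E) × ℝ => k q.1 q.2) := hcont.measurable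
  have hint : ∀ z : E × E, F z.2 - F z.1 = ∫ s in Set.Ioc (0 : ℝ) 1, k z s := by
    intro z
    rw [← intervalIntegral.integral_of_le zero_le_one,
      intervalIntegral.integral_eq_sub_of_hasDerivAt (fun s _ => hpath z s)
        ((hkc z).intervalIntegrable _ _)]
    simp
  -- The quarter circle is run in unit time so that Jensen applies to the time average.
  have hprob : IsProbabilityMeasure (volume.restrict (Set.Ioc (0 : ℝ) 1)) :=
    ⟨by simp⟩
  calc ∫⁻ z, ENNReal.ofReal (Real.exp (c * (F z.2 - F z.1) ^ 2)) ∂(μ.prod μ)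
      ≤ ∫⁻ z, ∫⁻ s in Set.Ioc (0 : ℝ) 1, ENNReal.ofReal (Real.exp (c * (k z s) ^ 2))
          ∂volume ∂(μ.prod μ) := by
        refine lintegral_mono fun z => ?_
        rw [hint z]
        refine ofReal_exp_sq_integral_le ?_ hc0
        exact ((hkc z).integrableOn_Icc (a := 0) (b := 1)).mono_set Set.Ioc_subset_Icc_self
    _ = ∫⁻ s in Set.Ioc (0 : ℝ) 1, ∫⁻ z, ENNReal.ofReal (Real.exp (c * (k z s) ^ 2))
          ∂(μ.prod μ) ∂volume := by
        refine lintegral_lintegral_swap ?_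
        exact Measurable.aemeasurable (by fun_prop)
    _ ≤ ∫⁻ s in Set.Ioc (0 : ℝ) 1, 2 ∂volume := by
        refine lintegral_mono fun s => ?_
        -- Rotation by the current angle turns position and velocity into the two independent
        -- coordinates.
        have h1 : ∫⁻ z, ENNReal.ofReal (Real.exp (c * (k z s) ^ 2)) ∂(μ.prod μ) =
            ∫⁻ z : E × E, ENNReal.ofReal (Real.exp (c *
              (inner ℝ ((Real.pi / 2) • gF z.1) z.2) ^ 2)) ∂(μ.prod μ) := by
          rw [← (measurePreserving_rotation (E := E) (Real.pi / 2 * s)).lintegral_comp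
            (f := fun z : E × E => ENNReal.ofReal (Real.exp (c *
              (inner ℝ ((Real.pi / 2) • gF z.1) z.2) ^ 2))) (by fun_prop)]
          refine lintegral_congr fun z => ?_
          simp only [hk, real_inner_smul_left]
          rw [mul_comm (Real.pi / 2) (inner ℝ _ _)]
        have h2 : AEMeasurable (fun z : E × E => ENNReal.ofReal (Real.exp (c *
              (inner ℝ ((Real.pi / 2) • gF z.1) z.2) ^ 2))) (μ.prod μ) :=
          Measurable.aemeasurable (by fun_prop)
        rw [h1, lintegral_prod _ h2]
        calc _ ≤ ∫⁻ y, 2 ∂μ := by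
              refine lintegral_mono fun y => ?_
              refine subG_inner (a := (Real.pi / 2) • gF y) (c := c) ?_
              rw [norm_smul, mul_pow, Real.norm_eq_abs, sq_abs]
              have h3 : ‖gF y‖ ^ 2 ≤ A ^ 2 := by gcongr; exact hA y
              have h4 : c * ‖gF y‖ ^ 2 * Real.pi ^ 2 ≤ c * A ^ 2 * Real.pi ^ 2 := by gcongr
              nlinarith
          _ = 2 := by simp
    _ = 2 := by simp

/-- Since `F` has mean zero, averaging `F y - F z` over `y` gives `-F z`; Jensen in `y` removes the
second copy. -/
theorem subG_of_gradient {F : E → ℝ} {gF : E → E} {A c : ℝ}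
    (hF : ∀ x, HasFDerivAt F (innerSL ℝ (gF x)) x) (hg : Continuous gF) (hA : ∀ x, ‖gF x‖ ≤ A)
    (hF0 : ∫ z, F z ∂(stdGaussian E) = 0)
    (hc0 : 0 ≤ c) (hc : c * A ^ 2 * Real.pi ^ 2 ≤ 1) : SubG (stdGaussian E) F c := by
  have hFi := integrable_of_gradient hF hA
  have hFc := continuous_of_gradient hF
  refine le_trans ?_ (subG_sub_of_gradient hF hg hA hc0 hc)
  rw [lintegral_prod _ (Measurable.aemeasurable (by fun_prop))]
  refine lintegral_mono fun z => ?_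
  have h := ofReal_exp_sq_integral_le (μ := stdGaussian E) (f := fun y => F y - F z)
    (hFi.sub (integrable_const _)) hc0
  rw [integral_sub hFi (integrable_const _), hF0] at h
  simpa using h

theorem integral_comp_rotation {g : E × E → ℝ} (hg : Measurable g) (θ : ℝ) :
    ∫ z : E × E, g (Real.cos θ • z.1 + Real.sin θ • z.2,
      -Real.sin θ • z.1 + Real.cos θ • z.2) ∂((stdGaussian E).prod (stdGaussian E)) =
    ∫ z, g z ∂((stdGaussian E).prod (stdGaussian E)) := by
  have h := measurePreserving_rotation (E := E) θ
  conv_rhs => rw [← h.map_eq]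
  rw [integral_map h.measurable.aemeasurable hg.aestronglyMeasurable]

theorem integrable_norm_add_norm :
    Integrable (fun z : E × E => ‖z.1‖ + ‖z.2‖) ((stdGaussian E).prod (stdGaussian E)) :=
  (integrable_norm_stdGaussian.comp_fst _).add (integrable_norm_stdGaussian.comp_snd _)

theorem integrable_norm_add_norm_sq :
    Integrable (fun z : E × E => (‖z.1‖ + ‖z.2‖) ^ 2)
      ((stdGaussian E).prod (stdGaussian E)) := by
  refine Integrable.mono' (((integrable_norm_sq_stdGaussian.comp_fst (stdGaussian E)).add
    (integrable_norm_sq_stdGaussian.comp_snd (stdGaussian E))).const_mul 2) (by fun_prop)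
    (Eventually.of_forall fun z => ?_)
  rw [Real.norm_of_nonneg (by positivity)]
  simp only [Pi.add_apply]
  nlinarith [sq_nonneg (‖z.1‖ - ‖z.2‖)]

/-- Gaussian integration by parts, by rotation instead of densities. For every angle the rotated
pair is independent, so `E[f(z_θ) ⟨a, z'_θ⟩]` vanishes identically; its derivative at angle `0` is
`E[⟨∇f(z), z'⟩⟨a, z'⟩] - E[f(z)⟨a, z⟩]`, and integrating out `z'` gives the identity. -/
theorem integral_inner_mul_eq {f : E → ℝ} {gf : E → E} {M : ℝ}
    (hf : ∀ x, HasFDerivAt f (innerSL ℝ (gf x)) x) (hg : Continuous gf) (hM : ∀ x, ‖gf x‖ ≤ M)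
    (a : E) :
    ∫ z, inner ℝ a z * f z ∂(stdGaussian E) = ∫ z, inner ℝ (gf z) a ∂(stdGaussian E) := by
  set μ := stdGaussian E
  have hfc := continuous_of_gradient hf
  have hM0 : 0 ≤ M := (norm_nonneg _).trans (hM 0)
  have hfi := integrable_of_gradient hf hM
  have hzero : ∀ θ : ℝ, ∫ z : E × E, f (Real.cos θ • z.1 + Real.sin θ • z.2) *
      inner ℝ a (-Real.sin θ • z.1 + Real.cos θ • z.2) ∂(μ.prod μ) = 0 := by
    intro θ
    rw [integral_comp_rotation (g := fun z => f z.1 * inner ℝ a z.2) (by fun_prop),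
      integral_prod_mul (fun x => f x) (fun y => inner ℝ a y), integral_inner_stdGaussian, mul_zero]
  set G : ℝ → E × E → ℝ := fun θ z => f (Real.cos θ • z.1 + Real.sin θ • z.2) *
      inner ℝ a (-Real.sin θ • z.1 + Real.cos θ • z.2) with hG
  set G' : ℝ → E × E → ℝ := fun θ z =>
      inner ℝ (gf (Real.cos θ • z.1 + Real.sin θ • z.2))
        (-Real.sin θ • z.1 + Real.cos θ • z.2) *
        inner ℝ a (-Real.sin θ • z.1 + Real.cos θ • z.2) +
      f (Real.cos θ • z.1 + Real.sin θ • z.2) *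
        inner ℝ a (-(Real.cos θ • z.1 + Real.sin θ • z.2)) with hG'
  set B : E × E → ℝ := fun z => (M * ‖a‖ + M * ‖a‖) * (‖z.1‖ + ‖z.2‖) ^ 2 +
    |f 0| * ‖a‖ * (‖z.1‖ + ‖z.2‖) with hB
  have hBi : Integrable B (μ.prod μ) :=
    (integrable_norm_add_norm_sq.const_mul _).add (integrable_norm_add_norm.const_mul _)
  have hfbd : ∀ (θ : ℝ) (z : E × E), |f (Real.cos θ • z.1 + Real.sin θ • z.2)| ≤
      |f 0| + M * (‖z.1‖ + ‖z.2‖) := fun θ z => (abs_le_of_gradient hf hM _).trans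
        (by gcongr; exact norm_rotation_le z θ)
  have hder : ∀ z θ, HasDerivAt (fun θ => G θ z) (G' θ z) θ := by
    intro z θ
    have h1 := hasDerivAt_comp_rotation hf z θ
    have h2 : HasDerivAt (fun θ : ℝ => (inner ℝ a (-Real.sin θ • z.1 + Real.cos θ • z.2) : ℝ))
        (inner ℝ a (-(Real.cos θ • z.1 + Real.sin θ • z.2))) θ := by
      have h3 : HasDerivAt (fun θ : ℝ => -Real.sin θ • z.1 + Real.cos θ • z.2)
          (-(Real.cos θ • z.1 + Real.sin θ • z.2)) θ := by
        refine (((Real.hasDerivAt_sin θ).fun_neg.smul_const z.1).fun_add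
          ((Real.hasDerivAt_cos θ).smul_const z.2)).congr_deriv ?_
        module
      exact ((innerSL ℝ a).hasFDerivAt).comp_hasDerivAt θ h3
    exact h1.mul h2
  have hbd : ∀ z θ, ‖G' θ z‖ ≤ B z := by
    intro z θ
    have i1 : |inner ℝ (gf (Real.cos θ • z.1 + Real.sin θ • z.2))
        (-Real.sin θ • z.1 + Real.cos θ • z.2)| ≤ M * (‖z.1‖ + ‖z.2‖) :=
      (abs_real_inner_le_norm _ _).trans (mul_le_mul (hM _) (norm_rotation_deriv_le z θ)
        (norm_nonneg _) hM0)
    have i2 : |inner ℝ a (-Real.sin θ • z.1 + Real.cos θ • z.2)| ≤ ‖a‖ * (‖z.1‖ + ‖z.2‖) :=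
      (abs_real_inner_le_norm _ _).trans (by gcongr; exact norm_rotation_deriv_le z θ)
    have i3 : |inner ℝ a (-(Real.cos θ • z.1 + Real.sin θ • z.2))| ≤
        ‖a‖ * (‖z.1‖ + ‖z.2‖) :=
      (abs_real_inner_le_norm _ _).trans (by rw [norm_neg]; gcongr; exact norm_rotation_le z θ)
    rw [Real.norm_eq_abs]
    refine (abs_add_le _ _).trans ?_
    rw [abs_mul, abs_mul]
    calc _ ≤ M * (‖z.1‖ + ‖z.2‖) * (‖a‖ * (‖z.1‖ + ‖z.2‖)) +
          (|f 0| + M * (‖z.1‖ + ‖z.2‖)) * (‖a‖ * (‖z.1‖ + ‖z.2‖)) := by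
          gcongr
          exact hfbd θ z
      _ = B z := by simp only [hB]; ring
  have hG0 : Integrable (G 0) (μ.prod μ) := by
    have : G 0 = fun z : E × E => f z.1 * inner ℝ a z.2 := by
      ext z; simp [hG]
    rw [this]
    exact hfi.mul_prod ((memLp_inner_stdGaussian a).integrable one_le_two)
  obtain ⟨hi, hd⟩ := hasDerivAt_integral_of_dominated_loc_of_deriv_le (μ := μ.prod μ) (F := G)
    (F' := G') (x₀ := 0) (s := Set.univ) (bound := B) univ_mem
    (Eventually.of_forall fun θ => Measurable.aestronglyMeasurable (by fun_prop)) hG0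
    (Measurable.aestronglyMeasurable (by fun_prop))
    (Eventually.of_forall fun z θ _ => hbd z θ) hBi
    (Eventually.of_forall fun z θ _ => hder z θ)
  have hconst : HasDerivAt (fun θ => ∫ z, G θ z ∂(μ.prod μ)) 0 0 := by
    simp_rw [hG, hzero]
    exact hasDerivAt_const _ _
  have h0 := hd.unique hconst
  have hfa : Integrable (fun z => f z * inner ℝ a z) μ := by
    refine Integrable.mono' ((integrable_norm_stdGaussian.const_mul (|f 0| * ‖a‖)).add
      (integrable_norm_sq_stdGaussian.const_mul (M * ‖a‖))) (by fun_prop)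
      (Eventually.of_forall fun z => ?_)
    rw [Real.norm_eq_abs, abs_mul]
    calc _ ≤ (|f 0| + M * ‖z‖) * (‖a‖ * ‖z‖) := by
          gcongr
          · exact abs_le_of_gradient hf hM z
          · exact abs_real_inner_le_norm _ _
      _ = _ := by simp only [Pi.add_apply]; ring
  have hG'0 : G' 0 = fun z => inner ℝ (gf z.1) z.2 * inner ℝ a z.2 - f z.1 * inner ℝ a z.1 := by
    ext z; simp [hG', sub_eq_add_neg]
  rw [hG'0] at h0 hi
  have hsecond : Integrable (fun z : E × E => f z.1 * inner ℝ a z.1) (μ.prod μ) :=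
    hfa.comp_fst (ν := μ)
  have hfirst : Integrable (fun z : E × E => inner ℝ (gf z.1) z.2 * inner ℝ a z.2) (μ.prod μ) := by
    refine (hi.add hsecond).congr (Eventually.of_forall fun z => ?_)
    simp
  rw [integral_sub hfirst hsecond, integral_prod _ hfirst] at h0
  have h4 : ∀ x, ∫ y, inner ℝ (gf x) y * inner ℝ a y ∂μ = inner ℝ (gf x) a :=
    fun x => integral_inner_mul_inner_stdGaussian _ _
  simp_rw [h4] at h0
  have h3 : ∫ z : E × E, f z.1 * inner ℝ a z.1 ∂(μ.prod μ) = ∫ z, f z * inner ℝ a z ∂μ := by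
    rw [integral_prod _ hsecond]; simp
  rw [h3] at h0
  simp_rw [real_inner_comm a] at h0 ⊢
  simp_rw [mul_comm _ (f _)]
  linarith

/-- The covariance formula. Replace `F(z.1)` by minus the increment of `F` along the quarter circle
to an independent copy, rotate each angle back so that `∇F` is taken at `z.1`, and integrate by
parts in `z.2`. The weight `sin θ` is the coefficient of `z.2` in the rotated argument of `K`. -/
theorem integral_mul_eq_intervalIntegral {F K : E → ℝ} {gF gK : E → E} {A B : ℝ}
    (hF : ∀ x, HasFDerivAt F (innerSL ℝ (gF x)) x) (hgF : Continuous gF) (hA : ∀ x, ‖gF x‖ ≤ A)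
    (hK : ∀ x, HasFDerivAt K (innerSL ℝ (gK x)) x) (hgK : Continuous gK) (hB : ∀ x, ‖gK x‖ ≤ B)
    (hF0 : ∫ z, F z ∂(stdGaussian E) = 0) :
    ∫ z, F z * K z ∂(stdGaussian E) = ∫ θ in (0 : ℝ)..(Real.pi / 2), Real.sin θ *
      ∫ z, inner ℝ (gF z.1) (gK (Real.cos θ • z.1 - Real.sin θ • z.2))
        ∂((stdGaussian E).prod (stdGaussian E)) := by
  set μ := stdGaussian E
  have hFc := continuous_of_gradient hF
  have hKc := continuous_of_gradient hK
  have hA0 : 0 ≤ A := (norm_nonneg _).trans (hA 0)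
  have hB0 : 0 ≤ B := (norm_nonneg _).trans (hB 0)
  have hpi : (0 : ℝ) ≤ Real.pi / 2 := by positivity
  have hFi := integrable_of_gradient hF hA
  have hKi := integrable_of_gradient hK hB
  have hFK : Integrable (fun z => F z * K z) μ := by
    refine Integrable.mono' (((integrable_const (|F 0| * |K 0|)).add
      (integrable_norm_stdGaussian.const_mul (|F 0| * B + |K 0| * A))).add
      (integrable_norm_sq_stdGaussian.const_mul (A * B))) (by fun_prop)
      (Eventually.of_forall fun z => ?_)
    rw [Real.norm_eq_abs, abs_mul]
    calc _ ≤ (|F 0| + A * ‖z‖) * (|K 0| + B * ‖z‖) := by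
          gcongr
          · exact abs_le_of_gradient hF hA z
          · exact abs_le_of_gradient hK hB z
      _ = _ := by simp only [Pi.add_apply]; ring
  have hdiff : ∀ z : E × E, F z.2 - F z.1 = ∫ θ in Set.Ioc 0 (Real.pi / 2),
      inner ℝ (gF (Real.cos θ • z.1 + Real.sin θ • z.2))
        (-Real.sin θ • z.1 + Real.cos θ • z.2) := by
    intro z
    rw [← intervalIntegral.integral_of_le hpi,
      intervalIntegral.integral_eq_sub_of_hasDerivAt
        (fun θ _ => hasDerivAt_comp_rotation hF z θ)
        (Continuous.intervalIntegrable (by fun_prop) _ _)]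
    simp
  -- The product `F(z.2) K(z.1)` integrates to zero by independence and `E F = 0`.
  have h1 : ∫ z, F z * K z ∂μ = -∫ z : E × E, (F z.2 - F z.1) * K z.1 ∂(μ.prod μ) := by
    have e1 : Integrable (fun z : E × E => K z.1 * F z.2) (μ.prod μ) := hKi.mul_prod hFi
    have e2 : Integrable (fun z : E × E => F z.1 * K z.1) (μ.prod μ) :=
      Integrable.comp_fst (f := fun z => F z * K z) hFK μ
    have : (fun z : E × E => (F z.2 - F z.1) * K z.1) =
        fun z => K z.1 * F z.2 - F z.1 * K z.1 := by ext z; ring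
    rw [this, integral_sub e1 e2, integral_prod_mul (fun x => K x) (fun y => F y), hF0,
      integral_prod _ e2]
    simp
  have hint : Integrable (fun q : (E × E) × ℝ =>
      inner ℝ (gF (Real.cos q.2 • q.1.1 + Real.sin q.2 • q.1.2))
        (-Real.sin q.2 • q.1.1 + Real.cos q.2 • q.1.2) * K q.1.1)
      ((μ.prod μ).prod (volume.restrict (Set.Ioc 0 (Real.pi / 2)))) := by
    have hb : Integrable (fun z : E × E => A * |K 0| * (‖z.1‖ + ‖z.2‖) +
        A * B * (‖z.1‖ + ‖z.2‖) ^ 2) (μ.prod μ) :=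
      (integrable_norm_add_norm.const_mul _).add (integrable_norm_add_norm_sq.const_mul _)
    refine Integrable.mono' (hb.comp_fst (volume.restrict (Set.Ioc 0 (Real.pi / 2))))
      (Measurable.aestronglyMeasurable (by fun_prop)) (Eventually.of_forall fun q => ?_)
    rw [Real.norm_eq_abs, abs_mul]
    calc _ ≤ (A * (‖q.1.1‖ + ‖q.1.2‖)) * (|K 0| + B * (‖q.1.1‖ + ‖q.1.2‖)) := by
          gcongr
          · exact (abs_real_inner_le_norm _ _).trans (mul_le_mul (hA _)
              (norm_rotation_deriv_le q.1 q.2) (norm_nonneg _) hA0)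
          · refine (abs_le_of_gradient hK hB _).trans ?_
            gcongr
            linarith [norm_nonneg q.1.2]
      _ = _ := by ring
  have h2 : ∫ z : E × E, (F z.2 - F z.1) * K z.1 ∂(μ.prod μ) =
      ∫ θ in Set.Ioc 0 (Real.pi / 2), ∫ z : E × E,
        inner ℝ (gF (Real.cos θ • z.1 + Real.sin θ • z.2))
        (-Real.sin θ • z.1 + Real.cos θ • z.2) * K z.1 ∂(μ.prod μ) := by
    rw [← integral_integral_swap hint]
    refine integral_congr_ae (Eventually.of_forall fun z => ?_)
    simp only [hdiff, integral_mul_const]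
  have h3 : ∀ θ : ℝ, ∫ z : E × E,
        inner ℝ (gF (Real.cos θ • z.1 + Real.sin θ • z.2))
        (-Real.sin θ • z.1 + Real.cos θ • z.2) * K z.1 ∂(μ.prod μ) =
      -(Real.sin θ * ∫ z, inner ℝ (gF z.1) (gK (Real.cos θ • z.1 - Real.sin θ • z.2))
        ∂(μ.prod μ)) := by
    intro θ
    have e0 : Integrable (fun z : E × E =>
        inner ℝ (gF z.1) z.2 * K (Real.cos θ • z.1 - Real.sin θ • z.2)) (μ.prod μ) := by
      have hb : Integrable (fun z : E × E => A * |K 0| * (‖z.1‖ + ‖z.2‖) +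
          A * B * (‖z.1‖ + ‖z.2‖) ^ 2) (μ.prod μ) :=
        (integrable_norm_add_norm.const_mul _).add (integrable_norm_add_norm_sq.const_mul _)
      refine Integrable.mono' hb
        (Measurable.aestronglyMeasurable (by fun_prop)) (Eventually.of_forall fun q => ?_)
      rw [Real.norm_eq_abs, abs_mul]
      calc _ ≤ (A * (‖q.1‖ + ‖q.2‖)) * (|K 0| + B * (‖q.1‖ + ‖q.2‖)) := by
            gcongr
            · exact (abs_real_inner_le_norm _ _).trans (mul_le_mul (hA _)
                (by linarith [norm_nonneg q.1]) (norm_nonneg _) hA0)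
            · refine (abs_le_of_gradient hK hB _).trans ?_
              gcongr
              have := norm_rotation_le q (-θ)
              simpa [sub_eq_add_neg] using this
        _ = _ := by ring
    -- In the rotated coordinates the old `z.1` is `cos θ • z.1 - sin θ • z.2`.
    have e1 : ∫ z : E × E,
        inner ℝ (gF (Real.cos θ • z.1 + Real.sin θ • z.2))
        (-Real.sin θ • z.1 + Real.cos θ • z.2) * K z.1 ∂(μ.prod μ) =
        ∫ z : E × E, inner ℝ (gF z.1) z.2 * K (Real.cos θ • z.1 - Real.sin θ • z.2)
          ∂(μ.prod μ) := by
      rw [← integral_comp_rotation (g := fun z : E × E =>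
        inner ℝ (gF z.1) z.2 * K (Real.cos θ • z.1 - Real.sin θ • z.2)) (by fun_prop) θ]
      refine integral_congr_ae (Eventually.of_forall fun z => ?_)
      simp only
      have e : Real.cos θ • (Real.cos θ • z.1 + Real.sin θ • z.2) -
          Real.sin θ • (-Real.sin θ • z.1 + Real.cos θ • z.2) =
          (Real.cos θ ^ 2 + Real.sin θ ^ 2) • z.1 := by module
      rw [e, Real.cos_sq_add_sin_sq, one_smul]
    have e2 : Integrable (fun z : E × E =>
        (inner ℝ (gF z.1) (gK (Real.cos θ • z.1 - Real.sin θ • z.2)) : ℝ)) (μ.prod μ) := by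
      refine Integrable.mono' (integrable_const (A * B))
        (Measurable.aestronglyMeasurable (by fun_prop)) (Eventually.of_forall fun q => ?_)
      exact (abs_real_inner_le_norm _ _).trans (mul_le_mul (hA _) (hB _) (norm_nonneg _) hA0)
    rw [e1, integral_prod _ e0, integral_prod _ e2, ← integral_const_mul, ← integral_neg]
    refine integral_congr_ae (Eventually.of_forall fun y => ?_)
    simp only
    rw [integral_inner_mul_eq (f := fun y' => K (Real.cos θ • y - Real.sin θ • y'))
      (gf := fun y' => -Real.sin θ • gK (Real.cos θ • y - Real.sin θ • y')) (M := B)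
      (fun y' => ?_) (by fun_prop) (fun y' => ?_), ← integral_const_mul, ← integral_neg]
    · refine integral_congr_ae (Eventually.of_forall fun y' => ?_)
      simp only
      rw [real_inner_smul_left, real_inner_comm, neg_mul]
    · have h4 : HasFDerivAt (fun y' : E => Real.cos θ • y - Real.sin θ • y')
          (-(Real.sin θ • ContinuousLinearMap.id ℝ E)) y' :=
        ((hasFDerivAt_id y').const_smul (Real.sin θ)).const_sub _
      have h5 := (hK (Real.cos θ • y - Real.sin θ • y')).comp y' h4
      refine h5.congr_fderiv ?_
      ext v
      simp
    · rw [norm_smul, norm_neg, Real.norm_eq_abs]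
      have := mul_le_mul (Real.abs_sin_le_one θ)
        (hB (Real.cos θ • y - Real.sin θ • y')) (norm_nonneg _) zero_le_one
      linarith
  rw [h1, h2, intervalIntegral.integral_of_le hpi, ← integral_neg]
  refine integral_congr_ae (Eventually.of_forall fun θ => ?_)
  simp only
  rw [h3, neg_neg]

end GaussianCalculus

end RandomFeatures

namespace RandomFeatures

/-! ### Variance bounds -/

section Variance

theorem integrable_of_abs_le {α : Type*} [MeasurableSpace α] {μ : Measure α} [IsFiniteMeasure μ]
    {f : α → ℝ} (hf : Measurable f) {M : ℝ} (h : ∀ x, |f x| ≤ M) : Integrable f μ :=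
  Integrable.of_bound hf.aestronglyMeasurable M (Eventually.of_forall h)

theorem memLp_two_of_abs_le {α : Type*} [MeasurableSpace α] {μ : Measure α} [IsFiniteMeasure μ]
    {f : α → ℝ} (hf : Measurable f) {M : ℝ} (h : ∀ x, |f x| ≤ M) : MemLp f 2 μ :=
  MemLp.of_bound hf.aestronglyMeasurable M (Eventually.of_forall h)

theorem abs_integral_le_of_abs_le {α : Type*} [MeasurableSpace α] {μ : Measure α}
    [IsProbabilityMeasure μ] {f : α → ℝ} {M : ℝ} (h : ∀ x, |f x| ≤ M) : |∫ x, f x ∂μ| ≤ M := by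
  have := norm_integral_le_of_norm_le_const (μ := μ) (f := f) (Eventually.of_forall h)
  simpa using this

theorem sq_integral_le {α : Type*} [MeasurableSpace α] {μ : Measure α} [IsProbabilityMeasure μ]
    {f : α → ℝ} (hf : MemLp f 2 μ) : (∫ x, f x ∂μ) ^ 2 ≤ ∫ x, f x ^ 2 ∂μ := by
  have h := variance_nonneg f μ
  rw [variance_eq_sub hf] at h
  simpa using h

/-- Cauchy–Schwarz from the discriminant of `t ↦ ∫ (t f + g)²`. -/
theorem abs_integral_mul_le {α : Type*} [MeasurableSpace α] {μ : Measure α}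
    {f g : α → ℝ} (hf : MemLp f 2 μ) (hg : MemLp g 2 μ) {a b : ℝ} (ha : 0 ≤ a) (hb : 0 ≤ b)
    (hfa : ∫ x, f x ^ 2 ∂μ ≤ a ^ 2) (hgb : ∫ x, g x ^ 2 ∂μ ≤ b ^ 2) :
    |∫ x, f x * g x ∂μ| ≤ a * b := by
  have h1 := hf.integrable_sq
  have h2 := hg.integrable_sq
  have h3 : Integrable (fun x => f x * g x) μ := hf.integrable_mul hg
  have key : ∀ t : ℝ, 0 ≤ (∫ x, f x ^ 2 ∂μ) * (t * t) + (2 * ∫ x, f x * g x ∂μ) * t +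
      ∫ x, g x ^ 2 ∂μ := by
    intro t
    have : ∫ x, (t * f x + g x) ^ 2 ∂μ = (∫ x, f x ^ 2 ∂μ) * (t * t) +
        (2 * ∫ x, f x * g x ∂μ) * t + ∫ x, g x ^ 2 ∂μ := by
      have e : ∀ x, (t * f x + g x) ^ 2 = (t * t) * f x ^ 2 + (2 * t) * (f x * g x) + g x ^ 2 :=
        fun x => by ring
      simp_rw [e]
      rw [integral_add (f := fun x => t * t * f x ^ 2 + 2 * t * (f x * g x))
          ((h1.const_mul _).add (h3.const_mul _)) h2,
        integral_add (h1.const_mul _) (h3.const_mul _), integral_const_mul, integral_const_mul]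
      ring
    rw [← this]
    exact integral_nonneg fun x => sq_nonneg _
  have hd := discrim_le_zero key
  rw [discrim] at hd
  refine abs_le_of_sq_le_sq ?_ (by positivity)
  have h4 : (∫ x, f x ^ 2 ∂μ) * (∫ x, g x ^ 2 ∂μ) ≤ a ^ 2 * b ^ 2 :=
    mul_le_mul hfa hgb (integral_nonneg fun x => sq_nonneg _) (sq_nonneg _)
  nlinarith

variable {E : Type*} [NormedAddCommGroup E] [InnerProductSpace ℝ E] [FiniteDimensional ℝ E]
  [MeasurableSpace E] [BorelSpace E]

theorem exists_gradient {f : E → ℝ} (hf : ContDiff ℝ 1 f) {C : ℝ} (hC : 0 ≤ C)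
    (hlip : ∀ x y, |f x - f y| ≤ C * ‖x - y‖) :
    ∃ gf : E → E, (∀ x, HasFDerivAt f (innerSL ℝ (gf x)) x) ∧ Continuous gf ∧
      ∀ x, ‖gf x‖ ≤ C := by
  refine ⟨fun x => (InnerProductSpace.toDual ℝ E).symm (fderiv ℝ f x), fun x => ?_, ?_, fun x => ?_⟩
  · have h := (hf.differentiable one_ne_zero x).hasFDerivAt
    refine h.congr_fderiv ?_
    ext v
    rw [innerSL_apply_apply, InnerProductSpace.toDual_symm_apply]
  · exact (LinearIsometryEquiv.continuous _).comp (hf.continuous_fderiv one_ne_zero)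
  · rw [LinearIsometryEquiv.norm_map]
    refine norm_fderiv_le_of_lip' ℝ hC (Eventually.of_forall fun y => ?_)
    exact hlip y x

/-- A Gaussian Poincaré inequality with a non-optimal constant: the variance is at most the second
moment of `f(y) - f(x)` for an independent copy, and that difference is subgaussian with parameter
`1/(C²π²)`. -/
theorem integral_sq_sub_integral_le {f : E → ℝ} (hf : ContDiff ℝ 1 f) {C M : ℝ} (hC : 0 < C)
    (hlip : ∀ x y, |f x - f y| ≤ C * ‖x - y‖) (hM : ∀ x, |f x| ≤ M) :
    ∫ x, (f x - ∫ y, f y ∂(stdGaussian E)) ^ 2 ∂(stdGaussian E) ≤ Real.pi ^ 2 * C ^ 2 := by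
  set μ := stdGaussian E
  obtain ⟨gf, h1, h2, h3⟩ := exists_gradient hf hC.le hlip
  have hpi := Real.pi_pos
  have hfm : Measurable f := hf.continuous.measurable
  have hfi : Integrable f μ := integrable_of_abs_le hfm hM
  have hs := subG_sub_of_gradient (c := 1 / (C ^ 2 * Real.pi ^ 2)) h1 h2 h3 (by positivity)
    (by field_simp; exact le_refl _)
  obtain ⟨i1, i2⟩ := hs.integral_sq_le (by positivity) (Measurable.aemeasurable (by fun_prop))
  have hb : ∀ x y, |f y - f x| ≤ M + M := fun x y =>
    (abs_sub _ _).trans (add_le_add (hM y) (hM x))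
  have hm : |∫ y, f y ∂μ| ≤ M := abs_integral_le_of_abs_le hM
  calc ∫ x, (f x - ∫ y, f y ∂μ) ^ 2 ∂μ ≤ ∫ x, ∫ y, (f y - f x) ^ 2 ∂μ ∂μ := by
        refine integral_mono ?_ i1.integral_prod_left fun x => ?_
        · have := (memLp_two_of_abs_le (μ := μ) (f := fun x => f x - ∫ y, f y ∂μ) (by fun_prop)
            (M := M + M) fun x => (abs_sub _ _).trans (add_le_add (hM x) hm)).integrable_sq
          exact this
        · have h4 : f x - ∫ y, f y ∂μ = -∫ y, (f y - f x) ∂μ := by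
            rw [integral_sub hfi (integrable_const _)]; simp
          simp only
          rw [h4, neg_sq]
          exact sq_integral_le (memLp_two_of_abs_le (by fun_prop) (hb x))
    _ = ∫ z : E × E, (f z.2 - f z.1) ^ 2 ∂(μ.prod μ) := (integral_prod _ i1).symm
    _ ≤ 1 / (1 / (C ^ 2 * Real.pi ^ 2)) := i2
    _ = _ := by field_simp

/-- Split `T - E T` into `T - E[T | z.1]` and `E[T | z.1] - E T`. The one-variable inequality bounds
both second moments by `π² C²`; the factor `4` comes from `(a + b)² ≤ 2a² + 2b²`. -/
theorem integral_prod_sq_sub_integral_le {T : E × E → ℝ} (hT : ContDiff ℝ 1 T) {C M : ℝ}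
    (hC : 0 < C) (h₁ : ∀ x y w, |T (x, w) - T (y, w)| ≤ C * ‖x - y‖)
    (h₂ : ∀ x y w, |T (w, x) - T (w, y)| ≤ C * ‖x - y‖) (hM : ∀ x, |T x| ≤ M) :
    ∫ z, (T z - ∫ w, T w ∂((stdGaussian E).prod (stdGaussian E))) ^ 2
      ∂((stdGaussian E).prod (stdGaussian E)) ≤ (2 * Real.pi * C) ^ 2 := by
  set μ := stdGaussian E
  have hTm : Measurable T := hT.continuous.measurable
  have hTi : Integrable T (μ.prod μ) := integrable_of_abs_le hTm hM
  set m := ∫ w, T w ∂(μ.prod μ) with hm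
  set h : E → ℝ := fun x => ∫ y, T (x, y) ∂μ with hh
  set k : E → ℝ := fun y => ∫ x, T (x, y) ∂μ with hk
  have hhm : Measurable h :=
    (hTm.stronglyMeasurable.integral_prod_right' (ν := μ)).measurable
  have hkm : Measurable k :=
    (hTm.stronglyMeasurable.integral_prod_left' (μ := μ)).measurable
  have hhM : ∀ x, |h x| ≤ M := fun x => abs_integral_le_of_abs_le fun y => hM _
  have hkM : ∀ x, |k x| ≤ M := fun x => abs_integral_le_of_abs_le fun y => hM _
  have hmM : |m| ≤ M := abs_integral_le_of_abs_le hM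
  have hsec : ∀ x, ContDiff ℝ 1 (fun y => T (x, y)) := fun x =>
    hT.comp (contDiff_const.prodMk contDiff_id)
  have hsec' : ∀ y, ContDiff ℝ 1 (fun x => T (x, y)) := fun y =>
    hT.comp (contDiff_id.prodMk contDiff_const)
  have hmk : m = ∫ y, k y ∂μ := by rw [hm, integral_prod_symm _ hTi]
  have i1 : Integrable (fun z : E × E => (T z - h z.1) ^ 2) (μ.prod μ) :=
    (memLp_two_of_abs_le (by fun_prop) (M := M + M) fun z =>
      (abs_sub _ _).trans (add_le_add (hM z) (hhM z.1))).integrable_sq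
  have i2 : Integrable (fun z : E × E => (T z - k z.2) ^ 2) (μ.prod μ) :=
    (memLp_two_of_abs_le (by fun_prop) (M := M + M) fun z =>
      (abs_sub _ _).trans (add_le_add (hM z) (hkM z.2))).integrable_sq
  have i3 : Integrable (fun x => (h x - m) ^ 2) μ :=
    (memLp_two_of_abs_le (by fun_prop) (M := M + M) fun z =>
      (abs_sub _ _).trans (add_le_add (hhM z) hmM)).integrable_sq
  have b1 : ∫ z : E × E, (T z - h z.1) ^ 2 ∂(μ.prod μ) ≤ Real.pi ^ 2 * C ^ 2 := by
    rw [integral_prod _ i1]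
    calc _ ≤ ∫ x, Real.pi ^ 2 * C ^ 2 ∂μ := by
          refine integral_mono i1.integral_prod_left (integrable_const _) fun x => ?_
          exact integral_sq_sub_integral_le (hsec x) hC (fun _ _ => h₂ _ _ _) fun y => hM _
      _ = _ := by simp
  -- Here `h x - m` is the average over `y` of `T(x, y) - E_x T(x, y)`; Jensen in `y` reduces to the
  -- Poincaré inequality in `x`.
  have b2 : ∫ x, (h x - m) ^ 2 ∂μ ≤ Real.pi ^ 2 * C ^ 2 := by
    calc ∫ x, (h x - m) ^ 2 ∂μ ≤ ∫ x, ∫ y, (T (x, y) - k y) ^ 2 ∂μ ∂μ := by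
          refine integral_mono i3 i2.integral_prod_left fun x => ?_
          have e : h x - m = ∫ y, (T (x, y) - k y) ∂μ := by
            rw [hmk, hh, ← integral_sub (integrable_of_abs_le (by fun_prop) fun y => hM _)
              (integrable_of_abs_le hkm hkM)]
          simp only
          rw [e]
          exact sq_integral_le (memLp_two_of_abs_le (by fun_prop) (M := M + M) fun y =>
            (abs_sub _ _).trans (add_le_add (hM _) (hkM y)))
      _ = ∫ y, ∫ x, (T (x, y) - k y) ^ 2 ∂μ ∂μ := by
          rw [← integral_prod _ i2, integral_prod_symm _ i2]
      _ ≤ ∫ y, Real.pi ^ 2 * C ^ 2 ∂μ := by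
          refine integral_mono i2.integral_prod_right (integrable_const _) fun y => ?_
          exact integral_sq_sub_integral_le (hsec' y) hC (fun _ _ => h₁ _ _ _) fun x => hM _
      _ = _ := by simp
  have hb : Integrable (fun z : E × E => (h z.1 - m) ^ 2) (μ.prod μ) :=
    Integrable.comp_fst (f := fun x => (h x - m) ^ 2) i3 μ
  calc ∫ z, (T z - m) ^ 2 ∂(μ.prod μ)
      ≤ ∫ z : E × E, (2 * (T z - h z.1) ^ 2 + 2 * (h z.1 - m) ^ 2) ∂(μ.prod μ) := by
        refine integral_mono ?_ ((i1.const_mul 2).add (hb.const_mul 2)) fun z => ?_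
        · exact (memLp_two_of_abs_le (by fun_prop) (M := M + M) fun z =>
            (abs_sub _ _).trans (add_le_add (hM z) hmM)).integrable_sq
        · simp only
          nlinarith [sq_nonneg (T z - h z.1 - (h z.1 - m))]
    _ = 2 * ∫ z : E × E, (T z - h z.1) ^ 2 ∂(μ.prod μ) + 2 * ∫ x, (h x - m) ^ 2 ∂μ := by
        rw [integral_add (i1.const_mul 2) (hb.const_mul 2), integral_const_mul,
          integral_const_mul]
        congr 2
        rw [integral_prod _ hb]; simp
    _ ≤ _ := by nlinarith

end Variance

end RandomFeatures

namespace RandomFeatures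

/-! ### Gaussian comparison for functions of finitely many smooth features -/

section Comparison

variable {E₁ E₂ : Type*} [NormedAddCommGroup E₁] [InnerProductSpace ℝ E₁]
  [FiniteDimensional ℝ E₁] [MeasurableSpace E₁] [BorelSpace E₁] [NormedAddCommGroup E₂]
  [InnerProductSpace ℝ E₂] [FiniteDimensional ℝ E₂] [MeasurableSpace E₂] [BorelSpace E₂]
  {J : Type*} [Fintype J]

/-- Centered smooth functions `F j` of a standard Gaussian vector together with linear functionals
`⟨a j, ·⟩` of another standard Gaussian vector having the same covariances. -/
structure MatchedFeatures (E₁ E₂ : Type*) [NormedAddCommGroup E₁] [InnerProductSpace ℝ E₁]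
    [FiniteDimensional ℝ E₁] [MeasurableSpace E₁] [BorelSpace E₁] [NormedAddCommGroup E₂]
    [InnerProductSpace ℝ E₂] (J : Type*) where
  F : J → E₁ → ℝ
  gF : J → E₁ → E₁
  a : J → E₂
  A : ℝ
  B : ℝ
  A_pos : 0 < A
  B_pos : 0 < B
  hasFDerivAt_F : ∀ j x, HasFDerivAt (F j) (innerSL ℝ (gF j x)) x
  contDiff_gF : ∀ j, ContDiff ℝ 1 (gF j)
  norm_gF_le : ∀ j x, ‖gF j x‖ ≤ A
  lip_gF : ∀ j x y, ‖gF j x - gF j y‖ ≤ B * ‖x - y‖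
  mean_zero : ∀ j, ∫ z, F j z ∂(stdGaussian E₁) = 0
  inner_a : ∀ j j', inner ℝ (a j) (a j') = ∫ z, F j z * F j' z ∂(stdGaussian E₁)

/-- A bounded test function on `ℝ^J` with explicit bounded partial derivatives of order at most
two. -/
structure SmoothTest (J : Type*) [Fintype J] where
  H : (J → ℝ) → ℝ
  H1 : J → (J → ℝ) → ℝ
  H2 : J → J → (J → ℝ) → ℝ
  M : ℝ
  hasFDerivAt_H : ∀ u, HasFDerivAt H
    (∑ j, H1 j u • (ContinuousLinearMap.proj j : (J → ℝ) →L[ℝ] ℝ)) u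
  hasFDerivAt_H1 : ∀ j u, HasFDerivAt (H1 j)
    (∑ j', H2 j j' u • (ContinuousLinearMap.proj j' : (J → ℝ) →L[ℝ] ℝ)) u
  continuous_H2 : ∀ j j', Continuous (H2 j j')
  abs_H_le : ∀ u, |H u| ≤ M
  abs_H1_le : ∀ j u, |H1 j u| ≤ M
  abs_H2_le : ∀ j j' u, |H2 j j' u| ≤ M

theorem SmoothTest.continuous_H (h : SmoothTest J) : Continuous h.H :=
  continuous_iff_continuousAt.2 fun u => (h.hasFDerivAt_H u).continuousAt

theorem SmoothTest.continuous_H1 (h : SmoothTest J) (j : J) : Continuous (h.H1 j) :=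
  continuous_iff_continuousAt.2 fun u => (h.hasFDerivAt_H1 j u).continuousAt

theorem SmoothTest.M_nonneg (h : SmoothTest J) : 0 ≤ h.M := (abs_nonneg _).trans (h.abs_H_le 0)

theorem hasFDerivAt_comp_features {E : Type*} [NormedAddCommGroup E] [InnerProductSpace ℝ E]
    {h : (J → ℝ) → ℝ} {h1 : J → (J → ℝ) → ℝ}
    (hh : ∀ u, HasFDerivAt h (∑ j, h1 j u • (ContinuousLinearMap.proj j : (J → ℝ) →L[ℝ] ℝ)) u)
    {x : E → J → ℝ} {gx : J → E → E} (z : E)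
    (hx : ∀ j, HasFDerivAt (fun z => x z j) (innerSL ℝ (gx j z)) z) :
    HasFDerivAt (fun z => h (x z)) (innerSL ℝ (∑ j, h1 j (x z) • gx j z)) z := by
  have h2 : HasFDerivAt x (ContinuousLinearMap.pi fun j => innerSL ℝ (gx j z)) z :=
    hasFDerivAt_pi.2 hx
  refine ((hh (x z)).comp z h2).congr_fderiv ?_
  ext v
  simp only [map_sum, map_smul]
  simp

namespace MatchedFeatures

variable (f : MatchedFeatures E₁ E₂ J)

/-- The interpolating vector. -/
noncomputable def mix (s r : ℝ) (z : E₁) (ξ : E₂) : J → ℝ := fun j => s * f.F j z + r * inner ℝ (f.a j) ξ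

/-- The inner product of the gradients at two correlated points. -/
noncomputable def gradInner (j j' : J) (θ : ℝ) (w : E₁ × E₁) : ℝ :=
  inner ℝ (f.gF j w.1) (f.gF j' (Real.cos θ • w.1 - Real.sin θ • w.2))

theorem continuous_F (j : J) : Continuous (f.F j) := continuous_of_gradient (f.hasFDerivAt_F j)

theorem continuous_gF (j : J) : Continuous (f.gF j) := (f.contDiff_gF j).continuous

theorem continuous_mix (s r : ℝ) : Continuous fun q : E₁ × E₂ => f.mix s r q.1 q.2 := by
  have := f.continuous_F
  unfold mix
  fun_prop

theorem abs_gradInner_le (j j' : J) (θ : ℝ) (w : E₁ × E₁) : |f.gradInner j j' θ w| ≤ f.A ^ 2 := by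
  refine (abs_real_inner_le_norm _ _).trans ?_
  rw [sq]
  exact mul_le_mul (f.norm_gF_le _ _) (f.norm_gF_le _ _) (norm_nonneg _) f.A_pos.le

theorem continuous_gradInner (j j' : J) :
    Continuous fun q : ℝ × (E₁ × E₁) => f.gradInner j j' q.1 q.2 := by
  have := f.continuous_gF
  unfold gradInner
  fun_prop

/-- Each factor has norm at most `A` and Lipschitz constant at most `B`, and the first variable
occurs in both factors, so the product is `2AB`-Lipschitz in each variable. -/
theorem variance_gradInner_le (j j' : J) (θ : ℝ) :
    ∫ z, (f.gradInner j j' θ z -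
      ∫ w, f.gradInner j j' θ w ∂((stdGaussian E₁).prod (stdGaussian E₁))) ^ 2
      ∂((stdGaussian E₁).prod (stdGaussian E₁)) ≤ (4 * Real.pi * (f.A * f.B)) ^ 2 := by
  have hA := f.A_pos
  have hB := f.B_pos
  have hpt : ∀ p q p' q' : E₁, |inner ℝ (f.gF j p) (f.gF j' q) - inner ℝ (f.gF j p') (f.gF j' q')|
      ≤ f.A * f.B * (‖p - p'‖ + ‖q - q'‖) := by
    intro p q p' q'
    have e : inner ℝ (f.gF j p) (f.gF j' q) - inner ℝ (f.gF j p') (f.gF j' q') =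
        inner ℝ (f.gF j p - f.gF j p') (f.gF j' q) +
          inner ℝ (f.gF j p') (f.gF j' q - f.gF j' q') := by
      rw [inner_sub_left, inner_sub_right]; ring
    rw [e]
    calc _ ≤ ‖f.gF j p - f.gF j p'‖ * ‖f.gF j' q‖ + ‖f.gF j p'‖ * ‖f.gF j' q - f.gF j' q'‖ :=
          (abs_add_le _ _).trans (add_le_add (abs_real_inner_le_norm _ _)
            (abs_real_inner_le_norm _ _))
      _ ≤ (f.B * ‖p - p'‖) * f.A + f.A * (f.B * ‖q - q'‖) := by
          gcongr
          · exact f.lip_gF _ _ _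
          · exact f.norm_gF_le _ _
          · exact f.norm_gF_le _ _
          · exact f.lip_gF _ _ _
      _ = _ := by ring
  have h := integral_prod_sq_sub_integral_le (T := f.gradInner j j' θ) (C := 2 * (f.A * f.B))
    (M := f.A ^ 2) ?_ (by positivity) ?_ ?_ (f.abs_gradInner_le j j' θ)
  · refine h.trans (le_of_eq ?_); ring
  · have h1 := f.contDiff_gF j
    have h2 := f.contDiff_gF j'
    unfold gradInner
    exact ContDiff.inner ℝ (h1.comp contDiff_fst) (h2.comp (by fun_prop))
  · intro x y w
    refine (hpt _ _ _ _).trans ?_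
    have : ‖(Real.cos θ • x - Real.sin θ • w) - (Real.cos θ • y - Real.sin θ • w)‖ ≤ ‖x - y‖ := by
      rw [sub_sub_sub_cancel_right, ← smul_sub, norm_smul, Real.norm_eq_abs]
      exact mul_le_of_le_one_left (norm_nonneg _) (Real.abs_cos_le_one θ)
    have h3 : f.A * f.B * (‖x - y‖ + ‖(Real.cos θ • x - Real.sin θ • w) -
        (Real.cos θ • y - Real.sin θ • w)‖) ≤ f.A * f.B * (‖x - y‖ + ‖x - y‖) := by gcongr
    linarith
  · intro x y w
    refine (hpt _ _ _ _).trans ?_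
    have : ‖(Real.cos θ • w - Real.sin θ • x) - (Real.cos θ • w - Real.sin θ • y)‖ ≤ ‖x - y‖ := by
      rw [sub_sub_sub_cancel_left, ← smul_sub, norm_smul, Real.norm_eq_abs, norm_sub_rev]
      exact mul_le_of_le_one_left (norm_nonneg _) (Real.abs_sin_le_one θ)
    have h3 : f.A * f.B * (‖w - w‖ + ‖(Real.cos θ • w - Real.sin θ • x) -
        (Real.cos θ • w - Real.sin θ • y)‖) ≤ f.A * f.B * (0 + ‖x - y‖) := by
      rw [sub_self, norm_zero]; gcongr
    have h4 : 0 ≤ f.A * f.B * ‖x - y‖ := by positivity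
    linarith

variable (h : SmoothTest J)

/-- The correlation of a second partial derivative with the inner product of the gradients. -/
noncomputable def corr (s r : ℝ) (j j' : J) (θ : ℝ) : ℝ :=
  ∫ q : (E₁ × E₁) × E₂, h.H2 j j' (f.mix s r (Real.cos θ • q.1.1 - Real.sin θ • q.1.2) q.2) *
    f.gradInner j j' θ q.1 ∂(((stdGaussian E₁).prod (stdGaussian E₁)).prod (stdGaussian E₂))

theorem continuous_H2_mix (s r : ℝ) (j j' : J) :
    Continuous fun q : ((E₁ × E₁) × E₂) × ℝ =>
      h.H2 j j' (f.mix s r (Real.cos q.2 • q.1.1.1 - Real.sin q.2 • q.1.1.2) q.1.2) := by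
  have h1 := h.continuous_H2 j j'
  have h2 := f.continuous_mix s r
  have : Continuous fun q : ((E₁ × E₁) × E₂) × ℝ =>
      (Real.cos q.2 • q.1.1.1 - Real.sin q.2 • q.1.1.2, q.1.2) := by fun_prop
  exact h1.comp (h2.comp this)

theorem measurable_corr (s r : ℝ) (j j' : J) : Measurable (f.corr h s r j j') := by
  have h1 := f.continuous_H2_mix h s r j j'
  have h2 : Continuous fun q : ((E₁ × E₁) × E₂) × ℝ => f.gradInner j j' q.2 q.1.1 :=
    (f.continuous_gradInner j j').comp (by fun_prop : Continuous
      fun q : ((E₁ × E₁) × E₂) × ℝ => (q.2, q.1.1))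
  exact (((h1.mul h2).measurable.stronglyMeasurable).integral_prod_left'
    (μ := ((stdGaussian E₁).prod (stdGaussian E₁)).prod (stdGaussian E₂))).measurable

theorem abs_corr_le (s r : ℝ) (j j' : J) (θ : ℝ) : |f.corr h s r j j' θ| ≤ h.M * f.A ^ 2 :=
  abs_integral_le_of_abs_le fun q => by
    rw [abs_mul]
    exact mul_le_mul (h.abs_H2_le _ _ _) (f.abs_gradInner_le _ _ _ _) (abs_nonneg _) h.M_nonneg

theorem intervalIntegrable_sin_mul {g : ℝ → ℝ} (hg : Measurable g) {M : ℝ} (hM : ∀ x, |g x| ≤ M)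
    (a b : ℝ) : IntervalIntegrable (fun θ => Real.sin θ * g θ) volume a b := by
  have hm : Measurable fun θ => Real.sin θ * g θ := by fun_prop
  have hb : ∀ θ, |Real.sin θ * g θ| ≤ M := fun θ => by
    rw [abs_mul]
    exact (mul_le_of_le_one_left (abs_nonneg _) (Real.abs_sin_le_one θ)).trans (hM θ)
  exact ⟨integrable_of_abs_le hm hb, integrable_of_abs_le hm hb⟩

theorem integrable_H1_mul_F (s r : ℝ) (j : J) :
    Integrable (fun q : E₁ × E₂ => f.F j q.1 * h.H1 j (f.mix s r q.1 q.2))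
      ((stdGaussian E₁).prod (stdGaussian E₂)) := by
  have h1 := (h.continuous_H1 j).comp (f.continuous_mix s r)
  have h2 : Integrable (fun q : E₁ × E₂ => f.F j q.1)
      ((stdGaussian E₁).prod (stdGaussian E₂)) :=
    (integrable_of_gradient (f.hasFDerivAt_F j) (f.norm_gF_le j)).comp_fst _
  exact h2.mul_bdd (c := h.M) h1.aestronglyMeasurable
    (Eventually.of_forall fun q => h.abs_H1_le _ _)

theorem integrable_H1_mul_inner (s r : ℝ) (j : J) :
    Integrable (fun q : E₁ × E₂ => inner ℝ (f.a j) q.2 * h.H1 j (f.mix s r q.1 q.2))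
      ((stdGaussian E₁).prod (stdGaussian E₂)) := by
  have h1 := (h.continuous_H1 j).comp (f.continuous_mix s r)
  have h2 : Integrable (fun q : E₁ × E₂ => inner ℝ (f.a j) q.2)
      ((stdGaussian E₁).prod (stdGaussian E₂)) :=
    ((memLp_inner_stdGaussian (f.a j)).integrable one_le_two).comp_snd _
  exact h2.mul_bdd (c := h.M) h1.aestronglyMeasurable
    (Eventually.of_forall fun q => h.abs_H1_le _ _)

theorem hasFDerivAt_H1_mix_left (s r : ℝ) (j : J) (z : E₁) (ξ : E₂) :
    HasFDerivAt (fun z => h.H1 j (f.mix s r z ξ))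
      (innerSL ℝ (∑ j', h.H2 j j' (f.mix s r z ξ) • (s • f.gF j' z))) z := by
  refine hasFDerivAt_comp_features (h.hasFDerivAt_H1 j) (x := fun z => f.mix s r z ξ)
    (gx := fun j' z => s • f.gF j' z) z fun j' => ?_
  have := ((f.hasFDerivAt_F j' z).const_mul s).add_const (r * inner ℝ (f.a j') ξ)
  refine this.congr_fderiv ?_
  ext v
  simp

theorem hasFDerivAt_H1_mix_right (s r : ℝ) (j : J) (z : E₁) (ξ : E₂) :
    HasFDerivAt (fun ξ => h.H1 j (f.mix s r z ξ))
      (innerSL ℝ (∑ j', h.H2 j j' (f.mix s r z ξ) • (r • f.a j'))) ξ := by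
  refine hasFDerivAt_comp_features (h.hasFDerivAt_H1 j) (x := fun ξ => f.mix s r z ξ)
    (gx := fun j' _ => r • f.a j') ξ fun j' => ?_
  have h0 : HasFDerivAt (fun ξ : E₂ => (inner ℝ (f.a j') ξ : ℝ)) (innerSL ℝ (f.a j')) ξ :=
    (innerSL ℝ (f.a j')).hasFDerivAt
  have := (h0.const_mul r).const_add (s * f.F j' z)
  refine this.congr_fderiv ?_
  ext v
  simp

theorem norm_sum_smul_le {E : Type*} [NormedAddCommGroup E] [NormedSpace ℝ E] {c : J → ℝ}
    {v : J → E} {M : ℝ} (hc : ∀ j, |c j| ≤ M) :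
    ‖∑ j, c j • v j‖ ≤ ∑ j, M * ‖v j‖ := by
  refine (norm_sum_le _ _).trans (Finset.sum_le_sum fun j _ => ?_)
  rw [norm_smul]
  exact mul_le_mul_of_nonneg_right (hc j) (norm_nonneg _)

/-- The integrand of `corr`. -/
noncomputable def corrFun (s r : ℝ) (j j' : J) (ξ : E₂) (θ : ℝ) (w : E₁ × E₁) : ℝ :=
  h.H2 j j' (f.mix s r (Real.cos θ • w.1 - Real.sin θ • w.2) ξ) * f.gradInner j j' θ w

theorem continuous_corrFun (s r : ℝ) (j j' : J) : Continuous fun q : (E₂ × ℝ) × (E₁ × E₁) =>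
    f.corrFun h s r j j' q.1.1 q.1.2 q.2 := by
  have h1 : Continuous fun q : (E₂ × ℝ) × (E₁ × E₁) =>
      (Real.cos q.1.2 • q.2.1 - Real.sin q.1.2 • q.2.2, q.1.1) := by fun_prop
  have h2 : Continuous fun q : (E₂ × ℝ) × (E₁ × E₁) => (q.1.2, q.2) := by fun_prop
  have h3 := (h.continuous_H2 j j').comp ((f.continuous_mix s r).comp h1)
  have h4 := (f.continuous_gradInner j j').comp h2
  exact h3.mul h4

theorem abs_corrFun_le (s r : ℝ) (j j' : J) (ξ : E₂) (θ : ℝ) (w : E₁ × E₁) :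
    |f.corrFun h s r j j' ξ θ w| ≤ h.M * f.A ^ 2 := by
  rw [corrFun, abs_mul]
  exact mul_le_mul (h.abs_H2_le _ _ _) (f.abs_gradInner_le _ _ _ _) (abs_nonneg _) h.M_nonneg

theorem integrable_corrFun (s r : ℝ) (j j' : J) (ξ : E₂) (θ : ℝ) :
    Integrable (f.corrFun h s r j j' ξ θ) ((stdGaussian E₁).prod (stdGaussian E₁)) :=
  integrable_of_abs_le ((f.continuous_corrFun h s r j j').comp (by fun_prop : Continuous
      fun w : E₁ × E₁ => ((ξ, θ), w))).measurable (f.abs_corrFun_le h s r j j' ξ θ)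

/-- The conditional version of `corr`, with the second Gaussian vector fixed. -/
noncomputable def corrAt (s r : ℝ) (j j' : J) (q : E₂ × ℝ) : ℝ :=
  ∫ w, f.corrFun h s r j j' q.1 q.2 w ∂((stdGaussian E₁).prod (stdGaussian E₁))

theorem measurable_corrAt (s r : ℝ) (j j' : J) : Measurable (f.corrAt h s r j j') :=
  ((f.continuous_corrFun h s r j j').measurable.stronglyMeasurable.integral_prod_right'
    (ν := (stdGaussian E₁).prod (stdGaussian E₁))).measurable

theorem abs_corrAt_le (s r : ℝ) (j j' : J) (q : E₂ × ℝ) :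
    |f.corrAt h s r j j' q| ≤ h.M * f.A ^ 2 :=
  abs_integral_le_of_abs_le (f.abs_corrFun_le h s r j j' _ _)

theorem integral_corrAt (s r : ℝ) (j j' : J) (θ : ℝ) :
    ∫ ξ, f.corrAt h s r j j' (ξ, θ) ∂(stdGaussian E₂) = f.corr h s r j j' θ := by
  have hi : Integrable (fun q : (E₁ × E₁) × E₂ => f.corrFun h s r j j' q.2 θ q.1)
      (((stdGaussian E₁).prod (stdGaussian E₁)).prod (stdGaussian E₂)) :=
    integrable_of_abs_le ((f.continuous_corrFun h s r j j').comp (by fun_prop : Continuous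
      fun q : (E₁ × E₁) × E₂ => ((q.2, θ), q.1))).measurable
      fun q => f.abs_corrFun_le h s r j j' _ _ _
  exact (integral_prod_symm _ hi).symm

/-- The covariance formula with `K = H1 j ∘ mix` for fixed `ξ`; differentiating the mixture produces
the factor `s` and one second derivative for each `j'`. -/
theorem integral_F_mul_H1_left (s r : ℝ) (j : J) (ξ : E₂) :
    ∫ z, f.F j z * h.H1 j (f.mix s r z ξ) ∂(stdGaussian E₁) =
      ∫ θ in Set.Ioc 0 (Real.pi / 2), ∑ j', s * (Real.sin θ * f.corrAt h s r j j' (ξ, θ)) := by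
  have hpi : (0 : ℝ) ≤ Real.pi / 2 := by positivity
  have hc' : ∀ j', Continuous fun z => h.H2 j j' (f.mix s r z ξ) := fun j' =>
    (h.continuous_H2 j j').comp ((f.continuous_mix s r).comp
      (by fun_prop : Continuous fun z : E₁ => (z, ξ)))
  have hcg := f.continuous_gF
  have hB : ∀ z, ‖∑ j', h.H2 j j' (f.mix s r z ξ) • (s • f.gF j' z)‖ ≤
      ∑ j' : J, h.M * (|s| * f.A) := by
    intro z
    refine (norm_sum_smul_le fun j' => h.abs_H2_le _ _ _).trans ?_
    refine Finset.sum_le_sum fun j' _ => ?_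
    have := h.M_nonneg
    rw [norm_smul, Real.norm_eq_abs]
    gcongr
    exact f.norm_gF_le _ _
  rw [integral_mul_eq_intervalIntegral (f.hasFDerivAt_F j) (hcg j) (f.norm_gF_le j)
    (fun z => f.hasFDerivAt_H1_mix_left h s r j z ξ) (by fun_prop) hB (f.mean_zero j),
    intervalIntegral.integral_of_le hpi]
  refine integral_congr_ae (Eventually.of_forall fun θ => ?_)
  simp only [corrAt]
  rw [← Finset.mul_sum, ← Finset.mul_sum,
    ← integral_finsetSum _ fun j' _ => f.integrable_corrFun h s r j j' ξ θ, mul_left_comm,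
    ← integral_const_mul s]
  congr 1
  refine integral_congr_ae (Eventually.of_forall fun w => ?_)
  simp only [inner_sum, real_inner_smul_right, Finset.mul_sum, corrFun, gradInner]
  refine Finset.sum_congr rfl fun j' _ => ?_
  ring

theorem integral_F_mul_H1 (s r : ℝ) (j : J) :
    ∫ q : E₁ × E₂, f.F j q.1 * h.H1 j (f.mix s r q.1 q.2)
      ∂((stdGaussian E₁).prod (stdGaussian E₂)) =
    s * ∑ j', ∫ θ in (0 : ℝ)..(Real.pi / 2), Real.sin θ * f.corr h s r j j' θ := by
  have hpi : (0 : ℝ) ≤ Real.pi / 2 := by positivity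
  have hm := f.measurable_corrAt h s r j
  have hSm : Measurable fun q : E₂ × ℝ =>
      ∑ j', s * (Real.sin q.2 * f.corrAt h s r j j' q) := by fun_prop
  have hSM : ∀ q : E₂ × ℝ, |∑ j', s * (Real.sin q.2 * f.corrAt h s r j j' q)| ≤
      ∑ j' : J, |s| * (1 * (h.M * f.A ^ 2)) := by
    intro q
    refine (Finset.abs_sum_le_sum_abs _ _).trans (Finset.sum_le_sum fun j' _ => ?_)
    rw [abs_mul, abs_mul]
    gcongr
    · exact Real.abs_sin_le_one _
    · exact f.abs_corrAt_le h s r j j' _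
  have h4 : ∀ θ, ∫ ξ, ∑ j', s * (Real.sin θ * f.corrAt h s r j j' (ξ, θ)) ∂(stdGaussian E₂) =
      ∑ j', s * (Real.sin θ * f.corr h s r j j' θ) := by
    intro θ
    rw [integral_finsetSum]
    · refine Finset.sum_congr rfl fun j' _ => ?_
      rw [integral_const_mul, integral_const_mul, integral_corrAt]
    · intro j' _
      have : Integrable (fun ξ => f.corrAt h s r j j' (ξ, θ)) (stdGaussian E₂) :=
        integrable_of_abs_le ((hm j').comp (by fun_prop)) fun ξ => f.abs_corrAt_le h s r j j' _
      exact (this.const_mul _).const_mul _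
  rw [integral_prod_symm _ (f.integrable_H1_mul_F h s r j)]
  simp only [integral_F_mul_H1_left]
  rw [integral_integral_swap (f := fun ξ θ => ∑ j', s * (Real.sin θ * f.corrAt h s r j j' (ξ, θ)))
    (integrable_of_abs_le hSm hSM), Finset.mul_sum]
  simp_rw [h4]
  rw [integral_finsetSum]
  · refine Finset.sum_congr rfl fun j' _ => ?_
    rw [integral_const_mul, intervalIntegral.integral_of_le hpi]
  · intro j' _
    refine Integrable.const_mul ?_ _
    exact (intervalIntegrable_sin_mul (f.measurable_corr h s r j j')
      (f.abs_corr_le h s r j j') 0 (Real.pi / 2)).1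

theorem integrable_H2_mix (s r : ℝ) (j j' : J) :
    Integrable (fun q : E₁ × E₂ => h.H2 j j' (f.mix s r q.1 q.2))
      ((stdGaussian E₁).prod (stdGaussian E₂)) :=
  integrable_of_abs_le ((h.continuous_H2 j j').comp (f.continuous_mix s r)).measurable
    fun _ => h.abs_H2_le _ _ _

/-- Integration by parts in `ξ` alone. The gradients of the linear features are constant, so the
products `⟨a j, a j'⟩` leave the expectation, in contrast with `integral_F_mul_H1`. -/
theorem integral_inner_mul_H1 (s r : ℝ) (j : J) :
    ∫ q : E₁ × E₂, inner ℝ (f.a j) q.2 * h.H1 j (f.mix s r q.1 q.2)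
      ∂((stdGaussian E₁).prod (stdGaussian E₂)) =
    r * ∑ j', inner ℝ (f.a j) (f.a j') * ∫ q : E₁ × E₂, h.H2 j j' (f.mix s r q.1 q.2)
      ∂((stdGaussian E₁).prod (stdGaussian E₂)) := by
  have hcm := f.continuous_mix s r
  rw [integral_prod _ (f.integrable_H1_mul_inner h s r j)]
  have h1 : ∀ z, ∫ ξ, inner ℝ (f.a j) ξ * h.H1 j (f.mix s r z ξ) ∂(stdGaussian E₂) =
      ∑ j', r * (inner ℝ (f.a j) (f.a j') *
        ∫ ξ, h.H2 j j' (f.mix s r z ξ) ∂(stdGaussian E₂)) := by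
    intro z
    have hc' : ∀ j', Continuous fun ξ => h.H2 j j' (f.mix s r z ξ) := fun j' =>
      (h.continuous_H2 j j').comp (hcm.comp (by fun_prop : Continuous fun ξ : E₂ => (z, ξ)))
    rw [integral_inner_mul_eq (fun ξ => f.hasFDerivAt_H1_mix_right h s r j z ξ) (by fun_prop)
      (M := ∑ j' : J, h.M * ‖r • f.a j'‖) fun ξ => norm_sum_smul_le fun j' => h.abs_H2_le _ _ _]
    simp_rw [sum_inner, real_inner_smul_left]
    rw [integral_finsetSum]
    · refine Finset.sum_congr rfl fun j' _ => ?_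
      rw [integral_mul_const, real_inner_comm]
      ring
    · intro j' _
      exact (integrable_of_abs_le (hc' j').measurable fun ξ => h.abs_H2_le _ _ _).mul_const _
  simp_rw [h1]
  rw [integral_finsetSum, Finset.mul_sum]
  · refine Finset.sum_congr rfl fun j' _ => ?_
    rw [integral_const_mul, integral_const_mul, integral_prod _ (f.integrable_H2_mix h s r j j')]
  · intro j' _
    exact ((f.integrable_H2_mix h s r j j').integral_prod_left.const_mul _).const_mul _

theorem integral_comp_rotate_fst {g : E₁ × E₂ → ℝ} (hg : Measurable g) (θ : ℝ) :
    ∫ q : (E₁ × E₁) × E₂, g (Real.cos θ • q.1.1 - Real.sin θ • q.1.2, q.2)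
      ∂(((stdGaussian E₁).prod (stdGaussian E₁)).prod (stdGaussian E₂)) =
    ∫ q, g q ∂((stdGaussian E₁).prod (stdGaussian E₂)) := by
  have h := (measurePreserving_rotate_fst (E := E₁) θ).prod
    (MeasurePreserving.id (stdGaussian E₂))
  conv_rhs => rw [← h.map_eq]
  rw [integral_map h.measurable.aemeasurable hg.aestronglyMeasurable]
  rfl

/-- The mean of `gradInner`. -/
noncomputable def gradMean (j j' : J) (θ : ℝ) : ℝ :=
  ∫ w, f.gradInner j j' θ w ∂((stdGaussian E₁).prod (stdGaussian E₁))

theorem measurable_gradMean (j j' : J) : Measurable (f.gradMean j j') :=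
  ((f.continuous_gradInner j j').measurable.stronglyMeasurable.integral_prod_right'
    (ν := (stdGaussian E₁).prod (stdGaussian E₁))).measurable

theorem abs_gradMean_le (j j' : J) (θ : ℝ) : |f.gradMean j j' θ| ≤ f.A ^ 2 :=
  abs_integral_le_of_abs_le (f.abs_gradInner_le j j' θ)

/-- The covariance formula applied to the features themselves: the matched covariance is the `sin
θ`-weighted mean of the gradient products. -/
theorem inner_a_eq_intervalIntegral (j j' : J) :
    inner ℝ (f.a j) (f.a j') =
      ∫ θ in (0 : ℝ)..(Real.pi / 2), Real.sin θ * f.gradMean j j' θ := by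
  rw [f.inner_a, integral_mul_eq_intervalIntegral (f.hasFDerivAt_F j) (f.continuous_gF j)
    (f.norm_gF_le j) (f.hasFDerivAt_F j') (f.continuous_gF j') (f.norm_gF_le j') (f.mean_zero j)]
  rfl

theorem measurable_H2_mix (s r : ℝ) (j j' : J) :
    Measurable fun q : E₁ × E₂ => h.H2 j j' (f.mix s r q.1 q.2) :=
  ((h.continuous_H2 j j').comp (f.continuous_mix s r)).measurable

theorem measurable_H2_mix_rotate (s r : ℝ) (j j' : J) (θ : ℝ) :
    Measurable fun q : (E₁ × E₁) × E₂ =>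
      h.H2 j j' (f.mix s r (Real.cos θ • q.1.1 - Real.sin θ • q.1.2) q.2) :=
  ((f.continuous_H2_mix h s r j j').comp (by fun_prop : Continuous
    fun q : (E₁ × E₁) × E₂ => (q, θ))).measurable

theorem measurable_gradInner (j j' : J) (θ : ℝ) : Measurable (f.gradInner j j' θ) :=
  ((f.continuous_gradInner j j').comp (by fun_prop : Continuous
    fun w : E₁ × E₁ => (θ, w))).measurable

/-- The rotated point is again standard Gaussian, so the mean of `H2` there is its mean at the
unrotated point; what remains is the covariance of `H2` with the gradient product. -/
theorem corr_sub_eq (s r : ℝ) (j j' : J) (θ : ℝ) :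
    f.corr h s r j j' θ - f.gradMean j j' θ * ∫ q : E₁ × E₂, h.H2 j j' (f.mix s r q.1 q.2)
      ∂((stdGaussian E₁).prod (stdGaussian E₂)) = ∫ q : (E₁ × E₁) × E₂,
        h.H2 j j' (f.mix s r (Real.cos θ • q.1.1 - Real.sin θ • q.1.2) q.2) *
        (f.gradInner j j' θ q.1 - f.gradMean j j' θ)
        ∂(((stdGaussian E₁).prod (stdGaussian E₁)).prod (stdGaussian E₂)) := by
  have hX := f.measurable_H2_mix_rotate h s r j j' θ
  have hT := f.measurable_gradInner j j' θ
  have i1 : Integrable (fun q : (E₁ × E₁) × E₂ =>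
    h.H2 j j' (f.mix s r (Real.cos θ • q.1.1 - Real.sin θ • q.1.2) q.2) *
    f.gradInner j j' θ q.1) (((stdGaussian E₁).prod (stdGaussian E₁)).prod (stdGaussian E₂)) := by
    refine integrable_of_abs_le (M := h.M * f.A ^ 2) (hX.mul (hT.comp measurable_fst)) fun q => ?_
    rw [abs_mul]
    exact mul_le_mul (h.abs_H2_le _ _ _) (f.abs_gradInner_le _ _ _ _) (abs_nonneg _)
      h.M_nonneg
  have i2 : Integrable (fun q : (E₁ × E₁) × E₂ =>
    h.H2 j j' (f.mix s r (Real.cos θ • q.1.1 - Real.sin θ • q.1.2) q.2) * f.gradMean j j' θ)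
      (((stdGaussian E₁).prod (stdGaussian E₁)).prod (stdGaussian E₂)) :=
    (integrable_of_abs_le hX fun q => h.abs_H2_le _ _ _).mul_const _
  simp_rw [mul_sub]
  rw [integral_sub i1 i2, integral_mul_const,
    integral_comp_rotate_fst (f.measurable_H2_mix h s r j j') θ, corr, mul_comm (f.gradMean j j' θ)]

theorem abs_corr_sub_le_pointwise {s r κ : ℝ} (j j' : J) (hκ0 : 0 ≤ κ)
    (hκ : ∫ q : E₁ × E₂, h.H2 j j' (f.mix s r q.1 q.2) ^ 2
      ∂((stdGaussian E₁).prod (stdGaussian E₂)) ≤ κ ^ 2) (θ : ℝ) :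
    |f.corr h s r j j' θ - f.gradMean j j' θ * ∫ q : E₁ × E₂, h.H2 j j' (f.mix s r q.1 q.2)
      ∂((stdGaussian E₁).prod (stdGaussian E₂))| ≤ κ * (4 * Real.pi * (f.A * f.B)) := by
  have hA := f.A_pos
  have hB := f.B_pos
  have hX := f.measurable_H2_mix_rotate h s r j j' θ
  have hT := f.measurable_gradInner j j' θ
  have hTm : Measurable fun w => f.gradInner j j' θ w - f.gradMean j j' θ := hT.sub_const _
  have hTb : ∀ w, |f.gradInner j j' θ w - f.gradMean j j' θ| ≤ f.A ^ 2 + f.A ^ 2 := fun w =>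
    (abs_sub _ _).trans (add_le_add (f.abs_gradInner_le j j' θ w) (f.abs_gradMean_le j j' θ))
  rw [corr_sub_eq]
  refine abs_integral_mul_le (memLp_two_of_abs_le hX fun q => h.abs_H2_le _ _ _)
    (memLp_two_of_abs_le (hTm.comp measurable_fst) fun q => hTb q.1) hκ0 (by positivity) ?_ ?_
  · have := integral_comp_rotate_fst ((f.measurable_H2_mix h s r j j').pow_const 2) θ
    exact this.trans_le hκ
  · have i3 : Integrable (fun w => (f.gradInner j j' θ w - f.gradMean j j' θ) ^ 2)
        ((stdGaussian E₁).prod (stdGaussian E₁)) :=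
      (memLp_two_of_abs_le hTm hTb).integrable_sq
    have i4 := Integrable.comp_fst i3 (stdGaussian E₂)
    change ∫ q : (E₁ × E₁) × E₂, (f.gradInner j j' θ q.1 - f.gradMean j j' θ) ^ 2
      ∂(((stdGaussian E₁).prod (stdGaussian E₁)).prod (stdGaussian E₂)) ≤ _
    rw [integral_prod _ i4]
    simpa [gradMean] using f.variance_gradInner_le j j' θ

theorem abs_corr_sub_le {s r κ : ℝ} (j j' : J) (hκ0 : 0 ≤ κ)
    (hκ : ∫ q : E₁ × E₂, h.H2 j j' (f.mix s r q.1 q.2) ^ 2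
      ∂((stdGaussian E₁).prod (stdGaussian E₂)) ≤ κ ^ 2) :
    |(∫ θ in (0 : ℝ)..(Real.pi / 2), Real.sin θ * f.corr h s r j j' θ) -
      inner ℝ (f.a j) (f.a j') * ∫ q : E₁ × E₂, h.H2 j j' (f.mix s r q.1 q.2)
      ∂((stdGaussian E₁).prod (stdGaussian E₂))| ≤
    κ * (4 * Real.pi * (f.A * f.B)) * (Real.pi / 2) := by
  have hpi : (0 : ℝ) ≤ Real.pi / 2 := by positivity
  have hpt := f.abs_corr_sub_le_pointwise h j j' hκ0 hκ
  generalize ∫ q : E₁ × E₂, h.H2 j j' (f.mix s r q.1 q.2)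
      ∂((stdGaussian E₁).prod (stdGaussian E₂)) = m at hpt ⊢
  have e2 : (∫ θ in (0 : ℝ)..(Real.pi / 2), Real.sin θ * f.corr h s r j j' θ) -
      inner ℝ (f.a j) (f.a j') * m =
      ∫ θ in (0 : ℝ)..(Real.pi / 2), Real.sin θ *
        (f.corr h s r j j' θ - f.gradMean j j' θ * m) := by
    rw [f.inner_a_eq_intervalIntegral, ← intervalIntegral.integral_mul_const,
      ← intervalIntegral.integral_sub]
    · refine intervalIntegral.integral_congr fun θ _ => ?_
      ring
    · exact intervalIntegrable_sin_mul (f.measurable_corr h s r j j')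
        (f.abs_corr_le h s r j j') _ _
    · exact (intervalIntegrable_sin_mul (f.measurable_gradMean j j')
        (f.abs_gradMean_le j j') _ _).mul_const _
  rw [e2]
  have := intervalIntegral.norm_integral_le_of_norm_le_const (a := 0) (b := Real.pi / 2)
    (f := fun θ => Real.sin θ * (f.corr h s r j j' θ - f.gradMean j j' θ * m))
    (C := κ * (4 * Real.pi * (f.A * f.B))) (fun θ _ => by
      rw [norm_mul, Real.norm_eq_abs, Real.norm_eq_abs]
      exact (mul_le_of_le_one_left (abs_nonneg _) (Real.abs_sin_le_one θ)).trans (hpt θ))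
  rw [sub_zero, abs_of_nonneg hpi] at this
  exact this

/-- For `(s, r) = (sin t, cos t)` the integral is the derivative of `E H` along the interpolation.
Both integrations by parts give the coefficient `r s`, so the leading terms cancel and only the
covariances of `H2` with the gradient products are left. -/
theorem abs_integral_deriv_le {κ : J → J → ℝ} (hκ0 : ∀ j j', 0 ≤ κ j j') {s r : ℝ}
    (hs : |s| ≤ 1) (hr : |r| ≤ 1)
    (hκ : ∀ j j', ∫ q : E₁ × E₂, h.H2 j j' (f.mix s r q.1 q.2) ^ 2
      ∂((stdGaussian E₁).prod (stdGaussian E₂)) ≤ κ j j' ^ 2) :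
    |∫ q : E₁ × E₂, ∑ j, h.H1 j (f.mix s r q.1 q.2) *
      (r * f.F j q.1 - s * inner ℝ (f.a j) q.2) ∂((stdGaussian E₁).prod (stdGaussian E₂))| ≤
    (∑ j, ∑ j', κ j j') * (4 * Real.pi * (f.A * f.B)) * (Real.pi / 2) := by
  have hA := f.A_pos
  have hB := f.B_pos
  have i1 := fun j => (f.integrable_H1_mul_F h s r j).const_mul r
  have i2 := fun j => (f.integrable_H1_mul_inner h s r j).const_mul s
  have e : ∀ (j : J) (q : E₁ × E₂), h.H1 j (f.mix s r q.1 q.2) *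
      (r * f.F j q.1 - s * inner ℝ (f.a j) q.2) =
      r * (f.F j q.1 * h.H1 j (f.mix s r q.1 q.2)) -
        s * (inner ℝ (f.a j) q.2 * h.H1 j (f.mix s r q.1 q.2)) := fun j q => by ring
  simp_rw [e]
  rw [integral_finsetSum (f := fun (j : J) (q : E₁ × E₂) =>
      r * (f.F j q.1 * h.H1 j (f.mix s r q.1 q.2)) -
        s * (inner ℝ (f.a j) q.2 * h.H1 j (f.mix s r q.1 q.2))) _ fun j _ => (i1 j).sub (i2 j)]
  rw [Finset.sum_mul, Finset.sum_mul]
  refine (Finset.abs_sum_le_sum_abs _ _).trans (Finset.sum_le_sum fun j _ => ?_)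
  rw [integral_sub (i1 j) (i2 j), integral_const_mul, integral_const_mul,
    f.integral_F_mul_H1 h s r j, f.integral_inner_mul_H1 h s r j]
  -- Common coefficient of the two second-order terms.
  have e2 : ∀ a b : ℝ, r * (s * a) - s * (r * b) = r * s * (a - b) := fun a b => by ring
  rw [e2, ← Finset.sum_sub_distrib, abs_mul, Finset.sum_mul, Finset.sum_mul]
  have h3 : |r * s| ≤ 1 := by
    rw [abs_mul]
    exact mul_le_one₀ hr (abs_nonneg _) hs
  refine (mul_le_of_le_one_left (abs_nonneg _) h3).trans ?_
  refine (Finset.abs_sum_le_sum_abs _ _).trans (Finset.sum_le_sum fun j' _ => ?_)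
  exact f.abs_corr_sub_le h j j' (hκ0 j j') (hκ j j')

/-- Quantitative comparison of a smooth function of the features with the same function of the
Gaussian vector having the same covariances. -/
theorem abs_integral_sub_le {κ : J → J → ℝ} (hκ0 : ∀ j j', 0 ≤ κ j j')
    (hκ : ∀ s r : ℝ, |s| ≤ 1 → |r| ≤ 1 → ∀ j j', ∫ q : E₁ × E₂, h.H2 j j' (f.mix s r q.1 q.2) ^ 2
      ∂((stdGaussian E₁).prod (stdGaussian E₂)) ≤ κ j j' ^ 2) :
    |∫ z, h.H (fun j => f.F j z) ∂(stdGaussian E₁) -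
      ∫ ξ, h.H (fun j => inner ℝ (f.a j) ξ) ∂(stdGaussian E₂)| ≤
    (∑ j, ∑ j', κ j j') * (4 * Real.pi * (f.A * f.B)) * (Real.pi / 2) * (Real.pi / 2) := by
  set μ := stdGaussian E₁
  set ν := stdGaussian E₂
  have hpi : (0 : ℝ) ≤ Real.pi / 2 := by positivity
  have hcF := f.continuous_F
  have hcH := h.continuous_H
  have hcH1 := h.continuous_H1
  have hmixc : Continuous fun q : (E₁ × E₂) × ℝ =>
      f.mix (Real.sin q.2) (Real.cos q.2) q.1.1 q.1.2 := by
    unfold mix; fun_prop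
  set D : E₁ × E₂ → ℝ → ℝ := fun q t => ∑ j, h.H1 j (f.mix (Real.sin t) (Real.cos t) q.1 q.2) *
      (Real.cos t * f.F j q.1 - Real.sin t * inner ℝ (f.a j) q.2) with hD
  have hDc : Continuous fun p : (E₁ × E₂) × ℝ => D p.1 p.2 := by
    simp only [hD]
    refine continuous_finsetSum _ fun j _ => ?_
    refine Continuous.mul ((hcH1 j).comp hmixc) ?_
    have := hcF j
    fun_prop
  have hder : ∀ q t, HasDerivAt (fun t => h.H (f.mix (Real.sin t) (Real.cos t) q.1 q.2))
      (D q t) t := by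
    intro q t
    have h1 : HasDerivAt (fun t => f.mix (Real.sin t) (Real.cos t) q.1 q.2)
        (fun j => Real.cos t * f.F j q.1 - Real.sin t * inner ℝ (f.a j) q.2) t := by
      refine hasDerivAt_pi.2 fun j => ?_
      have := ((Real.hasDerivAt_sin t).mul_const (f.F j q.1)).fun_add
        ((Real.hasDerivAt_cos t).mul_const (inner ℝ (f.a j) q.2))
      refine this.congr_deriv ?_
      ring
    refine ((h.hasFDerivAt_H _).comp_hasDerivAt t h1).congr_deriv ?_
    simp [hD]
  -- The interpolation is the feature vector at `t = π/2` and the Gaussian vector at `t = 0`.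
  have hftc : ∀ q : E₁ × E₂, h.H (fun j => f.F j q.1) - h.H (fun j => inner ℝ (f.a j) q.2) =
      ∫ t in Set.Ioc 0 (Real.pi / 2), D q t := by
    intro q
    rw [← intervalIntegral.integral_of_le hpi,
      intervalIntegral.integral_eq_sub_of_hasDerivAt (fun t _ => hder q t)
        (Continuous.intervalIntegrable (hDc.comp (by fun_prop : Continuous fun t => (q, t))) _ _)]
    have e1 : f.mix 1 0 q.1 q.2 = fun j => f.F j q.1 := by ext j; simp [mix]
    have e0 : f.mix 0 1 q.1 q.2 = fun j => inner ℝ (f.a j) q.2 := by ext j; simp [mix]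
    simp [e1, e0]
  have hint : Integrable (fun p : (E₁ × E₂) × ℝ => D p.1 p.2)
      ((μ.prod ν).prod (volume.restrict (Set.Ioc 0 (Real.pi / 2)))) := by
    have hb : Integrable (fun q : E₁ × E₂ =>
        ∑ j, h.M * (|f.F j q.1| + |inner ℝ (f.a j) q.2|)) (μ.prod ν) := by
      refine integrable_finsetSum _ fun j _ => Integrable.const_mul (Integrable.add ?_ ?_) _
      · exact Integrable.comp_fst
          (integrable_of_gradient (f.hasFDerivAt_F j) (f.norm_gF_le j)).abs ν
      · exact Integrable.comp_snd
          ((memLp_inner_stdGaussian (f.a j)).integrable one_le_two).abs μ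
    refine Integrable.mono' (hb.comp_fst (volume.restrict (Set.Ioc 0 (Real.pi / 2))))
      hDc.aestronglyMeasurable (Eventually.of_forall fun p => ?_)
    refine (Finset.abs_sum_le_sum_abs _ _).trans (Finset.sum_le_sum fun j _ => ?_)
    rw [abs_mul]
    have := h.M_nonneg
    gcongr
    · exact h.abs_H1_le _ _
    · refine (abs_sub _ _).trans ?_
      rw [abs_mul, abs_mul]
      gcongr
      · exact mul_le_of_le_one_left (abs_nonneg _) (Real.abs_cos_le_one _)
      · exact mul_le_of_le_one_left (abs_nonneg _) (Real.abs_sin_le_one _)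
  have hH1 : Integrable (fun z => h.H (fun j => f.F j z)) μ :=
    integrable_of_abs_le (Continuous.measurable (by fun_prop)) fun z => h.abs_H_le _
  have hH2 : Integrable (fun ξ => h.H (fun j => inner ℝ (f.a j) ξ)) ν :=
    integrable_of_abs_le (Continuous.measurable (by fun_prop)) fun z => h.abs_H_le _
  have e : ∫ z, h.H (fun j => f.F j z) ∂μ - ∫ ξ, h.H (fun j => inner ℝ (f.a j) ξ) ∂ν =
      ∫ t in (0 : ℝ)..(Real.pi / 2), ∫ q, D q t ∂(μ.prod ν) := by
    rw [intervalIntegral.integral_of_le hpi, ← integral_integral_swap hint]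
    simp_rw [← hftc]
    have j1 : Integrable (fun q : E₁ × E₂ => h.H (fun j => f.F j q.1)) (μ.prod ν) :=
      Integrable.comp_fst hH1 ν
    have j2 : Integrable (fun q : E₁ × E₂ => h.H (fun j => inner ℝ (f.a j) q.2)) (μ.prod ν) :=
      Integrable.comp_snd hH2 μ
    rw [integral_sub j1 j2, integral_prod _ j1, integral_prod _ j2]
    simp
  rw [e]
  have := intervalIntegral.norm_integral_le_of_norm_le_const (a := 0) (b := Real.pi / 2)
    (f := fun t => ∫ q, D q t ∂(μ.prod ν)) (fun t _ => f.abs_integral_deriv_le h hκ0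
      (Real.abs_sin_le_one t) (Real.abs_cos_le_one t)
      (hκ _ _ (Real.abs_sin_le_one t) (Real.abs_cos_le_one t)))
  rw [sub_zero, abs_of_nonneg hpi] at this
  exact this

end MatchedFeatures

end Comparison

end RandomFeatures

namespace RandomFeatures

/-! ### The soft minimum as a test function -/

section SoftMin

/-- A Lipschitz function on `ℝ^ι` with explicit bounded partial derivatives of order at most two. -/
structure SmoothLoss (ι : Type*) [Fintype ι] where
  L : (ι → ℝ) → ℝ
  L1 : ι → (ι → ℝ) → ℝ
  L2 : ι → ι → (ι → ℝ) → ℝ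
  K : ℝ
  hasFDerivAt_L : ∀ v, HasFDerivAt L
    (∑ l, L1 l v • (ContinuousLinearMap.proj l : (ι → ℝ) →L[ℝ] ℝ)) v
  hasFDerivAt_L1 : ∀ l v, HasFDerivAt (L1 l)
    (∑ l', L2 l l' v • (ContinuousLinearMap.proj l' : (ι → ℝ) →L[ℝ] ℝ)) v
  continuous_L2 : ∀ l l', Continuous (L2 l l')
  lip : ∀ v v', |L v - L v'| ≤ K * ‖v - v'‖
  abs_L1_le : ∀ l v, |L1 l v| ≤ K
  abs_L2_le : ∀ l l' v, |L2 l l' v| ≤ K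
  K_nonneg : 0 ≤ K

/-- A bounded function on `ℝ` with bounded derivatives of order at most two. -/
structure SmoothOuter where
  φ : ℝ → ℝ
  φ1 : ℝ → ℝ
  φ2 : ℝ → ℝ
  M : ℝ
  hasDerivAt_φ : ∀ t, HasDerivAt φ (φ1 t) t
  hasDerivAt_φ1 : ∀ t, HasDerivAt φ1 (φ2 t) t
  continuous_φ2 : Continuous φ2
  abs_φ_le : ∀ t, |φ t| ≤ M
  abs_φ1_le : ∀ t, |φ1 t| ≤ M
  abs_φ2_le : ∀ t, |φ2 t| ≤ M

theorem SmoothOuter.M_nonneg (ψ : SmoothOuter) : 0 ≤ ψ.M := (abs_nonneg _).trans (ψ.abs_φ_le 0)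

variable {ι N : Type*} [Fintype ι] [Fintype N]

theorem SmoothLoss.continuous_L (L : SmoothLoss ι) : Continuous L.L :=
  continuous_iff_continuousAt.2 fun u => (L.hasFDerivAt_L u).continuousAt

theorem SmoothLoss.continuous_L1 (L : SmoothLoss ι) (l : ι) : Continuous (L.L1 l) :=
  continuous_iff_continuousAt.2 fun u => (L.hasFDerivAt_L1 l u).continuousAt

/-- Unnormalized Gibbs weights. -/
noncomputable def softExp (L : SmoothLoss ι) (c : N → ℝ) (β : ℝ) (Θ : N) (u : N × ι → ℝ) : ℝ :=
  Real.exp (-c Θ - β * L.L fun l => u (Θ, l))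

/-- The partition function. -/
noncomputable def softSum (L : SmoothLoss ι) (c : N → ℝ) (β : ℝ) (u : N × ι → ℝ) : ℝ :=
  ∑ Θ, softExp L c β Θ u

/-- Gibbs weights. -/
noncomputable def softWeight (L : SmoothLoss ι) (c : N → ℝ) (β : ℝ) (Θ : N) (u : N × ι → ℝ) : ℝ :=
  softExp L c β Θ u / softSum L c β u

/-- The soft minimum. -/
noncomputable def softMin (L : SmoothLoss ι) (c : N → ℝ) (β n : ℝ) (u : N × ι → ℝ) : ℝ :=
  -(1 / (n * β)) * Real.log (softSum L c β u)

/-- The derivative of `u ↦ L (u Θ)`. -/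
noncomputable def lossDeriv (L : SmoothLoss ι) (Θ : N) (u : N × ι → ℝ) :
    (N × ι → ℝ) →L[ℝ] ℝ :=
  ∑ l, L.L1 l (fun l => u (Θ, l)) • (ContinuousLinearMap.proj (Θ, l) : (N × ι → ℝ) →L[ℝ] ℝ)

variable (L : SmoothLoss ι) (c : N → ℝ) (β n : ℝ)

theorem hasFDerivAt_block (Θ : N) (u : N × ι → ℝ) :
    HasFDerivAt (fun u : N × ι → ℝ => fun l => u (Θ, l))
      (ContinuousLinearMap.pi fun l =>
        (ContinuousLinearMap.proj (Θ, l) : (N × ι → ℝ) →L[ℝ] ℝ)) u :=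
  hasFDerivAt_pi.2 fun l => (ContinuousLinearMap.proj (R := ℝ) (φ := fun _ : N × ι => ℝ)
    (Θ, l)).hasFDerivAt

theorem hasFDerivAt_loss_block (Θ : N) (u : N × ι → ℝ) :
    HasFDerivAt (fun u : N × ι → ℝ => L.L fun l => u (Θ, l)) (lossDeriv L Θ u) u := by
  refine ((L.hasFDerivAt_L _).comp u (hasFDerivAt_block Θ u)).congr_fderiv ?_
  ext v
  simp [lossDeriv]

theorem softExp_pos (Θ : N) (u : N × ι → ℝ) : 0 < softExp L c β Θ u := Real.exp_pos _

theorem softSum_pos [Nonempty N] (u : N × ι → ℝ) : 0 < softSum L c β u :=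
  Finset.sum_pos (fun _ _ => softExp_pos L c β _ u) Finset.univ_nonempty

theorem softWeight_pos [Nonempty N] (Θ : N) (u : N × ι → ℝ) : 0 < softWeight L c β Θ u :=
  div_pos (softExp_pos L c β Θ u) (softSum_pos L c β u)

theorem sum_softWeight [Nonempty N] (u : N × ι → ℝ) : ∑ Θ, softWeight L c β Θ u = 1 := by
  simp_rw [softWeight, ← Finset.sum_div]
  exact div_self (softSum_pos L c β u).ne'

theorem softWeight_le_one [Nonempty N] (Θ : N) (u : N × ι → ℝ) : softWeight L c β Θ u ≤ 1 := by
  rw [← sum_softWeight L c β u]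
  exact Finset.single_le_sum (fun q _ => (softWeight_pos L c β q u).le) (Finset.mem_univ Θ)

theorem hasFDerivAt_softExp (Θ : N) (u : N × ι → ℝ) :
    HasFDerivAt (softExp L c β Θ) ((-β * softExp L c β Θ u) • lossDeriv L Θ u) u := by
  have h := (((hasFDerivAt_loss_block L Θ u).const_mul β).const_sub (-c Θ)).exp
  refine h.congr_fderiv ?_
  rw [softExp]
  module

theorem hasFDerivAt_softSum (u : N × ι → ℝ) :
    HasFDerivAt (softSum L c β) (∑ Θ, (-β * softExp L c β Θ u) • lossDeriv L Θ u) u :=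
  HasFDerivAt.fun_sum fun Θ _ => hasFDerivAt_softExp L c β Θ u

variable [Nonempty N]

theorem hasFDerivAt_softMin (hβ : β ≠ 0) (u : N × ι → ℝ) :
    HasFDerivAt (softMin L c β n) (∑ Θ, (1 / n * softWeight L c β Θ u) • lossDeriv L Θ u) u := by
  have hS := (softSum_pos L c β u).ne'
  have h := ((hasFDerivAt_softSum L c β u).log hS).const_mul (-(1 / (n * β)))
  refine h.congr_fderiv ?_
  rw [Finset.smul_sum, Finset.smul_sum]
  refine Finset.sum_congr rfl fun Θ _ => ?_
  rw [smul_smul, smul_smul]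
  congr 1
  rw [softWeight]
  -- For `n = 0` both sides vanish because `1 / 0 = 0`.
  by_cases hn : n = 0
  · simp [hn]
  · field_simp

/-- The derivative of a Gibbs weight is `β` times the weight times the Gibbs mean of the loss
derivatives minus its own; this is the source of the terms with `β` in `softHess`. -/
theorem hasFDerivAt_softWeight (Θ : N) (u : N × ι → ℝ) :
    HasFDerivAt (softWeight L c β Θ) ((-β * softWeight L c β Θ u) • lossDeriv L Θ u +
      (β * softWeight L c β Θ u) • ∑ q, softWeight L c β q u • lossDeriv L q u) u := by
  have hS := (softSum_pos L c β u).ne'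
  have h := (hasFDerivAt_softExp L c β Θ u).fun_mul
    ((hasDerivAt_inv hS).comp_hasFDerivAt u (hasFDerivAt_softSum L c β u))
  refine HasFDerivAt.congr_fderiv (f := softWeight L c β Θ) h ?_
  have e : ∑ q, softWeight L c β q u • lossDeriv L q u =
      (softSum L c β u)⁻¹ • ∑ q, softExp L c β q u • lossDeriv L q u := by
    rw [Finset.smul_sum]
    refine Finset.sum_congr rfl fun q _ => ?_
    rw [smul_smul, softWeight, div_eq_inv_mul]
  have e2 : ∑ q, (-β * softExp L c β q u) • lossDeriv L q u =
      (-β) • ∑ q, softExp L c β q u • lossDeriv L q u := by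
    rw [Finset.smul_sum]
    simp_rw [smul_smul]
  rw [e, e2]
  generalize ∑ q, softExp L c β q u • lossDeriv L q u = T
  rw [softWeight]
  ext v
  simp only [add_apply, smul_apply, smul_eq_mul, Function.comp]
  field_simp
  ring

theorem lossDeriv_apply (Θ : N) (u v : N × ι → ℝ) :
    lossDeriv L Θ u v = ∑ l, L.L1 l (fun l => u (Θ, l)) * v (Θ, l) := by
  simp [lossDeriv]

variable [DecidableEq N]

/-- The second partial derivatives of `φ ∘ softMin`. -/
noncomputable def softHess (ψ : SmoothOuter) (j j' : N × ι) (u : N × ι → ℝ) : ℝ :=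
  ψ.φ2 (softMin L c β n u) * (1 / n * softWeight L c β j'.1 u * L.L1 j'.2 fun l => u (j'.1, l)) *
      (1 / n * softWeight L c β j.1 u * L.L1 j.2 fun l => u (j.1, l)) +
    ψ.φ1 (softMin L c β n u) * (1 / n) * (β * softWeight L c β j.1 u * softWeight L c β j'.1 u *
      (L.L1 j'.2 fun l => u (j'.1, l)) * L.L1 j.2 fun l => u (j.1, l)) +
    if j.1 = j'.1 then ψ.φ1 (softMin L c β n u) * (1 / n) * softWeight L c β j.1 u *
      ((L.L2 j.2 j'.2 fun l => u (j.1, l)) -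
        β * (L.L1 j'.2 fun l => u (j'.1, l)) * L.L1 j.2 fun l => u (j.1, l)) else 0

theorem hasFDerivAt_softTest (ψ : SmoothOuter) (hβ : β ≠ 0) (u : N × ι → ℝ) :
    HasFDerivAt (fun u => ψ.φ (softMin L c β n u))
      (∑ j : N × ι, (ψ.φ1 (softMin L c β n u) *
        (1 / n * softWeight L c β j.1 u * L.L1 j.2 fun l => u (j.1, l))) •
        (ContinuousLinearMap.proj j : (N × ι → ℝ) →L[ℝ] ℝ)) u := by
  refine ((ψ.hasDerivAt_φ _).comp_hasFDerivAt u
    (hasFDerivAt_softMin L c β n hβ u)).congr_fderiv ?_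
  ext v
  simp only [smul_apply, sum_apply, smul_eq_mul, lossDeriv_apply, ContinuousLinearMap.proj_apply,
    Fintype.sum_prod_type, Finset.mul_sum]
  refine Finset.sum_congr rfl fun Θ _ => Finset.sum_congr rfl fun l _ => ?_
  ring

theorem hasFDerivAt_softGrad (ψ : SmoothOuter) (hβ : β ≠ 0) (j : N × ι) (u : N × ι → ℝ) :
    HasFDerivAt (fun u => ψ.φ1 (softMin L c β n u) *
        (1 / n * softWeight L c β j.1 u * L.L1 j.2 fun l => u (j.1, l)))
      (∑ j' : N × ι, softHess L c β n ψ j j' u •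
        (ContinuousLinearMap.proj j' : (N × ι → ℝ) →L[ℝ] ℝ)) u := by
  obtain ⟨Θ, l⟩ := j
  have h1 := (ψ.hasDerivAt_φ1 _).comp_hasFDerivAt u (hasFDerivAt_softMin L c β n hβ u)
  have h2 := (hasFDerivAt_softWeight L c β Θ u).const_mul (1 / n)
  have h3 := (L.hasFDerivAt_L1 l _).comp u (hasFDerivAt_block Θ u)
  refine (h1.fun_mul (h2.fun_mul h3)).congr_fderiv ?_
  ext v
  simp only [smul_apply, sum_apply, add_apply, smul_eq_mul,
    ContinuousLinearMap.proj_apply, Fintype.sum_prod_type, softHess, Function.comp,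
    ContinuousLinearMap.comp_apply, ContinuousLinearMap.coe_pi', add_mul, ite_mul, zero_mul,
    Finset.sum_add_distrib]
  have e1 : ∑ q : N, ∑ l' : ι, (if Θ = q then
      ψ.φ1 (softMin L c β n u) * (1 / n) * softWeight L c β Θ u *
      ((L.L2 l l' fun l => u (Θ, l)) - β * (L.L1 l' fun l => u (q, l)) *
        L.L1 l fun l => u (Θ, l)) * v (q, l') else 0) =
      ψ.φ1 (softMin L c β n u) * (1 / n) * softWeight L c β Θ u *
        (∑ l' : ι, (L.L2 l l' fun l => u (Θ, l)) * v (Θ, l') -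
        β * lossDeriv L Θ u v * L.L1 l fun l => u (Θ, l)) := by
    rw [Finset.sum_eq_single Θ]
    · simp only [if_true, lossDeriv_apply, Finset.mul_sum, Finset.sum_mul,
        ← Finset.sum_sub_distrib]
      refine Finset.sum_congr rfl fun l' _ => ?_
      ring
    · intro b _ hb
      simp [hb.symm]
    · simp
  have e2 : ∀ a b : ℝ, ∑ q : N, ∑ l' : ι,
      a * (b * softWeight L c β q u * L.L1 l' fun l => u (q, l)) *
        (1 / n * softWeight L c β Θ u * L.L1 l fun l => u (Θ, l)) * v (q, l') =
      a * b * (1 / n * softWeight L c β Θ u * L.L1 l fun l => u (Θ, l)) *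
        ∑ q, softWeight L c β q u * lossDeriv L q u v := by
    intro a b
    simp only [lossDeriv_apply, Finset.mul_sum]
    refine Finset.sum_congr rfl fun q _ => Finset.sum_congr rfl fun l' _ => ?_
    ring
  have e3 : ∑ q : N, ∑ l' : ι, ψ.φ1 (softMin L c β n u) * (1 / n) *
      (β * softWeight L c β Θ u * softWeight L c β q u * (L.L1 l' fun l => u (q, l)) *
        L.L1 l fun l => u (Θ, l)) * v (q, l') =
      ψ.φ1 (softMin L c β n u) * (1 / n) * (β * softWeight L c β Θ u *
        L.L1 l fun l => u (Θ, l)) * ∑ q, softWeight L c β q u * lossDeriv L q u v := by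
    simp only [lossDeriv_apply, Finset.mul_sum]
    refine Finset.sum_congr rfl fun q _ => Finset.sum_congr rfl fun l' _ => ?_
    ring
  have e4 : ∑ q, 1 / n * softWeight L c β q u * lossDeriv L q u v =
      1 / n * ∑ q, softWeight L c β q u * lossDeriv L q u v := by
    rw [Finset.mul_sum]
    exact Finset.sum_congr rfl fun q _ => by ring
  rw [e1, e2, e3, e4]
  ring

theorem continuous_softMin (hβ : β ≠ 0) : Continuous (softMin L c β n) :=
  continuous_iff_continuousAt.2 fun u => (hasFDerivAt_softMin L c β n hβ u).continuousAt

theorem continuous_softWeight (Θ : N) : Continuous (softWeight L c β Θ) :=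
  continuous_iff_continuousAt.2 fun u => (hasFDerivAt_softWeight L c β Θ u).continuousAt

theorem continuous_softHess (ψ : SmoothOuter) (hβ : β ≠ 0) (j j' : N × ι) :
    Continuous (softHess L c β n ψ j j') := by
  have h1 := continuous_softMin L c β n hβ
  have h2 := continuous_softWeight L c β
  have h3 := L.continuous_L1
  have h4 := L.continuous_L2
  have h5 := ψ.continuous_φ2
  have h6 : Continuous ψ.φ1 :=
    continuous_iff_continuousAt.2 fun t => (ψ.hasDerivAt_φ1 t).continuousAt
  unfold softHess
  by_cases hj : j.1 = j'.1
  · simp only [hj, if_true]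
    fun_prop
  · simp only [hj, if_false]
    fun_prop

/-- The constant in the bound of the second derivatives of `φ ∘ softMin`. -/
noncomputable def hessConst (L : SmoothLoss ι) (β : ℝ) (ψ : SmoothOuter) : ℝ :=
  ψ.M * (L.K ^ 2 + β * L.K ^ 2 + L.K)

theorem hessConst_nonneg (hβ : 0 ≤ β) (ψ : SmoothOuter) : 0 ≤ hessConst L β ψ := by
  have h1 := L.K_nonneg
  have h2 := ψ.M_nonneg
  unfold hessConst
  positivity

/-- Every term carries `1/n` and either the product of two Gibbs weights or, on the diagonal blocks,
a single weight. Since the weights sum to one, the bound summed over all pairs of points does not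
see the size of `N`. -/
theorem abs_softHess_le (ψ : SmoothOuter) (hβ : 0 < β) (hn : 1 ≤ n) (j j' : N × ι)
    (u : N × ι → ℝ) : |softHess L c β n ψ j j' u| ≤ hessConst L β ψ / n *
      ((if j.1 = j'.1 then softWeight L c β j.1 u else 0) +
        softWeight L c β j.1 u * softWeight L c β j'.1 u) := by
  have hn0 : 0 < n := by linarith
  have hK := L.K_nonneg
  have hM := ψ.M_nonneg
  obtain ⟨Θ, l⟩ := j
  obtain ⟨Θ', l'⟩ := j'
  unfold softHess
  simp only
  have hw := softWeight_pos L c β Θ u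
  have hw' := softWeight_pos L c β Θ' u
  have b1 := L.abs_L1_le l fun l => u (Θ, l)
  have b2 := L.abs_L1_le l' fun l => u (Θ', l)
  have b3 := ψ.abs_φ1_le (softMin L c β n u)
  have b4 := ψ.abs_φ2_le (softMin L c β n u)
  have b5 := L.abs_L2_le l l' fun l => u (Θ, l)
  have b2' := L.abs_L1_le l' fun l => u (Θ, l)
  -- The term with `φ''` is of order `1/n²`; one factor is given away to have a single form for all
  -- terms.
  have hninv : 1 / n * (1 / n) ≤ 1 / n :=
    mul_le_of_le_one_right (by positivity) ((div_le_one hn0).2 hn)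
  generalize ψ.φ1 (softMin L c β n u) = p1 at *
  generalize ψ.φ2 (softMin L c β n u) = p2 at *
  generalize hx : (L.L1 l fun l => u (Θ, l)) = x at *
  generalize hy : (L.L1 l' fun l => u (Θ', l)) = y at *
  generalize hz : (L.L2 l l' fun l => u (Θ, l)) = z at *
  generalize softWeight L c β Θ u = w at *
  generalize softWeight L c β Θ' u = w' at *
  have t1 : |p2 * (1 / n * w' * y) * (1 / n * w * x)| ≤ ψ.M * L.K ^ 2 / n * (w * w') := by
    have e : |p2 * (1 / n * w' * y) * (1 / n * w * x)| =
        |p2| * (|x| * |y|) * (1 / n * (1 / n)) * (w * w') := by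
      simp only [abs_mul, abs_of_pos hw, abs_of_pos hw', abs_of_pos (one_div_pos.2 hn0)]
      ring
    rw [e]
    calc _ ≤ ψ.M * (L.K * L.K) * (1 / n) * (w * w') := by gcongr
      _ = _ := by ring
  have t2 : |p1 * (1 / n) * (β * w * w' * y * x)| ≤ ψ.M * (β * L.K ^ 2) / n * (w * w') := by
    have e : |p1 * (1 / n) * (β * w * w' * y * x)| =
        |p1| * (β * (|x| * |y|)) * (1 / n) * (w * w') := by
      simp only [abs_mul, abs_of_pos hw, abs_of_pos hw', abs_of_pos hβ,
        abs_of_pos (one_div_pos.2 hn0)]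
      ring
    rw [e]
    calc _ ≤ ψ.M * (β * (L.K * L.K)) * (1 / n) * (w * w') := by gcongr
      _ = _ := by ring
  have key12 : ψ.M * L.K ^ 2 / n * (w * w') + ψ.M * (β * L.K ^ 2) / n * (w * w') ≤
      hessConst L β ψ / n * (w * w') := by
    have : hessConst L β ψ / n * (w * w') = ψ.M * L.K ^ 2 / n * (w * w') +
        ψ.M * (β * L.K ^ 2) / n * (w * w') + ψ.M * L.K / n * (w * w') := by
      unfold hessConst; ring
    have h0 : 0 ≤ ψ.M * L.K / n * (w * w') := by positivity
    linarith
  split_ifs with hΘ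
  · subst hΘ
    have t3 : |p1 * (1 / n) * w * (z - β * y * x)| ≤
        ψ.M * (L.K + β * L.K ^ 2) / n * w := by
      have e : |p1 * (1 / n) * w * (z - β * y * x)| =
          |p1| * |z - β * y * x| * (1 / n) * w := by
        simp only [abs_mul, abs_of_pos hw, abs_of_pos (one_div_pos.2 hn0)]
        ring
      have e2 : |z - β * y * x| ≤ L.K + β * (L.K * L.K) := by
        refine (abs_sub _ _).trans ?_
        rw [abs_mul, abs_mul, abs_of_pos hβ, mul_assoc]
        gcongr
      rw [e]
      calc _ ≤ ψ.M * (L.K + β * (L.K * L.K)) * (1 / n) * w := by gcongr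
        _ = _ := by ring
    have key3 : ψ.M * (L.K + β * L.K ^ 2) / n * w ≤ hessConst L β ψ / n * w := by
      have : hessConst L β ψ / n * w = ψ.M * (L.K + β * L.K ^ 2) / n * w +
          ψ.M * L.K ^ 2 / n * w := by
        unfold hessConst; ring
      have h0 : 0 ≤ ψ.M * L.K ^ 2 / n * w := by positivity
      linarith
    refine (abs_add_three _ _ _).trans ?_
    rw [mul_add]
    linarith
  · refine (abs_add_three _ _ _).trans ?_
    rw [abs_zero, zero_add]
    linarith

/-- `φ ∘ softMin` as a test function. -/
noncomputable def softTest (ψ : SmoothOuter) (hβ : 0 < β) (hn : 1 ≤ n) : SmoothTest (N × ι) where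
  H := fun u => ψ.φ (softMin L c β n u)
  H1 := fun j u => ψ.φ1 (softMin L c β n u) *
        (1 / n * softWeight L c β j.1 u * L.L1 j.2 fun l => u (j.1, l))
  H2 := softHess L c β n ψ
  M := ψ.M + ψ.M * L.K + hessConst L β ψ / n * 2
  hasFDerivAt_H := hasFDerivAt_softTest L c β n ψ hβ.ne'
  hasFDerivAt_H1 := hasFDerivAt_softGrad L c β n ψ hβ.ne'
  continuous_H2 := continuous_softHess L c β n ψ hβ.ne'
  abs_H_le := fun u => by
    have h1 := L.K_nonneg
    have h2 := ψ.M_nonneg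
    have h3 := hessConst_nonneg L β hβ.le ψ
    have h4 : 0 ≤ ψ.M * L.K + hessConst L β ψ / n * 2 := by positivity
    linarith [ψ.abs_φ_le (softMin L c β n u)]
  abs_H1_le := fun j u => by
    have h1 := L.K_nonneg
    have h2 := ψ.M_nonneg
    have h3 := hessConst_nonneg L β hβ.le ψ
    have hn0 : 0 < n := by linarith
    have hw := softWeight_pos L c β j.1 u
    have hw1 := softWeight_le_one L c β j.1 u
    have h4 : 0 ≤ hessConst L β ψ / n * 2 := by positivity
    have h5 : 1 / n * softWeight L c β j.1 u ≤ 1 :=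
      mul_le_one₀ ((div_le_one hn0).2 hn) hw.le hw1
    rw [abs_mul, abs_mul, abs_of_pos (mul_pos (one_div_pos.2 hn0) hw)]
    calc _ ≤ ψ.M * (1 * L.K) := by
          gcongr
          · exact ψ.abs_φ1_le _
          · exact L.abs_L1_le _ _
      _ ≤ _ := by linarith
  abs_H2_le := fun j j' u => by
    have h1 := L.K_nonneg
    have h2 := ψ.M_nonneg
    have h3 := hessConst_nonneg L β hβ.le ψ
    have hn0 : 0 < n := by linarith
    have hw := softWeight_pos L c β j.1 u
    have hw1 := softWeight_le_one L c β j.1 u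
    have hw' := softWeight_pos L c β j'.1 u
    have hw1' := softWeight_le_one L c β j'.1 u
    refine (abs_softHess_le L c β n ψ hβ hn j j' u).trans ?_
    have h6 : (if j.1 = j'.1 then softWeight L c β j.1 u else 0) +
        softWeight L c β j.1 u * softWeight L c β j'.1 u ≤ 2 := by
      have : softWeight L c β j.1 u * softWeight L c β j'.1 u ≤ 1 := mul_le_one₀ hw1 hw'.le hw1'
      split_ifs <;> linarith
    have h7 : hessConst L β ψ / n * ((if j.1 = j'.1 then softWeight L c β j.1 u else 0) +
        softWeight L c β j.1 u * softWeight L c β j'.1 u) ≤ hessConst L β ψ / n * 2 := by gcongr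
    have h8 : 0 ≤ ψ.M * L.K := by positivity
    linarith

/-! ### Comparison of the Gibbs weights with those of the other samples -/

/-- The Gibbs weights without the contribution of the loss. -/
noncomputable def priorWeight (c : N → ℝ) (Θ : N) : ℝ := Real.exp (-c Θ) / ∑ q, Real.exp (-c q)

theorem priorWeight_pos (Θ : N) : 0 < priorWeight c Θ :=
  div_pos (Real.exp_pos _) (Finset.sum_pos (fun _ _ => Real.exp_pos _) Finset.univ_nonempty)

theorem sum_priorWeight : ∑ Θ, priorWeight c Θ = 1 := by
  simp_rw [priorWeight, ← Finset.sum_div]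
  exact div_self (Finset.sum_pos (fun _ _ => Real.exp_pos _) Finset.univ_nonempty).ne'

/-- The bound of the density of the Gibbs weights with respect to the prior weights. -/
noncomputable def tiltBound (L : SmoothLoss ι) (c : N → ℝ) (β : ℝ) (Θ : N) (u : N × ι → ℝ) : ℝ :=
  ∑ q, priorWeight c q * Real.exp (β * L.K * (∑ l, |u (q, l)| + ∑ l, |u (Θ, l)|))

theorem pi_norm_le_sum_abs {ι : Type*} [Fintype ι] (v : ι → ℝ) : ‖v‖ ≤ ∑ l, |v l| :=
  (pi_norm_le_iff_of_nonneg (Finset.sum_nonneg fun _ _ => abs_nonneg _)).2 fun l =>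
    Finset.single_le_sum (f := fun l => |v l|) (fun _ _ => abs_nonneg _) (Finset.mem_univ l)

/-- Pointwise bounds by Gibbs weights are not enough: `L²` norms must be summed over `N × N`, and
the weights are random. A single loss changes the weights only by a bounded tilt: the inverse of a
prior average is at most the prior average of the inverse, and ratios of exponentials of the loss
are controlled by its Lipschitz constant. This gives deterministic weights of total mass one times a
factor with bounded moments. -/
theorem softWeight_le (hβ : 0 ≤ β) (Θ : N) (u : N × ι → ℝ) :
    softWeight L c β Θ u ≤ priorWeight c Θ * tiltBound L c β Θ u := by
  set Z := ∑ q, Real.exp (-c q) with hZ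
  have hZ0 : 0 < Z := Finset.sum_pos (fun _ _ => Real.exp_pos _) Finset.univ_nonempty
  set e : N → ℝ := fun q => Real.exp (-β * L.L fun l => u (q, l)) with he
  have he0 : ∀ q, 0 < e q := fun q => Real.exp_pos _
  have hsplit : ∀ q, softExp L c β q u = Z * (priorWeight c q * e q) := by
    intro q
    rw [softExp, sub_eq_add_neg, Real.exp_add, priorWeight, ← hZ, he]
    field_simp
  have hA : 0 < ∑ q, priorWeight c q * e q :=
    Finset.sum_pos (fun q _ => mul_pos (priorWeight_pos c q) (he0 q)) Finset.univ_nonempty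
  have hw : softWeight L c β Θ u = priorWeight c Θ * (e Θ / ∑ q, priorWeight c q * e q) := by
    rw [softWeight, softSum, hsplit]
    simp_rw [hsplit]
    rw [← Finset.mul_sum]
    field_simp
  -- Cauchy–Schwarz for the prior weights, with `√e` and `1/√e`.
  have hcs : 1 ≤ (∑ q, priorWeight c q * e q) * ∑ q, priorWeight c q * (e q)⁻¹ := by
    have := Finset.sum_sq_le_sum_mul_sum_of_sq_le_mul Finset.univ
      (r := priorWeight c) (f := fun q => priorWeight c q * e q)
      (g := fun q => priorWeight c q * (e q)⁻¹)
      (fun q _ => (mul_pos (priorWeight_pos c q) (he0 q)).le)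
      (fun q _ => (mul_pos (priorWeight_pos c q) (inv_pos.2 (he0 q))).le)
      (fun q _ => le_of_eq (by have := (he0 q).ne'; field_simp))
    rwa [sum_priorWeight, one_pow] at this
  rw [hw]
  refine mul_le_mul_of_nonneg_left ?_ (priorWeight_pos c Θ).le
  calc e Θ / ∑ q, priorWeight c q * e q ≤ e Θ * ∑ q, priorWeight c q * (e q)⁻¹ := by
        rw [div_eq_mul_inv]
        refine mul_le_mul_of_nonneg_left ?_ (he0 Θ).le
        rw [inv_le_iff_one_le_mul₀ hA, mul_comm]
        exact hcs
    _ ≤ tiltBound L c β Θ u := by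
        rw [Finset.mul_sum, tiltBound]
        refine Finset.sum_le_sum fun q _ => ?_
        rw [mul_left_comm]
        refine mul_le_mul_of_nonneg_left ?_ (priorWeight_pos c q).le
        rw [he, ← Real.exp_neg, ← Real.exp_add]
        refine Real.exp_le_exp.2 ?_
        have h1 := L.lip (fun l => u (q, l)) (fun l => u (Θ, l))
        have h2 : ‖(fun l => u (q, l)) - fun l => u (Θ, l)‖ ≤
            ∑ l, |u (q, l)| + ∑ l, |u (Θ, l)| := by
          refine (norm_sub_le _ _).trans (add_le_add ?_ ?_)
          · exact pi_norm_le_sum_abs _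
          · exact pi_norm_le_sum_abs _
        have h3 := mul_le_mul_of_nonneg_left ((le_abs_self _).trans
          (h1.trans (mul_le_mul_of_nonneg_left h2 L.K_nonneg))) hβ
        linarith

theorem one_le_tiltBound (hβ : 0 ≤ β) (Θ : N) (u : N × ι → ℝ) : 1 ≤ tiltBound L c β Θ u := by
  rw [← sum_priorWeight c, tiltBound]
  refine Finset.sum_le_sum fun q _ => ?_
  have := L.K_nonneg
  exact le_mul_of_one_le_right (priorWeight_pos c q).le (Real.one_le_exp (by positivity))

/-- Convexity of `x⁴` under the prior weights, then `exp (4x + 4y) ≤ exp (8x) + exp (8y)`. -/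
theorem tiltBound_pow_four_le (Θ : N) (u : N × ι → ℝ) :
    tiltBound L c β Θ u ^ 4 ≤ ∑ q, priorWeight c q *
      (Real.exp (8 * β * L.K * ∑ l, |u (q, l)|) + Real.exp (8 * β * L.K * ∑ l, |u (Θ, l)|)) := by
  refine (Real.pow_arith_mean_le_arith_mean_pow Finset.univ _ _
    (fun q _ => (priorWeight_pos c q).le) (sum_priorWeight c)
    (fun q _ => (Real.exp_pos _).le) 4).trans (Finset.sum_le_sum fun q _ => ?_)
  refine mul_le_mul_of_nonneg_left ?_ (priorWeight_pos c q).le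
  rw [← Real.exp_nat_mul]
  have e : ((4 : ℕ) : ℝ) * (β * L.K * (∑ l, |u (q, l)| + ∑ l, |u (Θ, l)|)) =
      4 * β * L.K * ∑ l, |u (q, l)| + 4 * β * L.K * ∑ l, |u (Θ, l)| := by push_cast; ring
  have e2 : ∀ x, 8 * β * L.K * x = 2 * (4 * β * L.K * x) := fun x => by ring
  rw [e, e2, e2, Real.exp_add, two_mul, two_mul, Real.exp_add, Real.exp_add]
  generalize Real.exp (4 * β * L.K * ∑ l, |u (q, l)|) = a
  generalize Real.exp (4 * β * L.K * ∑ l, |u (Θ, l)|) = b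
  nlinarith [sq_nonneg (a - b), sq_nonneg (a + b)]

/-- The square of a product of two weights contains `(g g')²`, at most `(g⁴ + g'⁴)/2`; this is why
fourth moments of `tiltBound` are needed. -/
theorem softHess_sq_le (ψ : SmoothOuter) (hβ : 0 < β) (hn : 1 ≤ n) (j j' : N × ι)
    (u : N × ι → ℝ) : softHess L c β n ψ j j' u ^ 2 ≤ 2 * (hessConst L β ψ / n) ^ 2 *
      ((if j.1 = j'.1 then priorWeight c j.1 else 0) ^ 2 * tiltBound L c β j.1 u ^ 4 +
        (priorWeight c j.1 * priorWeight c j'.1) ^ 2 *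
          ((tiltBound L c β j.1 u ^ 4 + tiltBound L c β j'.1 u ^ 4) / 2)) := by
  have h0 := hessConst_nonneg L β hβ.le ψ
  have hn0 : 0 < n := by linarith
  have hw := softWeight_pos L c β j.1 u
  have hw' := softWeight_pos L c β j'.1 u
  have hv := softWeight_le L c β hβ.le j.1 u
  have hv' := softWeight_le L c β hβ.le j'.1 u
  have hp := priorWeight_pos c j.1
  have hp' := priorWeight_pos c j'.1
  have hg := one_le_tiltBound L c β hβ.le j.1 u
  have hg' := one_le_tiltBound L c β hβ.le j'.1 u
  have h1 := abs_softHess_le L c β n ψ hβ hn j j' u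
  generalize softWeight L c β j.1 u = w at *
  generalize softWeight L c β j'.1 u = w' at *
  generalize tiltBound L c β j.1 u = g at *
  generalize tiltBound L c β j'.1 u = g' at *
  generalize priorWeight c j.1 = p at *
  generalize priorWeight c j'.1 = p' at *
  have hC : 0 ≤ hessConst L β ψ / n := by positivity
  generalize hessConst L β ψ / n = C at *
  set A : ℝ := if j.1 = j'.1 then w else 0 with hA
  set A' : ℝ := if j.1 = j'.1 then p else 0 with hA'
  have hA0 : 0 ≤ A := by rw [hA]; split_ifs <;> linarith
  have hA'0 : 0 ≤ A' := by rw [hA']; split_ifs <;> linarith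
  have hAA : A ≤ A' * g := by
    rw [hA, hA']; split_ifs
    · exact hv
    · simp
  have hww : w * w' ≤ (p * p') * (g * g') := by
    calc w * w' ≤ (p * g) * (p' * g') := by gcongr
      _ = _ := by ring
  have hg24 : g ^ 2 ≤ g ^ 4 := pow_le_pow_right₀ hg (by norm_num)
  have hAsq : A ^ 2 ≤ A' ^ 2 * g ^ 4 := by
    calc A ^ 2 ≤ (A' * g) ^ 2 := by gcongr
      _ = A' ^ 2 * g ^ 2 := by ring
      _ ≤ _ := by gcongr
  have hwsq : (w * w') ^ 2 ≤ (p * p') ^ 2 * ((g ^ 4 + g' ^ 4) / 2) := by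
    calc (w * w') ^ 2 ≤ ((p * p') * (g * g')) ^ 2 := by gcongr
      _ = (p * p') ^ 2 * (g ^ 2 * g' ^ 2) := by ring
      _ ≤ _ := by
        gcongr
        nlinarith [sq_nonneg (g ^ 2 - g' ^ 2)]
  calc softHess L c β n ψ j j' u ^ 2 = |softHess L c β n ψ j j' u| ^ 2 := (sq_abs _).symm
    _ ≤ (C * (A + w * w')) ^ 2 := by gcongr
    _ ≤ 2 * C ^ 2 * (A ^ 2 + (w * w') ^ 2) := by
        have : (A + w * w') ^ 2 ≤ 2 * (A ^ 2 + (w * w') ^ 2) := by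
          nlinarith [sq_nonneg (A - w * w')]
        calc (C * (A + w * w')) ^ 2 = C ^ 2 * (A + w * w') ^ 2 := by ring
          _ ≤ C ^ 2 * (2 * (A ^ 2 + (w * w') ^ 2)) := by gcongr
          _ = _ := by ring
    _ ≤ _ := by gcongr

end SoftMin

end RandomFeatures

namespace RandomFeatures

/-! ### Gaussian comparison for the soft minimum -/

section SoftComparison

variable {E₁ E₂ : Type*} [NormedAddCommGroup E₁] [InnerProductSpace ℝ E₁]
  [FiniteDimensional ℝ E₁] [MeasurableSpace E₁] [BorelSpace E₁] [NormedAddCommGroup E₂]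
  [InnerProductSpace ℝ E₂] [FiniteDimensional ℝ E₂] [MeasurableSpace E₂] [BorelSpace E₂]
  {ι N J : Type*} [Fintype ι] [Fintype N] [Fintype J]

/-- The parameter is a quarter of what the gradient bound allows, so that the same one serves for
the Gaussian features in `MatchedFeatures.subG_inner_a`. -/
theorem MatchedFeatures.subG_F (f : MatchedFeatures E₁ E₂ J) (j : J) :
    SubG (stdGaussian E₁) (f.F j) (1 / (4 * Real.pi ^ 2 * f.A ^ 2)) := by
  have hA := f.A_pos
  have hpi := Real.pi_pos
  refine subG_of_gradient (f.hasFDerivAt_F j) (f.continuous_gF j) (f.norm_gF_le j) (f.mean_zero j)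
    (by positivity) ?_
  field_simp
  norm_num

/-- By matching, `‖a j‖²` is the second moment of `F j`, which is subgaussian. -/
theorem MatchedFeatures.norm_a_sq_le (f : MatchedFeatures E₁ E₂ J) (j : J) :
    ‖f.a j‖ ^ 2 ≤ Real.pi ^ 2 * f.A ^ 2 := by
  have hA := f.A_pos
  have hpi := Real.pi_pos
  have h : SubG (stdGaussian E₁) (f.F j) (1 / (Real.pi ^ 2 * f.A ^ 2)) :=
    subG_of_gradient (f.hasFDerivAt_F j) (f.continuous_gF j) (f.norm_gF_le j) (f.mean_zero j)
      (by positivity) (le_of_eq (by field_simp))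
  have h2 := (h.integral_sq_le (by positivity) (f.continuous_F j).measurable.aemeasurable).2
  rw [← real_inner_self_eq_norm_sq, f.inner_a]
  simp_rw [← sq]
  refine h2.trans (le_of_eq ?_)
  field_simp

theorem MatchedFeatures.subG_inner_a (f : MatchedFeatures E₁ E₂ J) (j : J) :
    SubG (stdGaussian E₂) (fun ξ => inner ℝ (f.a j) ξ) (1 / (4 * Real.pi ^ 2 * f.A ^ 2)) := by
  have hA := f.A_pos
  have hpi := Real.pi_pos
  refine subG_inner ?_
  have := f.norm_a_sq_le j
  rw [one_div_mul_eq_div, div_le_iff₀ (by positivity)]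
  linarith

/-- The bound of exponential moments of the sums of `m` interpolating features. -/
noncomputable def expConst (m : ℕ) (A t : ℝ) : ℝ :=
  4 * m * Real.exp ((2 * (t * m)) ^ 2 / (4 * (1 / (4 * Real.pi ^ 2 * A ^ 2))))

/-- The sum of the `|v l|` is at most their number times the largest; separating the coordinates
this way requires no independence. -/
theorem exp_sum_abs_le [Nonempty ι] {t : ℝ} (ht : 0 ≤ t) (v : ι → ℝ) :
    Real.exp (t * ∑ l, |v l|) ≤ ∑ l, Real.exp (t * Fintype.card ι * |v l|) := by
  obtain ⟨l₀, -, hl₀⟩ := Finset.exists_max_image Finset.univ (fun l => |v l|)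
    Finset.univ_nonempty
  calc Real.exp (t * ∑ l, |v l|) ≤ Real.exp (t * Fintype.card ι * |v l₀|) := by
        refine Real.exp_le_exp.2 ?_
        rw [mul_assoc]
        refine mul_le_mul_of_nonneg_left ?_ ht
        have := Finset.sum_le_card_nsmul Finset.univ (fun l => |v l|) _ hl₀
        simpa using this
    _ ≤ _ := Finset.single_le_sum (f := fun l => Real.exp (t * Fintype.card ι * |v l|))
        (fun _ _ => (Real.exp_pos _).le) (Finset.mem_univ l₀)

theorem SubG.integral_exp_abs_le {α : Type*} [MeasurableSpace α] {μ : Measure α} {f : α → ℝ}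
    {c : ℝ} (h : SubG μ f c) (hc : 0 < c) (hf : Measurable f) (a : ℝ) :
    Integrable (fun x => Real.exp (a * |f x|)) μ ∧
      ∫ x, Real.exp (a * |f x|) ∂μ ≤ 2 * Real.exp (a ^ 2 / (4 * c)) :=
  integral_le_of_lintegral_ofReal_le (Measurable.aestronglyMeasurable (by fun_prop))
    (fun _ => (Real.exp_pos _).le) (by positivity) (h.lintegral_exp_abs_le hc a)

/-- Uniform in the interpolation parameters and in `q`: the exponential of a sum is at most the sum
of the exponentials with doubled exponents, which separates the coordinates and the two Gaussian
vectors. -/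
theorem MatchedFeatures.integral_exp_sum_le [Nonempty ι] (f : MatchedFeatures E₁ E₂ (N × ι))
    {s r t : ℝ} (hs : |s| ≤ 1) (hr : |r| ≤ 1) (ht : 0 ≤ t) (q : N) :
    Integrable (fun w : E₁ × E₂ => Real.exp (t * ∑ l, |f.mix s r w.1 w.2 (q, l)|))
      ((stdGaussian E₁).prod (stdGaussian E₂)) ∧
    ∫ w : E₁ × E₂, Real.exp (t * ∑ l, |f.mix s r w.1 w.2 (q, l)|)
      ∂((stdGaussian E₁).prod (stdGaussian E₂)) ≤ expConst (Fintype.card ι) f.A t := by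
  have hA := f.A_pos
  have hpi := Real.pi_pos
  set m : ℝ := (Fintype.card ι : ℝ) with hm_def
  have hm : 0 ≤ m := Nat.cast_nonneg _
  have hc : 0 < 1 / (4 * Real.pi ^ 2 * f.A ^ 2) := by positivity
  have hF := fun l => (f.subG_F (q, l)).integral_exp_abs_le hc
    (f.continuous_F (q, l)).measurable (2 * (t * m))
  have ha := fun l => (f.subG_inner_a (q, l)).integral_exp_abs_le hc
    (Measurable.const_inner measurable_id) (2 * (t * m))
  have iF := fun l => Integrable.comp_fst (hF l).1 (stdGaussian E₂)
  have ia := fun l => Integrable.comp_snd (ha l).1 (stdGaussian E₁)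
  have hpt : ∀ w : E₁ × E₂, Real.exp (t * ∑ l, |f.mix s r w.1 w.2 (q, l)|) ≤
      ∑ l, (Real.exp (2 * (t * m) * |f.F (q, l) w.1|) +
        Real.exp (2 * (t * m) * |inner ℝ (f.a (q, l)) w.2|)) := by
    intro w
    refine (exp_sum_abs_le ht _).trans (Finset.sum_le_sum fun l _ => ?_)
    have h1 : |f.mix s r w.1 w.2 (q, l)| ≤ |f.F (q, l) w.1| + |inner ℝ (f.a (q, l)) w.2| := by
      refine (abs_add_le _ _).trans ?_
      rw [abs_mul, abs_mul]
      exact add_le_add (mul_le_of_le_one_left (abs_nonneg _) hs)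
        (mul_le_of_le_one_left (abs_nonneg _) hr)
    have htm : 0 ≤ t * m := mul_nonneg ht hm
    have e2 : ∀ x, 2 * (t * m) * x = 2 * (t * m * x) := fun x => by ring
    calc Real.exp (t * m * |f.mix s r w.1 w.2 (q, l)|)
        ≤ Real.exp (t * m * (|f.F (q, l) w.1| + |inner ℝ (f.a (q, l)) w.2|)) := by gcongr
      _ ≤ _ := by
        rw [mul_add, e2, e2, Real.exp_add, two_mul, two_mul, Real.exp_add, Real.exp_add]
        generalize Real.exp (t * m * |f.F (q, l) w.1|) = a
        generalize Real.exp (t * m * |inner ℝ (f.a (q, l)) w.2|) = b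
        nlinarith [sq_nonneg (a - b), sq_nonneg (a + b)]
  have hcont : Continuous fun w : E₁ × E₂ =>
      Real.exp (t * ∑ l, |f.mix s r w.1 w.2 (q, l)|) := by
    have := f.continuous_mix s r
    have h2 : ∀ l, Continuous fun w : E₁ × E₂ => f.mix s r w.1 w.2 (q, l) := fun l =>
      (continuous_apply (q, l)).comp this
    fun_prop
  have hbi : Integrable (fun w : E₁ × E₂ => ∑ l, (Real.exp (2 * (t * m) * |f.F (q, l) w.1|) +
        Real.exp (2 * (t * m) * |inner ℝ (f.a (q, l)) w.2|)))
      ((stdGaussian E₁).prod (stdGaussian E₂)) :=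
    integrable_finsetSum _ fun l _ => (iF l).add (ia l)
  have hi : Integrable (fun w : E₁ × E₂ => Real.exp (t * ∑ l, |f.mix s r w.1 w.2 (q, l)|))
      ((stdGaussian E₁).prod (stdGaussian E₂)) := by
    refine Integrable.mono' hbi hcont.aestronglyMeasurable (Eventually.of_forall fun w => ?_)
    rw [Real.norm_of_nonneg (Real.exp_pos _).le]
    exact hpt w
  refine ⟨hi, (integral_mono hi hbi hpt).trans ?_⟩
  rw [integral_finsetSum (f := fun l (w : E₁ × E₂) =>
      Real.exp (2 * (t * m) * |f.F (q, l) w.1|) +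
        Real.exp (2 * (t * m) * |inner ℝ (f.a (q, l)) w.2|)) _ fun l _ => (iF l).add (ia l)]
  calc _ ≤ ∑ l : ι, 4 * Real.exp ((2 * (t * m)) ^ 2 / (4 * (1 / (4 * Real.pi ^ 2 * f.A ^ 2)))) := by
        refine Finset.sum_le_sum fun l _ => ?_
        rw [integral_add (iF l) (ia l), integral_prod _ (iF l), integral_prod _ (ia l)]
        have h1 := (hF l).2
        have h2 := (ha l).2
        simp only [integral_const, probReal_univ, smul_eq_mul, one_mul]
        linarith
    _ = _ := by
        rw [Finset.sum_const, Finset.card_univ, nsmul_eq_mul, expConst]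
        ring

variable [Nonempty N] [DecidableEq N] (L : SmoothLoss ι) (c : N → ℝ) (β n : ℝ)

theorem continuous_tiltBound (Θ : N) : Continuous (tiltBound L c β Θ) := by
  unfold tiltBound; fun_prop

/-- The average over `q` is taken with weights of total mass one, so the bound depends neither on
`N` nor on `c`. -/
theorem MatchedFeatures.integral_tiltBound_le [Nonempty ι] (f : MatchedFeatures E₁ E₂ (N × ι))
    (hβ : 0 ≤ β) {s r : ℝ} (hs : |s| ≤ 1) (hr : |r| ≤ 1) (Θ : N) :
    Integrable (fun w : E₁ × E₂ => tiltBound L c β Θ (f.mix s r w.1 w.2) ^ 4)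
      ((stdGaussian E₁).prod (stdGaussian E₂)) ∧
    ∫ w : E₁ × E₂, tiltBound L c β Θ (f.mix s r w.1 w.2) ^ 4
      ∂((stdGaussian E₁).prod (stdGaussian E₂)) ≤
        2 * expConst (Fintype.card ι) f.A (8 * β * L.K) := by
  have ht : 0 ≤ 8 * β * L.K := mul_nonneg (by positivity) L.K_nonneg
  have h := fun q => f.integral_exp_sum_le hs hr ht q
  have hbi : Integrable (fun w : E₁ × E₂ => ∑ q, priorWeight c q *
      (Real.exp (8 * β * L.K * ∑ l, |f.mix s r w.1 w.2 (q, l)|) +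
        Real.exp (8 * β * L.K * ∑ l, |f.mix s r w.1 w.2 (Θ, l)|)))
      ((stdGaussian E₁).prod (stdGaussian E₂)) :=
    integrable_finsetSum _ fun q _ => ((h q).1.add (h Θ).1).const_mul _
  have hcont : Continuous fun w : E₁ × E₂ => tiltBound L c β Θ (f.mix s r w.1 w.2) ^ 4 :=
    ((continuous_tiltBound L c β Θ).comp (f.continuous_mix s r)).pow 4
  have hi : Integrable (fun w : E₁ × E₂ => tiltBound L c β Θ (f.mix s r w.1 w.2) ^ 4)
      ((stdGaussian E₁).prod (stdGaussian E₂)) := by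
    refine Integrable.mono' hbi hcont.aestronglyMeasurable (Eventually.of_forall fun w => ?_)
    rw [Real.norm_of_nonneg (by positivity)]
    exact tiltBound_pow_four_le L c β Θ _
  refine ⟨hi, (integral_mono hi hbi fun w => tiltBound_pow_four_le L c β Θ _).trans ?_⟩
  rw [integral_finsetSum (f := fun q (w : E₁ × E₂) => priorWeight c q *
      (Real.exp (8 * β * L.K * ∑ l, |f.mix s r w.1 w.2 (q, l)|) +
        Real.exp (8 * β * L.K * ∑ l, |f.mix s r w.1 w.2 (Θ, l)|))) _
      fun q _ => ((h q).1.add (h Θ).1).const_mul _]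
  calc _ ≤ ∑ q, priorWeight c q * (2 * expConst (Fintype.card ι) f.A (8 * β * L.K)) := by
        refine Finset.sum_le_sum fun q _ => ?_
        rw [integral_const_mul, integral_add (h q).1 (h Θ).1]
        refine mul_le_mul_of_nonneg_left ?_ (priorWeight_pos c q).le
        linarith [(h q).2, (h Θ).2]
    _ = _ := by rw [← Finset.sum_mul, sum_priorWeight, one_mul]

/-- The constant in the comparison of one sample. -/
noncomputable def compConst (m : ℕ) (A K M β : ℝ) : ℝ :=
  8 * Real.pi ^ 3 * (M * (K ^ 2 + β * K ^ 2 + K)) * expConst m A (8 * β * K) * m ^ 2 * A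

/-- The general comparison applied to `softTest`. The bound is free of `N` and `c`, the latter
because `c` will contain the contribution of the other samples, and it carries `1/n` so that `n`
exchanges are affordable. -/
theorem MatchedFeatures.abs_integral_softMin_sub_le [Nonempty ι]
    (f : MatchedFeatures E₁ E₂ (N × ι)) (ψ : SmoothOuter) (hβ : 0 < β) (hn : 1 ≤ n) :
    |∫ z, ψ.φ (softMin L c β n fun j => f.F j z) ∂(stdGaussian E₁) -
      ∫ ξ, ψ.φ (softMin L c β n fun j => inner ℝ (f.a j) ξ) ∂(stdGaussian E₂)| ≤
    compConst (Fintype.card ι) f.A L.K ψ.M β * f.B / n := by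
  have hA := f.A_pos
  have hB := f.B_pos
  have hn0 : 0 < n := by linarith
  set C := hessConst L β ψ with hC
  have hC0 : 0 ≤ C := hessConst_nonneg L β hβ.le ψ
  set m := Fintype.card ι with hm
  have hm1 : (1 : ℝ) ≤ m := by
    rw [hm]; exact_mod_cast Fintype.card_pos
  set D := 2 * expConst m f.A (8 * β * L.K) with hD
  -- Allows `D ≤ D²`, so that no square root of `D` appears in `κ`.
  have hD1 : 1 ≤ D := by
    rw [hD, expConst]
    have : (1 : ℝ) ≤ Real.exp ((2 * (8 * β * L.K * m)) ^ 2 /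
      (4 * (1 / (4 * Real.pi ^ 2 * f.A ^ 2)))) := Real.one_le_exp (by positivity)
    nlinarith
  -- The `L²` bounds of the second derivatives, with the deterministic prior weights in place of the
  -- Gibbs weights.
  set κ : N × ι → N × ι → ℝ := fun j j' => 2 * (C / n) * D *
    ((if j.1 = j'.1 then priorWeight c j.1 else 0) +
      priorWeight c j.1 * priorWeight c j'.1) with hκ
  have hp := priorWeight_pos c
  have hκ0 : ∀ j j', 0 ≤ κ j j' := by
    intro j j'
    have h1 := (hp j.1).le
    have h2 := (hp j'.1).le
    have h3 : 0 ≤ if j.1 = j'.1 then priorWeight c j.1 else 0 := by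
      split_ifs <;> linarith
    simp only [hκ]
    positivity
  have hL2 : ∀ s r : ℝ, |s| ≤ 1 → |r| ≤ 1 → ∀ j j', ∫ q : E₁ × E₂,
      (softTest L c β n ψ hβ hn).H2 j j' (f.mix s r q.1 q.2) ^ 2
      ∂((stdGaussian E₁).prod (stdGaussian E₂)) ≤ κ j j' ^ 2 := by
    intro s r hs hr j j'
    have t1 := f.integral_tiltBound_le L c β hβ.le hs hr j.1
    have t2 := f.integral_tiltBound_le L c β hβ.le hs hr j'.1
    set a : ℝ := if j.1 = j'.1 then priorWeight c j.1 else 0 with ha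
    have ha0 : 0 ≤ a := by
      have h1 := (hp j.1).le
      rw [ha]; split_ifs <;> linarith
    set b := priorWeight c j.1 * priorWeight c j'.1 with hb
    have hb0 : 0 ≤ b := (mul_pos (hp _) (hp _)).le
    have hbi := ((t1.1.const_mul (a ^ 2)).add
      (((t1.1.add t2.1).div_const 2).const_mul (b ^ 2))).const_mul (2 * (C / n) ^ 2)
    have t3 : Integrable (fun q : E₁ × E₂ => b ^ 2 *
        ((tiltBound L c β j.1 (f.mix s r q.1 q.2) ^ 4 +
          tiltBound L c β j'.1 (f.mix s r q.1 q.2) ^ 4) / 2))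
        ((stdGaussian E₁).prod (stdGaussian E₂)) :=
      ((t1.1.add t2.1).div_const 2).const_mul (b ^ 2)
    calc _ ≤ ∫ q : E₁ × E₂, 2 * (C / n) ^ 2 *
          (a ^ 2 * tiltBound L c β j.1 (f.mix s r q.1 q.2) ^ 4 + b ^ 2 *
            ((tiltBound L c β j.1 (f.mix s r q.1 q.2) ^ 4 +
              tiltBound L c β j'.1 (f.mix s r q.1 q.2) ^ 4) / 2))
          ∂((stdGaussian E₁).prod (stdGaussian E₂)) := by
          refine integral_mono ?_ hbi fun q => softHess_sq_le L c β n ψ hβ hn j j' _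
          exact (memLp_two_of_abs_le (f.measurable_H2_mix (softTest L c β n ψ hβ hn) s r j j')
            fun q => (softTest L c β n ψ hβ hn).abs_H2_le _ _ _).integrable_sq
      _ = 2 * (C / n) ^ 2 * (a ^ 2 * ∫ q : E₁ × E₂, tiltBound L c β j.1 (f.mix s r q.1 q.2) ^ 4
          ∂((stdGaussian E₁).prod (stdGaussian E₂)) + b ^ 2 *
            ((∫ q : E₁ × E₂, tiltBound L c β j.1 (f.mix s r q.1 q.2) ^ 4
          ∂((stdGaussian E₁).prod (stdGaussian E₂)) +
            ∫ q : E₁ × E₂, tiltBound L c β j'.1 (f.mix s r q.1 q.2) ^ 4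
          ∂((stdGaussian E₁).prod (stdGaussian E₂))) / 2)) := by
          rw [integral_const_mul, integral_add (t1.1.const_mul _) t3, integral_const_mul,
            integral_const_mul, integral_div, integral_add t1.1 t2.1]
      _ ≤ 2 * (C / n) ^ 2 * (a ^ 2 * D + b ^ 2 * ((D + D) / 2)) := by
          gcongr
          · exact t1.2
          · exact t1.2
          · exact t2.2
      _ = 2 * (C / n) ^ 2 * ((a ^ 2 + b ^ 2) * D) := by ring
      _ ≤ 4 * (C / n) ^ 2 * ((a + b) ^ 2 * D ^ 2) := by
          have h1 : a ^ 2 + b ^ 2 ≤ (a + b) ^ 2 := by nlinarith [mul_nonneg ha0 hb0]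
          have h2 : D ≤ D ^ 2 := by nlinarith
          gcongr
          norm_num
      _ = _ := by simp only [hκ]; ring
  refine (f.abs_integral_sub_le (softTest L c β n ψ hβ hn) hκ0 hL2).trans (le_of_eq ?_)
  -- Diagonal and off-diagonal parts each have prior mass one, and the `m²` pairs in `ι × ι` are
  -- counted; the cardinality of `N` drops out.
  have hsum : ∑ j : N × ι, ∑ j' : N × ι, κ j j' = 4 * (C / n) * D * m ^ 2 := by
    simp only [hκ, ← Finset.mul_sum, Fintype.sum_prod_type, Finset.sum_const, Finset.card_univ,
      ← hm, nsmul_eq_mul, Finset.sum_add_distrib, Finset.sum_ite_eq, Finset.mem_univ, if_true,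
      sum_priorWeight, mul_one]
    rw [← Finset.sum_mul, sum_priorWeight]
    ring
  rw [hsum, compConst, hC, hD, hessConst]
  ring

end SoftComparison

end RandomFeatures

namespace RandomFeatures

/-! ### Mollification of Lipschitz functions -/

section Mollification

variable {E : Type*} [NormedAddCommGroup E] [NormedSpace ℝ E] [FiniteDimensional ℝ E]
  [MeasurableSpace E] [BorelSpace E] (μ : Measure E) [μ.IsAddHaarMeasure]

/-- The convolution of `f` with the kernel `ρ`. -/
noncomputable def mollify (f ρ : E → ℝ) (u : E) : ℝ := ∫ t, f (u - t) * ρ t ∂μ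

variable {f ρ : E → ℝ}

theorem mollify_eq_convolution (f ρ : E → ℝ) :
    mollify μ f ρ = convolution f ρ (ContinuousLinearMap.mul ℝ ℝ) μ := by
  ext u
  rw [convolution_eq_swap]
  rfl

/-- The derivative falls on the kernel, so every derivative of a mollification is itself a
mollification of `f`. -/
theorem hasFDerivAt_mollify (hf : Continuous f) (hρ : ContDiff ℝ 1 ρ) (hc : HasCompactSupport ρ)
    (u : E) : ∃ D : E →L[ℝ] ℝ, HasFDerivAt (mollify μ f ρ) D u ∧
      ∀ v, D v = mollify μ f (fun t => fderiv ℝ ρ t v) u := by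
  refine ⟨(convolution f (fderiv ℝ ρ) ((ContinuousLinearMap.mul ℝ ℝ).precompR E) μ) u, ?_, ?_⟩
  · rw [mollify_eq_convolution]
    exact hc.hasFDerivAt_convolution_right _ hf.locallyIntegrable hρ u
  · intro v
    rw [mollify_eq_convolution, convolution_precompR_apply _ hf.locallyIntegrable
      (hc.fderiv ℝ) (hρ.continuous_fderiv one_ne_zero)]

/-- The kernel `ρ` may change sign: the lemma also serves for the derivatives of the bump, where the
`L¹` norm of the kernel becomes the constant. -/
theorem abs_mollify_sub_le (hf : Continuous f) (hρ : Continuous ρ) (hc : HasCompactSupport ρ)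
    {K : ℝ} (hK : ∀ u v, |f u - f v| ≤ K * ‖u - v‖) (u v : E) :
    |mollify μ f ρ u - mollify μ f ρ v| ≤ K * (∫ t, |ρ t| ∂μ) * ‖u - v‖ := by
  have hi : ∀ u, Integrable (fun t => f (u - t) * ρ t) μ := fun u =>
    Continuous.integrable_of_hasCompactSupport (by fun_prop) hc.mul_left
  have hρi : Integrable (fun t => |ρ t|) μ :=
    (hρ.integrable_of_hasCompactSupport hc).abs
  rw [mollify, mollify, ← integral_sub (hi u) (hi v)]
  calc _ ≤ ∫ t, (K * ‖u - v‖) * |ρ t| ∂μ := by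
        refine (abs_integral_le_integral_abs).trans
          (integral_mono ((hi u).sub (hi v)).abs (hρi.const_mul _) fun t => ?_)
        simp only
        rw [← sub_mul, abs_mul]
        refine mul_le_mul_of_nonneg_right ((hK _ _).trans (le_of_eq ?_)) (abs_nonneg _)
        congr 2
        abel
    _ = _ := by rw [integral_const_mul]; ring

theorem abs_mollify_sub_self_le (hf : Continuous f) (hρ : Continuous ρ) (hc : HasCompactSupport ρ)
    {K s : ℝ} (hK0 : 0 ≤ K) (hK : ∀ u v, |f u - f v| ≤ K * ‖u - v‖) (h0 : ∀ t, 0 ≤ ρ t)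
    (h1 : ∫ t, ρ t ∂μ = 1) (hs : ∀ t, s < ‖t‖ → ρ t = 0) (u : E) :
    |mollify μ f ρ u - f u| ≤ K * s := by
  have hi : ∀ u, Integrable (fun t => f (u - t) * ρ t) μ := fun u =>
    Continuous.integrable_of_hasCompactSupport (by fun_prop) hc.mul_left
  have hρi : Integrable ρ μ := hρ.integrable_of_hasCompactSupport hc
  have e : f u = ∫ t, f u * ρ t ∂μ := by rw [integral_const_mul, h1, mul_one]
  rw [e, mollify, ← integral_sub (hi u) (hρi.const_mul _)]
  calc _ ≤ ∫ t, (K * s) * ρ t ∂μ := by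
        refine (abs_integral_le_integral_abs).trans
          (integral_mono ((hi u).sub (hρi.const_mul _)).abs (hρi.const_mul _) fun t => ?_)
        simp only
        rw [← sub_mul, abs_mul, abs_of_nonneg (h0 t)]
        rcases le_or_gt ‖t‖ s with hts | hts
        · refine mul_le_mul_of_nonneg_right ((hK _ _).trans ?_) (h0 t)
          rw [sub_sub_cancel_left, norm_neg]
          exact mul_le_mul_of_nonneg_left hts hK0
        · simp [hs t hts]
    _ = _ := by rw [integral_const_mul, h1]; ring

end Mollification

/-! ### Smooth approximations of losses and of test functions. -/

section SmoothApproximation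

variable (ι : Type*) [Fintype ι]

theorem hasFDerivAt_mollify_pi {f ρ : (ι → ℝ) → ℝ} [DecidableEq ι]
    (hf : Continuous f) (hρ : ContDiff ℝ 1 ρ) (hc : HasCompactSupport ρ) (u : ι → ℝ) :
    HasFDerivAt (mollify volume f ρ)
      (∑ l, mollify volume f (fun t => fderiv ℝ ρ t (Pi.single l 1)) u •
        (ContinuousLinearMap.proj l : (ι → ℝ) →L[ℝ] ℝ)) u := by
  obtain ⟨D, h1, h2⟩ := hasFDerivAt_mollify volume hf hρ hc u
  refine h1.congr_fderiv ?_
  refine ContinuousLinearMap.coe_injective (LinearMap.pi_ext' fun l => LinearMap.ext_ring ?_)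
  simp [h2, Pi.single_apply]

/-- Lipschitz functions are uniformly approximated by smooth ones, with derivatives controlled in
terms of the Lipschitz constant only. -/
theorem exists_smoothLoss {K : ℝ} (hK0 : 0 ≤ K) {s : ℝ} (hs : 0 < s) :
    ∃ K' : ℝ, 0 ≤ K' ∧ ∀ f : (ι → ℝ) → ℝ, (∀ u v, |f u - f v| ≤ K * ‖u - v‖) →
      ∃ L : SmoothLoss ι, L.K = K' ∧ ∀ u, |L.L u - f u| ≤ K * s := by
  classical
  let b : ContDiffBump (0 : ι → ℝ) := ⟨s / 2, s, by positivity, by linarith⟩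
  set ρ : (ι → ℝ) → ℝ := b.normed volume with hρ_def
  have hρ : ContDiff ℝ (⊤ : ℕ∞) ρ := b.contDiff_normed
  have hc : HasCompactSupport ρ := b.hasCompactSupport_normed
  set ρ1 : ι → (ι → ℝ) → ℝ := fun l t => fderiv ℝ ρ t (Pi.single l 1) with hρ1_def
  have hρ1 : ∀ l, ContDiff ℝ (⊤ : ℕ∞) (ρ1 l) := fun l =>
    (hρ.fderiv_right (m := ((⊤ : ℕ∞) : WithTop ℕ∞)) (by simp)).clm_apply contDiff_const
  have hc1 : ∀ l, HasCompactSupport (ρ1 l) := fun l => hc.fderiv_apply ℝ _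
  set ρ2 : ι → ι → (ι → ℝ) → ℝ := fun l l' t => fderiv ℝ (ρ1 l) t (Pi.single l' 1) with hρ2_def
  have hρ2 : ∀ l l', ContDiff ℝ (⊤ : ℕ∞) (ρ2 l l') := fun l l' =>
    ((hρ1 l).fderiv_right (m := ((⊤ : ℕ∞) : WithTop ℕ∞)) (by simp)).clm_apply contDiff_const
  have hc2 : ∀ l l', HasCompactSupport (ρ2 l l') := fun l l' => (hc1 l).fderiv_apply ℝ _
  have h1 : ∫ t, ρ t = 1 := b.integral_normed
  have h0 : ∀ t, 0 ≤ ρ t := fun t => b.nonneg_normed t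
  have hsupp : ∀ t, s < ‖t‖ → ρ t = 0 := by
    intro t ht
    by_contra h
    have : t ∈ Function.support ρ := h
    rw [hρ_def, b.support_normed_eq] at this
    have h2 : ‖t‖ < s := by simpa using this
    linarith
  set T : ℝ := ∑ l, ∫ t, |ρ1 l t| with hT
  have hT0 : ∀ l, 0 ≤ ∫ t, |ρ1 l t| := fun l => integral_nonneg fun t => abs_nonneg _
  have hTl : ∀ l, ∫ t, |ρ1 l t| ≤ T := fun l =>
    Finset.single_le_sum (f := fun l => ∫ t, |ρ1 l t|) (fun l _ => hT0 l) (Finset.mem_univ l)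
  have hT1 : 0 ≤ T := Finset.sum_nonneg fun l _ => hT0 l
  -- `T` bounds the `L¹` norms of the first derivatives of the kernel, so `K T` bounds the Lipschitz
  -- constants of the first derivatives of the mollification, hence its second derivatives. The
  -- constant depends on the scale `s` but not on `f`; it therefore serves for all `n` and all
  -- values of the noise.
  refine ⟨K * (1 + T), by positivity, fun f hf => ?_⟩
  have hfc : Continuous f := by
    refine LipschitzWith.continuous (K := ⟨K, hK0⟩) (LipschitzWith.of_dist_le_mul fun u v => ?_)
    rw [Real.dist_eq, dist_eq_norm]
    exact hf u v
  have hlip : ∀ u v, |mollify volume f ρ u - mollify volume f ρ v| ≤ K * ‖u - v‖ := by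
    intro u v
    refine (abs_mollify_sub_le volume hfc hρ.continuous hc hf u v).trans (le_of_eq ?_)
    simp_rw [abs_of_nonneg (h0 _), h1, mul_one]
  -- Partial derivatives of a Lipschitz function are bounded by its constant, as basis vectors have
  -- sup norm at most one.
  have bound : ∀ {g : (ι → ℝ) → ℝ} {g1 : ι → (ι → ℝ) → ℝ} {C : ℝ}, 0 ≤ C →
      (∀ u, HasFDerivAt g (∑ l, g1 l u • (ContinuousLinearMap.proj l : (ι → ℝ) →L[ℝ] ℝ)) u) →
      (∀ u v, |g u - g v| ≤ C * ‖u - v‖) → ∀ l u, |g1 l u| ≤ C := by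
    intro g g1 C hC hg hgl l u
    have h := (hg u).le_of_lipschitz (C := ⟨C, hC⟩) (LipschitzWith.of_dist_le_mul fun u v => by
      rw [Real.dist_eq, dist_eq_norm]; exact hgl u v)
    have h2 := ContinuousLinearMap.le_of_opNorm_le _ h (Pi.single l 1)
    have h3 : ‖(Pi.single l 1 : ι → ℝ)‖ ≤ 1 := by
      refine (pi_norm_le_iff_of_nonneg zero_le_one).2 fun i => ?_
      by_cases h : i = l
      · subst h; simp
      · simp [h]
    simp only [_root_.sum_apply, _root_.smul_apply,
      ContinuousLinearMap.proj_apply, Pi.single_apply, smul_eq_mul, mul_ite, mul_one, mul_zero,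
      Finset.sum_ite_eq', Finset.mem_univ, if_true, Real.norm_eq_abs] at h2
    refine h2.trans ?_
    exact (mul_le_mul_of_nonneg_left h3 hC).trans_eq (mul_one _)
  have hd : ∀ u, HasFDerivAt (mollify volume f ρ) (∑ l, mollify volume f (ρ1 l) u •
      (ContinuousLinearMap.proj l : (ι → ℝ) →L[ℝ] ℝ)) u := fun u =>
    hasFDerivAt_mollify_pi ι hfc (hρ.of_le (by norm_cast)) hc u
  have hd1 : ∀ l u, HasFDerivAt (mollify volume f (ρ1 l)) (∑ l', mollify volume f (ρ2 l l') u •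
      (ContinuousLinearMap.proj l' : (ι → ℝ) →L[ℝ] ℝ)) u := fun l u =>
    hasFDerivAt_mollify_pi ι hfc ((hρ1 l).of_le (by norm_cast)) (hc1 l) u
  have hlip1 : ∀ l u v, |mollify volume f (ρ1 l) u - mollify volume f (ρ1 l) v| ≤
      K * (1 + T) * ‖u - v‖ := by
    intro l u v
    refine (abs_mollify_sub_le volume hfc (hρ1 l).continuous (hc1 l) hf u v).trans ?_
    have := hTl l
    gcongr
    linarith
  have hK' : K ≤ K * (1 + T) := by nlinarith
  have hlip' : ∀ u v, |mollify volume f ρ u - mollify volume f ρ v| ≤ K * (1 + T) * ‖u - v‖ :=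
    fun u v => (hlip u v).trans (by gcongr)
  exact ⟨{
    L := mollify volume f ρ
    L1 := fun l => mollify volume f (ρ1 l)
    L2 := fun l l' => mollify volume f (ρ2 l l')
    K := K * (1 + T)
    hasFDerivAt_L := hd
    hasFDerivAt_L1 := hd1
    continuous_L2 := fun l l' => continuous_iff_continuousAt.2 fun u =>
      (hasFDerivAt_mollify_pi ι hfc ((hρ2 l l').of_le (by norm_cast))
        (hc2 l l') u).continuousAt
    lip := hlip'
    abs_L1_le := bound (by positivity) hd hlip'
    abs_L2_le := fun l => bound (by positivity) (hd1 l) (hlip1 l)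
    K_nonneg := by positivity }, rfl, fun u =>
      abs_mollify_sub_self_le volume hfc hρ.continuous hc hK0 hf h0 h1 hsupp u⟩

/-- The case of a one-point index type, with the boundedness of `ψ` carried along. -/
theorem exists_smoothOuter {ψ : ℝ → ℝ} {K M : ℝ} (hK0 : 0 ≤ K)
    (hψ : ∀ t t', |ψ t - ψ t'| ≤ K * |t - t'|) (hM : ∀ t, |ψ t| ≤ M) {s : ℝ} (hs : 0 < s) :
    ∃ φ : SmoothOuter, ∀ t, |φ.φ t - ψ t| ≤ K * s := by
  obtain ⟨K', hK', h⟩ := exists_smoothLoss Unit hK0 hs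
  obtain ⟨L, rfl, hL⟩ := h (fun u => ψ (u ())) fun u v => by
    refine (hψ _ _).trans (mul_le_mul_of_nonneg_left ?_ hK0)
    exact norm_le_pi_norm (u - v) ()
  have hc : ∀ t : ℝ, HasDerivAt (fun t : ℝ => (fun _ : Unit => t)) (fun _ => 1) t := fun t =>
    hasDerivAt_pi.2 fun _ => hasDerivAt_id t
  refine ⟨{
    φ := fun t => L.L fun _ => t
    φ1 := fun t => L.L1 () fun _ => t
    φ2 := fun t => L.L2 () () fun _ => t
    M := M + K * s + L.K
    hasDerivAt_φ := fun t => ?_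
    hasDerivAt_φ1 := fun t => ?_
    continuous_φ2 := (L.continuous_L2 () ()).comp (by fun_prop)
    abs_φ_le := fun t => ?_
    abs_φ1_le := fun t => ?_
    abs_φ2_le := fun t => ?_ }, fun t => hL _⟩
  · have := (L.hasFDerivAt_L fun _ => t).comp_hasDerivAt t (hc t)
    simpa [Function.comp_def] using this
  · have := (L.hasFDerivAt_L1 () fun _ => t).comp_hasDerivAt t (hc t)
    simpa [Function.comp_def] using this
  · have h1 := hL fun _ => t
    have h2 := hM t
    have h3 := abs_sub_abs_le_abs_sub (L.L fun _ => t) (ψ t)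
    linarith
  all_goals
    have h1 : 0 ≤ M := (abs_nonneg _).trans (hM t)
    have h2 : 0 ≤ K * s := by positivity
    have h3 := L.abs_L1_le () fun _ => t
    have h4 := L.abs_L2_le () () fun _ => t
    linarith

end SmoothApproximation

end RandomFeatures

namespace RandomFeatures

/-! ### Lindeberg replacement -/

section Lindeberg

theorem integral_pi_succ {S : Type*} [MeasurableSpace S] (μ : Measure S) [IsProbabilityMeasure μ]
    {n : ℕ} {Φ : (Fin (n + 1) → S) → ℝ} (hΦ : Measurable Φ) {M : ℝ} (hM : ∀ x, |Φ x| ≤ M) :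
    ∫ x, Φ x ∂(Measure.pi fun _ : Fin (n + 1) => μ) =
      ∫ s, ∫ x, Φ (Fin.cons s x) ∂(Measure.pi fun _ : Fin n => μ) ∂μ := by
  have h := (measurePreserving_piFinSuccAbove (fun _ : Fin (n + 1) => μ) 0).symm
  rw [← h.integral_comp' Φ]
  have hm : Measurable fun q : S × (Fin n → S) =>
      Φ ((MeasurableEquiv.piFinSuccAbove (fun _ : Fin (n + 1) => S) 0).symm q) :=
    hΦ.comp (MeasurableEquiv.measurable _)
  rw [integral_prod _ (integrable_of_abs_le hm fun q => hM _)]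
  simp_rw [MeasurableEquiv.piFinSuccAbove_symm_apply]
  simp [Fin.insertNthEquiv]

/-- The exchange of coordinates one at a time. The hypothesis on a single coordinate is uniform in
the others, so each exchange costs `δ`; independence enters through the product measures and Fubini.
-/
theorem abs_integral_pi_sub_le {S : Type*} [MeasurableSpace S] (μ ν : Measure S)
    [IsProbabilityMeasure μ] [IsProbabilityMeasure ν] {δ M : ℝ} (n : ℕ) (Φ : (Fin n → S) → ℝ)
    (hΦ : Measurable Φ) (hM : ∀ x, |Φ x| ≤ M)
    (hδ : ∀ i x, |∫ s, Φ (Function.update x i s) ∂μ - ∫ s, Φ (Function.update x i s) ∂ν| ≤ δ) :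
    |∫ x, Φ x ∂(Measure.pi fun _ : Fin n => μ) - ∫ x, Φ x ∂(Measure.pi fun _ : Fin n => ν)| ≤
      n * δ := by
  induction n with
  | zero =>
    have e : (Measure.pi fun _ : Fin 0 => μ) = Measure.pi fun _ : Fin 0 => ν := by
      rw [Measure.pi_of_empty, Measure.pi_of_empty]
    simp [e]
  | succ n ih =>
    have hcm : Measurable fun q : S × (Fin n → S) => (Fin.cons q.1 q.2 : Fin (n + 1) → S) := by
      refine measurable_pi_lambda _ fun i => ?_
      refine Fin.cases ?_ (fun i => ?_) i
      · simpa using measurable_fst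
      · simpa [Function.comp_def] using (measurable_pi_apply i).comp measurable_snd
    have hΦc : Measurable fun q : S × (Fin n → S) => Φ (Fin.cons q.1 q.2) := hΦ.comp hcm
    set μn := Measure.pi fun _ : Fin n => μ
    set νn := Measure.pi fun _ : Fin n => ν
    rw [integral_pi_succ μ hΦ hM, integral_pi_succ ν hΦ hM]
    have hs : ∀ s, Measurable fun x : Fin n → S => Φ (Fin.cons s x) := fun s =>
      hΦc.comp measurable_prodMk_left
    have hIn : ∀ (κ : Measure (Fin n → S)) [IsProbabilityMeasure κ],
        Measurable fun s => ∫ x, Φ (Fin.cons s x) ∂κ := fun κ _ =>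
      (StronglyMeasurable.integral_prod_right' (ν := κ) hΦc.stronglyMeasurable).measurable
    have hInb : ∀ (κ : Measure (Fin n → S)) [IsProbabilityMeasure κ] s,
        |∫ x, Φ (Fin.cons s x) ∂κ| ≤ M := fun κ _ s => abs_integral_le_of_abs_le fun x => hM _
    have h1 : |∫ s, ∫ x, Φ (Fin.cons s x) ∂μn ∂μ - ∫ s, ∫ x, Φ (Fin.cons s x) ∂νn ∂μ| ≤
        n * δ := by
      rw [← integral_sub (integrable_of_abs_le (hIn μn) (hInb μn))
        (integrable_of_abs_le (hIn νn) (hInb νn))]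
      refine abs_integral_le_of_abs_le fun s => ?_
      refine ih (fun x => Φ (Fin.cons s x)) (hs s) (fun x => hM _) fun i x => ?_
      have := hδ i.succ (Fin.cons s x)
      simpa only [Fin.cons_update] using this
    -- The last `n` coordinates already have law `ν`; only the first is exchanged here.
    have h2 : |∫ s, ∫ x, Φ (Fin.cons s x) ∂νn ∂μ - ∫ s, ∫ x, Φ (Fin.cons s x) ∂νn ∂ν| ≤ δ := by
      have sw : ∀ (κ : Measure S) [IsProbabilityMeasure κ],
          ∫ s, ∫ x, Φ (Fin.cons s x) ∂νn ∂κ = ∫ x, ∫ s, Φ (Fin.cons s x) ∂κ ∂νn := fun κ _ =>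
        integral_integral_swap (f := fun s x => Φ (Fin.cons s x))
          (integrable_of_abs_le (μ := κ.prod νn) hΦc fun q => hM _)
      have hm : ∀ (κ : Measure S) [IsProbabilityMeasure κ],
          Measurable fun x => ∫ s, Φ (Fin.cons s x) ∂κ := fun κ _ =>
        (StronglyMeasurable.integral_prod_left' (μ := κ) hΦc.stronglyMeasurable).measurable
      have hb : ∀ (κ : Measure S) [IsProbabilityMeasure κ] x,
          |∫ s, Φ (Fin.cons s x) ∂κ| ≤ M := fun κ _ x => abs_integral_le_of_abs_le fun s => hM _
      rw [sw μ, sw ν, ← integral_sub (integrable_of_abs_le (hm μ) (hb μ))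
        (integrable_of_abs_le (hm ν) (hb ν))]
      refine abs_integral_le_of_abs_le fun x => ?_
      -- An arbitrary first coordinate is needed to state the update; an empty space carries no
      -- probability measure.
      rcases isEmpty_or_nonempty S with hS | ⟨⟨s₀⟩⟩
      · exact absurd (IsProbabilityMeasure.ne_zero μ) (by simp [Measure.eq_zero_of_isEmpty])
      have := hδ 0 (Fin.cons s₀ x)
      simpa only [Fin.update_cons_zero] using this
    push_cast
    calc _ ≤ _ := abs_sub_le _ (∫ s, ∫ x, Φ (Fin.cons s x) ∂νn ∂μ) _
      _ ≤ n * δ + δ := add_le_add h1 h2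
      _ = _ := by ring

end Lindeberg

/-! ### The free energy of all samples and its invariance under the exchange. -/

section SoftRisk

variable {ι N : Type*} [Fintype ι] [Fintype N] {n : ℕ}

/-- The free energy approximating the minimal regularized risk over the finite set `N`, as a
function of the projected features. -/
noncomputable def softRisk (L : Fin n → SmoothLoss ι) (r : N → ℝ) (β : ℝ)
    (u : Fin n → N × ι → ℝ) : ℝ :=
  -(1 / (n * β)) * Real.log (∑ Θ, Real.exp (-(n * β * r Θ) - β * ∑ i, (L i).L fun l => u i (Θ, l)))

/-- As a function of one sample the free energy is a soft minimum: the regularizer and the losses of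
the other samples become the constants `c`. -/
theorem softRisk_update (L : Fin n → SmoothLoss ι) (r : N → ℝ) (β : ℝ)
    (u : Fin n → N × ι → ℝ) (i : Fin n) (v : N × ι → ℝ) :
    softRisk L r β (Function.update u i v) =
      softMin (L i) (fun Θ => n * β * r Θ +
        β * ∑ i' ∈ Finset.univ.erase i, (L i').L fun l => u i' (Θ, l)) β n v := by
  classical
  unfold softRisk softMin softSum softExp
  refine congrArg (fun x => -(1 / (n * β)) * Real.log x) (Finset.sum_congr rfl fun Θ _ => ?_)
  refine congrArg Real.exp ?_
  rw [← Finset.add_sum_erase Finset.univ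
    (fun i' => (L i').L fun l => Function.update u i v i' (Θ, l)) (Finset.mem_univ i)]
  have : ∀ i' ∈ Finset.univ.erase i, ((L i').L fun l => Function.update u i v i' (Θ, l)) =
      (L i').L fun l => u i' (Θ, l) := fun i' hi' => by
    rw [Function.update_of_ne (Finset.ne_of_mem_erase hi')]
  rw [Finset.sum_congr rfl this, Function.update_self]
  ring

theorem measurable_softRisk (L : Fin n → SmoothLoss ι) (r : N → ℝ) (β : ℝ) :
    Measurable (softRisk L r β) := by
  have h : ∀ i Θ, Measurable fun u : Fin n → N × ι → ℝ => (L i).L fun l => u i (Θ, l) :=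
    fun i Θ => (L i).continuous_L.measurable.comp (by fun_prop)
  unfold softRisk
  fun_prop

variable {E₁ E₂ : Type*} [NormedAddCommGroup E₁] [InnerProductSpace ℝ E₁]
  [FiniteDimensional ℝ E₁] [MeasurableSpace E₁] [BorelSpace E₁] [NormedAddCommGroup E₂]
  [InnerProductSpace ℝ E₂] [FiniteDimensional ℝ E₂] [MeasurableSpace E₂] [BorelSpace E₂]

/-- Push both laws forward to the common space of projections and exchange the samples; `n`
exchanges at cost `compConst * B / n` each. There is no dependence on `N`, `r` or `n`. -/
theorem MatchedFeatures.abs_integral_softRisk_sub_le [Nonempty ι] [Nonempty N]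
    (f : MatchedFeatures E₁ E₂ (N × ι)) (ψ : SmoothOuter) {β K : ℝ} (hβ : 0 < β) (hn : 0 < n)
    (L : Fin n → SmoothLoss ι) (hL : ∀ i, (L i).K = K) (r : N → ℝ) :
    |∫ z, ψ.φ (softRisk L r β fun i j => f.F j (z i))
        ∂(Measure.pi fun _ : Fin n => stdGaussian E₁) -
      ∫ ξ, ψ.φ (softRisk L r β fun i j => inner ℝ (f.a j) (ξ i))
        ∂(Measure.pi fun _ : Fin n => stdGaussian E₂)| ≤
    compConst (Fintype.card ι) f.A K ψ.M β * f.B := by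
  classical
  have hF : Measurable fun (z : E₁) (j : N × ι) => f.F j z :=
    measurable_pi_lambda _ fun j => (f.continuous_F j).measurable
  have ha : Measurable fun (ξ : E₂) (j : N × ι) => inner ℝ (f.a j) ξ :=
    measurable_pi_lambda _ fun j => Measurable.const_inner measurable_id
  have hψ : Measurable ψ.φ :=
    (continuous_iff_continuousAt.2 fun t => (ψ.hasDerivAt_φ t).continuousAt).measurable
  have hΦ : Measurable fun u : Fin n → N × ι → ℝ => ψ.φ (softRisk L r β u) :=
    hψ.comp (measurable_softRisk L r β)
  set μ := (stdGaussian E₁).map fun z (j : N × ι) => f.F j z with hμ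
  set ν := (stdGaussian E₂).map fun ξ (j : N × ι) => inner ℝ (f.a j) ξ with hν
  have pμ : IsProbabilityMeasure μ := Measure.isProbabilityMeasure_map hF.aemeasurable
  have pν : IsProbabilityMeasure ν := Measure.isProbabilityMeasure_map ha.aemeasurable
  have e1 : (Measure.pi fun _ : Fin n => μ) = (Measure.pi fun _ : Fin n => stdGaussian E₁).map
      fun z i j => f.F j (z i) := (Measure.pi_map_pi fun _ => hF.aemeasurable).symm
  have e2 : (Measure.pi fun _ : Fin n => ν) = (Measure.pi fun _ : Fin n => stdGaussian E₂).map
      fun ξ i j => inner ℝ (f.a j) (ξ i) := (Measure.pi_map_pi fun _ => ha.aemeasurable).symm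
  have m1 : Measurable fun (z : Fin n → E₁) (i : Fin n) (j : N × ι) => f.F j (z i) :=
    measurable_pi_lambda _ fun i => hF.comp (measurable_pi_apply i)
  have m2 : Measurable fun (ξ : Fin n → E₂) (i : Fin n) (j : N × ι) => inner ℝ (f.a j) (ξ i) :=
    measurable_pi_lambda _ fun i => ha.comp (measurable_pi_apply i)
  have key := abs_integral_pi_sub_le μ ν n (fun u => ψ.φ (softRisk L r β u)) hΦ
    (fun u => ψ.abs_φ_le _) (δ := compConst (Fintype.card ι) f.A K ψ.M β * f.B / n) ?_
  · rw [e1, e2, integral_map m1.aemeasurable hΦ.aestronglyMeasurable,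
      integral_map m2.aemeasurable hΦ.aestronglyMeasurable] at key
    refine key.trans (le_of_eq ?_)
    have : (n : ℝ) ≠ 0 := by positivity
    field_simp
  · intro i x
    have hs : Measurable fun s : N × ι → ℝ => ψ.φ (softRisk L r β (Function.update x i s)) :=
      hΦ.comp (measurable_update x)
    rw [hμ, hν, integral_map hF.aemeasurable hs.aestronglyMeasurable,
      integral_map ha.aemeasurable hs.aestronglyMeasurable]
    simp_rw [softRisk_update]
    rw [← hL i]
    exact f.abs_integral_softMin_sub_le (L i) _ β n ψ hβ (by exact_mod_cast hn)

end SoftRisk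

end RandomFeatures

namespace RandomFeatures

/-! ### Random features with fixed weights -/

section Features

/-- Activation functions with bounded first and second derivatives, centered under the standard
Gaussian distribution. -/
structure IsActivation (σ : ℝ → ℝ) (M : ℝ) : Prop where
  contDiff : ContDiff ℝ 3 σ
  pos : 0 < M
  abs_deriv_le : ∀ t, |deriv σ t| ≤ M
  abs_deriv_deriv_le : ∀ t, |deriv (deriv σ) t| ≤ M
  mean_zero : ∫ t, σ t ∂(gaussianReal 0 1) = 0

namespace IsActivation

variable {σ : ℝ → ℝ} {M : ℝ} (h : IsActivation σ M)

include h

theorem hasDerivAt (t : ℝ) : HasDerivAt σ (deriv σ t) t :=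
  ((h.contDiff.differentiable (by norm_num)) t).hasDerivAt

theorem contDiff_deriv : ContDiff ℝ 2 (deriv σ) := by
  have := h.contDiff
  rw [show (3 : WithTop ℕ∞) = 2 + 1 by norm_num, contDiff_succ_iff_deriv] at this
  exact this.2.2

theorem abs_deriv_sub_le (s t : ℝ) : |deriv σ s - deriv σ t| ≤ M * |s - t| := by
  have := Convex.norm_image_sub_le_of_norm_deriv_le (f := deriv σ) (C := M) (s := Set.univ)
    (x := t) (y := s) (fun x _ => (h.contDiff_deriv.differentiable (by norm_num)) x)
    (fun x _ => h.abs_deriv_deriv_le x) convex_univ (Set.mem_univ _) (Set.mem_univ _)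
  simpa using this

end IsActivation

variable {d p : ℕ}

/-- Unit weights whose frame operator is bounded by `Λ²`. -/
structure IsGoodWeights (W : Fin p → EuclideanSpace ℝ (Fin d)) (Λ : ℝ) : Prop where
  norm_eq : ∀ a, ‖W a‖ = 1
  pos : 0 < Λ
  frame : ∀ v, ∑ a, inner ℝ v (W a) ^ 2 ≤ Λ ^ 2 * ‖v‖ ^ 2

/-- The adjoint form of the frame bound: pair the sum with itself, apply Cauchy–Schwarz and the
frame inequality, and cancel `‖s‖²`. -/
theorem IsGoodWeights.norm_sum_le {W : Fin p → EuclideanSpace ℝ (Fin d)} {Λ : ℝ}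
    (hW : IsGoodWeights W Λ) (c : Fin p → ℝ) : ‖∑ a, c a • W a‖ ≤ Λ * √(∑ a, c a ^ 2) := by
  set s := ∑ a, c a • W a with hs
  have h1 : ‖s‖ ^ 2 = ∑ a, c a * inner ℝ s (W a) := by
    rw [← real_inner_self_eq_norm_sq]
    conv_lhs => rw [hs, sum_inner]
    refine Finset.sum_congr rfl fun a _ => ?_
    rw [real_inner_smul_left, real_inner_comm]
  have h2 := Finset.sum_mul_sq_le_sq_mul_sq Finset.univ c fun a => inner ℝ s (W a)
  rw [← h1] at h2
  have h3 := hW.frame s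
  have hc : 0 ≤ ∑ a, c a ^ 2 := Finset.sum_nonneg fun _ _ => sq_nonneg _
  rcases (norm_nonneg s).eq_or_lt with h0 | h0
  · rw [← h0]
    have := hW.pos
    positivity
  · refine abs_le_of_sq_le_sq' ?_ (by have := hW.pos; positivity) |>.2
    rw [mul_pow, Real.sq_sqrt hc]
    have h4 : (‖s‖ ^ 2) ^ 2 ≤ (∑ a, c a ^ 2) * (Λ ^ 2 * ‖s‖ ^ 2) := h2.trans (by gcongr)
    have h5 : 0 < ‖s‖ ^ 2 := by positivity
    refine le_of_mul_le_mul_right (a := ‖s‖ ^ 2) ?_ h5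
    nlinarith

/-- The projection of the features on `θ`. -/
noncomputable def projFeature (σ : ℝ → ℝ) (W : Fin p → EuclideanSpace ℝ (Fin d))
    (θ : EuclideanSpace ℝ (Fin p)) (z : EuclideanSpace ℝ (Fin d)) : ℝ :=
  inner ℝ θ (feature σ W z)

/-- The gradient of `projFeature`. -/
noncomputable def projFeatureGrad (σ : ℝ → ℝ) (W : Fin p → EuclideanSpace ℝ (Fin d))
    (θ : EuclideanSpace ℝ (Fin p)) (z : EuclideanSpace ℝ (Fin d)) : EuclideanSpace ℝ (Fin d) :=
  ∑ a, (θ a * deriv σ (inner ℝ (W a) z)) • W a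

theorem projFeature_eq_sum (σ : ℝ → ℝ) (W : Fin p → EuclideanSpace ℝ (Fin d))
    (θ : EuclideanSpace ℝ (Fin p)) (z : EuclideanSpace ℝ (Fin d)) :
    projFeature σ W θ z = ∑ a, θ a * σ (inner ℝ (W a) z) := by
  simp [projFeature, feature, PiLp.inner_apply, mul_comm]

variable {σ : ℝ → ℝ} {M Λ : ℝ} {W : Fin p → EuclideanSpace ℝ (Fin d)}

theorem IsActivation.hasFDerivAt_unit (hσ : IsActivation σ M) (w z : EuclideanSpace ℝ (Fin d)) :
    HasFDerivAt (fun z => σ (inner ℝ w z)) (innerSL ℝ (deriv σ (inner ℝ w z) • w)) z := by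
  have h := (hσ.hasDerivAt (inner ℝ w z)).comp_hasFDerivAt z (innerSL ℝ w).hasFDerivAt
  refine h.congr_fderiv ?_
  ext v
  simp

theorem IsActivation.hasFDerivAt_projFeature (hσ : IsActivation σ M)
    (θ : EuclideanSpace ℝ (Fin p)) (z : EuclideanSpace ℝ (Fin d)) :
    HasFDerivAt (projFeature σ W θ) (innerSL ℝ (projFeatureGrad σ W θ z)) z := by
  have e : projFeature σ W θ = fun z => ∑ a, θ a * σ (inner ℝ (W a) z) :=
    funext fun z => projFeature_eq_sum σ W θ z
  rw [e]
  refine (HasFDerivAt.fun_sum fun a _ => (hσ.hasFDerivAt_unit (W a) z).const_mul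
    (θ a)).congr_fderiv ?_
  ext v
  simp [projFeatureGrad, mul_assoc]

theorem IsActivation.contDiff_projFeatureGrad (hσ : IsActivation σ M)
    (θ : EuclideanSpace ℝ (Fin p)) : ContDiff ℝ 1 (projFeatureGrad σ W θ) := by
  have h := hσ.contDiff_deriv.of_le (show (1 : WithTop ℕ∞) ≤ 2 by norm_num)
  unfold projFeatureGrad
  refine ContDiff.sum fun a _ => ContDiff.smul (contDiff_const.mul (h.comp ?_)) contDiff_const
  exact (innerSL ℝ (W a)).contDiff

theorem IsActivation.norm_projFeatureGrad_le (hσ : IsActivation σ M) (hW : IsGoodWeights W Λ)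
    (θ : EuclideanSpace ℝ (Fin p)) (z : EuclideanSpace ℝ (Fin d)) :
    ‖projFeatureGrad σ W θ z‖ ≤ Λ * M * ‖θ‖ := by
  have hM := hσ.pos
  have hΛ := hW.pos
  refine (hW.norm_sum_le _).trans ?_
  rw [mul_assoc]
  refine mul_le_mul_of_nonneg_left ?_ hΛ.le
  rw [EuclideanSpace.norm_eq, ← Real.sqrt_sq hM.le, ← Real.sqrt_mul (sq_nonneg M)]
  refine Real.sqrt_le_sqrt ?_
  rw [Finset.mul_sum]
  refine Finset.sum_le_sum fun a _ => ?_
  rw [mul_pow, Real.norm_eq_abs, sq_abs, mul_comm]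
  gcongr ?_ * _
  rw [← sq_abs]
  exact pow_le_pow_left₀ (abs_nonneg _) (hσ.abs_deriv_le _) 2

/-- The frame bound is used twice, for the combination of the `W a` and for the increments `⟨W a, z
- z'⟩`. The coefficients `θ a` leave the sum through their supremum rather than their Euclidean
norm; this yields the factor `R/√p`. -/
theorem IsActivation.norm_projFeatureGrad_sub_le (hσ : IsActivation σ M)
    (hW : IsGoodWeights W Λ) {θ : EuclideanSpace ℝ (Fin p)} {T : ℝ} (hT : ∀ a, |θ a| ≤ T)
    (hT0 : 0 ≤ T) (z z' : EuclideanSpace ℝ (Fin d)) :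
    ‖projFeatureGrad σ W θ z - projFeatureGrad σ W θ z'‖ ≤ Λ ^ 2 * M * T * ‖z - z'‖ := by
  have hM := hσ.pos
  have hΛ := hW.pos
  have e : projFeatureGrad σ W θ z - projFeatureGrad σ W θ z' =
      ∑ a, (θ a * (deriv σ (inner ℝ (W a) z) - deriv σ (inner ℝ (W a) z'))) • W a := by
    simp only [projFeatureGrad, ← Finset.sum_sub_distrib, ← sub_smul, mul_sub]
  rw [e]
  refine (hW.norm_sum_le _).trans ?_
  rw [show Λ ^ 2 * M * T * ‖z - z'‖ = Λ * (T * M * Λ * ‖z - z'‖) by ring]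
  refine mul_le_mul_of_nonneg_left ?_ hΛ.le
  refine Real.sqrt_le_iff.2 ⟨by positivity, ?_⟩
  calc _ ≤ ∑ a, (T * M) ^ 2 * inner ℝ (z - z') (W a) ^ 2 := by
        refine Finset.sum_le_sum fun a _ => ?_
        rw [← mul_pow]
        refine sq_le_sq.2 ?_
        rw [abs_mul, abs_mul]
        have h1 := hσ.abs_deriv_sub_le (inner ℝ (W a) z) (inner ℝ (W a) z')
        rw [← inner_sub_right, real_inner_comm (z - z')] at h1
        rw [abs_mul, abs_of_pos hM, abs_of_nonneg hT0, mul_assoc]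
        exact mul_le_mul (hT a) h1 (abs_nonneg _) hT0
    _ ≤ (T * M) ^ 2 * (Λ ^ 2 * ‖z - z'‖ ^ 2) := by
        rw [← Finset.mul_sum]
        exact mul_le_mul_of_nonneg_left (hW.frame _) (sq_nonneg _)
    _ = _ := by ring

theorem IsActivation.integrable_unit (hσ : IsActivation σ M) {w : EuclideanSpace ℝ (Fin d)}
    (hw : ‖w‖ = 1) : Integrable (fun z => σ (inner ℝ w z)) (stdGaussian (EuclideanSpace ℝ (Fin d))) :=
  integrable_of_gradient (hσ.hasFDerivAt_unit w) (A := M) fun x => by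
    rw [norm_smul, hw, mul_one]; exact hσ.abs_deriv_le _

theorem IsActivation.integral_unit (hσ : IsActivation σ M) {w : EuclideanSpace ℝ (Fin d)}
    (hw : ‖w‖ = 1) : ∫ z, σ (inner ℝ w z) ∂(stdGaussian (EuclideanSpace ℝ (Fin d))) = 0 := by
  have h := stdGaussian_map_inner w
  rw [hw, one_pow, Real.toNNReal_one] at h
  rw [← hσ.mean_zero, ← h, integral_map (by fun_prop)
    hσ.contDiff.continuous.aestronglyMeasurable]

theorem IsActivation.integral_projFeature (hσ : IsActivation σ M) (hW : IsGoodWeights W Λ)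
    (θ : EuclideanSpace ℝ (Fin p)) :
    ∫ z, projFeature σ W θ z ∂(stdGaussian (EuclideanSpace ℝ (Fin d))) = 0 := by
  simp_rw [projFeature_eq_sum]
  rw [integral_finsetSum _ fun a _ => (hσ.integrable_unit (hW.norm_eq a)).const_mul _]
  simp [integral_const_mul, hσ.integral_unit (hW.norm_eq _)]

theorem memLp_two_norm_stdGaussian (E : Type*) [NormedAddCommGroup E] [InnerProductSpace ℝ E]
    [FiniteDimensional ℝ E] [MeasurableSpace E] [BorelSpace E] :
    MemLp (fun z => ‖z‖) 2 (stdGaussian E) :=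
  (IsGaussian.memLp_two_id (μ := stdGaussian E)).norm

theorem IsActivation.memLp_unit (hσ : IsActivation σ M) {w : EuclideanSpace ℝ (Fin d)}
    (hw : ‖w‖ = 1) : MemLp (fun z => σ (inner ℝ w z)) 2 (stdGaussian (EuclideanSpace ℝ (Fin d))) := by
  have h0 := (memLp_two_norm_stdGaussian (EuclideanSpace ℝ (Fin d))).const_mul M
  have h1 := (memLp_const (|σ (inner ℝ w 0)|) (p := 2)
    (μ := stdGaussian (EuclideanSpace ℝ (Fin d)))).add h0
  have h2 : Continuous fun z : EuclideanSpace ℝ (Fin d) => σ (inner ℝ w z) :=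
    continuous_of_gradient (hσ.hasFDerivAt_unit w)
  refine h1.mono h2.aestronglyMeasurable (Eventually.of_forall fun z => ?_)
  have := abs_le_of_gradient (hσ.hasFDerivAt_unit w) (A := M) (fun x => by
    rw [norm_smul, hw, mul_one]; exact hσ.abs_deriv_le _) z
  exact this.trans (le_abs_self _)

/-- The quadratic form of `condCov` is the covariance of the projected features; positivity and the
matching of covariances both rest on it. -/
theorem IsActivation.inner_condCov (hσ : IsActivation σ M) (hW : ∀ a, ‖W a‖ = 1)
    (θ θ' : EuclideanSpace ℝ (Fin p)) :
    inner ℝ θ (Matrix.toEuclideanCLM (𝕜 := ℝ) (condCov σ W) θ') =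
      ∫ z, projFeature σ W θ z * projFeature σ W θ' z
        ∂(stdGaussian (EuclideanSpace ℝ (Fin d))) := by
  have hi : ∀ a b, Integrable (fun z => σ (inner ℝ (W a) z) * σ (inner ℝ (W b) z))
      (stdGaussian (EuclideanSpace ℝ (Fin d))) := fun a b =>
    (hσ.memLp_unit (hW a)).integrable_mul (hσ.memLp_unit (hW b))
  have hi' : ∀ a b, Integrable (fun z => θ a * σ (inner ℝ (W a) z) *
      (θ' b * σ (inner ℝ (W b) z))) (stdGaussian (EuclideanSpace ℝ (Fin d))) := fun a b =>
    ((hi a b).const_mul (θ a * θ' b)).congr (Eventually.of_forall fun z => by ring)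
  simp_rw [projFeature_eq_sum, Finset.sum_mul_sum]
  rw [integral_finsetSum _ fun a _ => integrable_finsetSum _ fun b _ => hi' a b,
    Matrix.inner_toEuclideanCLM]
  simp only [dotProduct, Matrix.mulVec, Finset.mul_sum]
  refine Finset.sum_congr rfl fun a _ => ?_
  rw [integral_finsetSum _ fun b _ => hi' a b]
  refine Finset.sum_congr rfl fun b _ => ?_
  simp_rw [mul_mul_mul_comm (θ a)]
  rw [integral_const_mul]
  simp only [condCov, feature, Matrix.of_apply]
  ring

theorem IsActivation.posSemidef_condCov (hσ : IsActivation σ M) (hW : ∀ a, ‖W a‖ = 1) :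
    (condCov σ W).PosSemidef := by
  refine Matrix.PosSemidef.of_dotProduct_mulVec_nonneg ?_ fun x => ?_
  · ext a b
    simp only [condCov, Matrix.conjTranspose_apply, Matrix.of_apply, star_trivial]
    simp_rw [mul_comm]
  · have h := hσ.inner_condCov hW (WithLp.toLp 2 x) (WithLp.toLp 2 x)
    rw [Matrix.inner_toEuclideanCLM] at h
    simp only [star_trivial]
    rw [h]
    exact integral_nonneg fun z => mul_self_nonneg _

open scoped MatrixOrder in
/-- The symmetric square root of the covariance of the features. -/
noncomputable def covRoot (σ : ℝ → ℝ) (W : Fin p → EuclideanSpace ℝ (Fin d)) :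
    EuclideanSpace ℝ (Fin p) →L[ℝ] EuclideanSpace ℝ (Fin p) :=
  Matrix.toEuclideanCLM (𝕜 := ℝ) (CFC.sqrt (condCov σ W))

open scoped MatrixOrder in
theorem multivariateGaussian_condCov (σ : ℝ → ℝ) (W : Fin p → EuclideanSpace ℝ (Fin d)) :
    multivariateGaussian 0 (condCov σ W) =
      (stdGaussian (EuclideanSpace ℝ (Fin p))).map (covRoot σ W) := by
  simp [multivariateGaussian, covRoot]

open scoped MatrixOrder in
theorem inner_covRoot_left (σ : ℝ → ℝ) (W : Fin p → EuclideanSpace ℝ (Fin d))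
    (θ ξ : EuclideanSpace ℝ (Fin p)) :
    inner ℝ (covRoot σ W θ) ξ = inner ℝ θ (covRoot σ W ξ) := by
  have h : IsSelfAdjoint (covRoot σ W) := (CFC.sqrt_nonneg _).isSelfAdjoint.map _
  rw [← ContinuousLinearMap.adjoint_inner_right, h.adjoint_eq]

-- The square root is self-adjoint and squares to the covariance matrix, so the vectors `covRoot σ W
-- θ` realize the covariances of the features.
open scoped MatrixOrder in
theorem IsActivation.inner_covRoot_covRoot (hσ : IsActivation σ M) (hW : ∀ a, ‖W a‖ = 1)
    (θ θ' : EuclideanSpace ℝ (Fin p)) :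
    inner ℝ (covRoot σ W θ) (covRoot σ W θ') =
      ∫ z, projFeature σ W θ z * projFeature σ W θ' z
        ∂(stdGaussian (EuclideanSpace ℝ (Fin d))) := by
  rw [inner_covRoot_left, ← hσ.inner_condCov hW, covRoot, ← ContinuousLinearMap.comp_apply,
    ← ContinuousLinearMap.mul_def, ← map_mul,
    CFC.sqrt_mul_sqrt_self _ (hσ.posSemidef_condCov hW).nonneg]

/-- The projections of the random features on parameters in a cube, and the projections of Gaussian
features with the same covariance. -/
noncomputable def featuresOf {J : Type*} (hσ : IsActivation σ M) (hW : IsGoodWeights W Λ)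
    (θ : J → EuclideanSpace ℝ (Fin p)) {R T : ℝ} (hR : 0 < R) (hT : 0 < T)
    (hθ : ∀ j, ‖θ j‖ ≤ R) (hθ' : ∀ j a, |θ j a| ≤ T) :
    MatchedFeatures (EuclideanSpace ℝ (Fin d)) (EuclideanSpace ℝ (Fin p)) J where
  F j := projFeature σ W (θ j)
  gF j := projFeatureGrad σ W (θ j)
  a j := covRoot σ W (θ j)
  A := Λ * M * R
  B := Λ ^ 2 * M * T
  A_pos := mul_pos (mul_pos hW.pos hσ.pos) hR
  B_pos := by have := hW.pos; have := hσ.pos; positivity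
  hasFDerivAt_F j x := hσ.hasFDerivAt_projFeature (θ j) x
  contDiff_gF j := hσ.contDiff_projFeatureGrad (θ j)
  norm_gF_le j x := (hσ.norm_projFeatureGrad_le hW (θ j) x).trans
    (mul_le_mul_of_nonneg_left (hθ j) (mul_pos hW.pos hσ.pos).le)
  lip_gF j x y := hσ.norm_projFeatureGrad_sub_le hW (hθ' j) hT.le x y
  mean_zero j := hσ.integral_projFeature hW (θ j)
  inner_a j j' := hσ.inner_covRoot_covRoot hW.norm_eq (θ j) (θ j')

theorem norm_le_of_mem_linftyBall {R : ℝ} (hR : 0 ≤ R) {θ : EuclideanSpace ℝ (Fin p)}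
    (h : θ ∈ linftyBall p R) : ‖θ‖ ≤ R := by
  rw [EuclideanSpace.norm_eq]
  refine Real.sqrt_le_iff.2 ⟨hR, ?_⟩
  calc ∑ a, ‖θ a‖ ^ 2 ≤ ∑ _a : Fin p, (R / √p) ^ 2 :=
        Finset.sum_le_sum fun a _ => pow_le_pow_left₀ (norm_nonneg _) (h a) 2
    _ = p * (R ^ 2 / p) := by
        rw [Finset.sum_const, Finset.card_univ, Fintype.card_fin, nsmul_eq_mul, div_pow,
          Real.sq_sqrt (Nat.cast_nonneg _)]
    _ ≤ R ^ 2 := by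
        rcases Nat.eq_zero_or_pos p with rfl | hp
        · simp [sq_nonneg]
        · rw [mul_div_cancel₀]
          positivity

end Features

end RandomFeatures

namespace RandomFeatures

/-! ### Nets and operator norms of matrices with subgaussian rows -/

section Nets

variable {E : Type*} [NormedAddCommGroup E] [NormedSpace ℝ E] [FiniteDimensional ℝ E]

/-- The balls of radius `ε/2` around the points are disjoint and lie in the ball of radius `R +
ε/2`; compare volumes. -/
theorem card_le_of_separated {R ε : ℝ} (hR : 0 ≤ R) (hε : 0 < ε) (s : Finset E)
    (hs : ∀ c ∈ s, ‖c‖ ≤ R) (h : ∀ c ∈ s, ∀ d ∈ s, c ≠ d → ε ≤ ‖c - d‖) :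
    (s.card : ℝ) ≤ (1 + 2 * R / ε) ^ Module.finrank ℝ E := by
  borelize E
  let μ : Measure E := Measure.addHaar
  have δpos : 0 < ε / 2 := by positivity
  have ρpos : 0 < R + ε / 2 := by positivity
  set A := ⋃ c ∈ s, Metric.ball (c : E) (ε / 2) with hA
  have D : Set.Pairwise (s : Set E)
      (Function.onFun Disjoint fun c => Metric.ball (c : E) (ε / 2)) := by
    rintro c hc d hd hcd
    refine Metric.ball_disjoint_ball ?_
    rw [dist_eq_norm]
    linarith [h c hc d hd hcd]
  have A_subset : A ⊆ Metric.ball (0 : E) (R + ε / 2) := by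
    refine Set.iUnion₂_subset fun x hx => Metric.ball_subset_ball' ?_
    rw [dist_zero_right]
    linarith [hs x hx]
  have I : (s.card : ℝ≥0∞) * ENNReal.ofReal ((ε / 2) ^ Module.finrank ℝ E) *
      μ (Metric.ball 0 1) ≤
      ENNReal.ofReal ((R + ε / 2) ^ Module.finrank ℝ E) * μ (Metric.ball 0 1) :=
    calc _ = μ A := by
          rw [hA, measure_biUnion_finset D fun c _ => measurableSet_ball]
          simp only [μ.addHaar_ball_of_pos _ δpos, Finset.sum_const, nsmul_eq_mul, mul_assoc]
      _ ≤ μ (Metric.ball (0 : E) (R + ε / 2)) := measure_mono A_subset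
      _ = _ := by simp only [μ.addHaar_ball_of_pos _ ρpos]
  have J := (ENNReal.mul_le_mul_iff_left (Metric.measure_ball_pos _ _ zero_lt_one).ne'
    measure_ball_lt_top.ne).1 I
  have K := ENNReal.toReal_le_of_le_ofReal (by positivity) J
  rw [ENNReal.toReal_mul, ENNReal.toReal_natCast, ENNReal.toReal_ofReal (by positivity)] at K
  have e : 1 + 2 * R / ε = (R + ε / 2) / (ε / 2) := by field_simp; ring
  rw [e, div_pow, le_div_iff₀ (by positivity)]
  exact K

/-- A separated subset of maximal cardinality, which exists by the volume bound, is a net. Its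
points lie in `A` itself, as is needed for a net of feasible parameters. -/
theorem exists_net {R ε : ℝ} (hR : 0 ≤ R) (hε : 0 < ε) (A : Set E) (hA : ∀ x ∈ A, ‖x‖ ≤ R) :
    ∃ T : Finset E, (∀ y ∈ T, y ∈ A) ∧ (T.card : ℝ) ≤ (1 + 2 * R / ε) ^ Module.finrank ℝ E ∧
      ∀ x ∈ A, ∃ y ∈ T, ‖x - y‖ ≤ ε := by
  classical
  set P : ℕ → Prop := fun m => ∃ s : Finset E, s.card = m ∧ (∀ y ∈ s, y ∈ A) ∧
    ∀ c ∈ s, ∀ d ∈ s, c ≠ d → ε ≤ ‖c - d‖ with hP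
  set b := ⌊(1 + 2 * R / ε) ^ Module.finrank ℝ E⌋₊ with hb
  have hbound : ∀ s : Finset E, (∀ y ∈ s, y ∈ A) →
      (∀ c ∈ s, ∀ d ∈ s, c ≠ d → ε ≤ ‖c - d‖) → s.card ≤ b := fun s h1 h2 =>
    Nat.le_floor (card_le_of_separated hR hε s (fun c hc => hA c (h1 c hc)) h2)
  have h0 : P 0 := ⟨∅, by simp⟩
  obtain ⟨T, hTc, hTA, hTs⟩ := Nat.findGreatest_spec (P := P) (Nat.zero_le b) h0
  refine ⟨T, hTA, card_le_of_separated hR hε T (fun c hc => hA c (hTA c hc)) hTs,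
    fun x hx => ?_⟩
  by_contra! hcon
  have hxT : x ∉ T := fun hxT => by
    have := hcon x hxT
    rw [sub_self, norm_zero] at this
    linarith
  -- A point far from all of `T` could be added, against maximality.
  have hins : P (T.card + 1) := by
    refine ⟨insert x T, Finset.card_insert_of_notMem hxT, ?_, ?_⟩
    · intro y hy
      rcases Finset.mem_insert.1 hy with rfl | hy
      exacts [hx, hTA y hy]
    · intro c hc d hd hcd
      rcases Finset.mem_insert.1 hc with hc' | hc' <;>
        rcases Finset.mem_insert.1 hd with hd' | hd'
      · exact absurd (hc'.trans hd'.symm) hcd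
      · rw [hc']; exact (hcon d hd').le
      · rw [hd', norm_sub_rev]; exact (hcon c hc').le
      · exact hTs c hc' d hd' hcd
  obtain ⟨s, hsc, h1, h2⟩ := id hins
  have hle : T.card + 1 ≤ b := hsc ▸ hbound s h1 h2
  have := Nat.le_findGreatest hle hins
  omega

end Nets

/-! ### Operator norms of matrices with independent subgaussian rows. -/

section OperatorNorm

theorem lintegral_pi_prod {S : Type*} [MeasurableSpace S] (μ : Measure S) [IsProbabilityMeasure μ]
    {g : S → ℝ≥0∞} (hg : Measurable g) (n : ℕ) :
    ∫⁻ x, ∏ i, g (x i) ∂(Measure.pi fun _ : Fin n => μ) = (∫⁻ s, g s ∂μ) ^ n := by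
  induction n with
  | zero => simp
  | succ n ih =>
    have h := (measurePreserving_piFinSuccAbove (fun _ : Fin (n + 1) => μ) 0)
    have hm : Measurable fun x : Fin n → S => ∏ i, g (x i) :=
      Finset.measurable_prod _ fun i _ => hg.comp (measurable_pi_apply i)
    have e : ∀ x : Fin (n + 1) → S, ∏ i, g (x i) =
        (fun q : S × (Fin n → S) => g q.1 * ∏ i, g (q.2 i))
          (MeasurableEquiv.piFinSuccAbove (fun _ => S) 0 x) := by
      intro x
      rw [Fin.prod_univ_succ]
      rfl
    simp_rw [e]
    rw [h.lintegral_comp (f := fun q : S × (Fin n → S) => g q.1 * ∏ i, g (q.2 i)) (by fun_prop),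
      lintegral_prod_mul hg.aemeasurable hm.aemeasurable, ih, pow_succ']

variable {E : Type*} [NormedAddCommGroup E] [InnerProductSpace ℝ E] [FiniteDimensional ℝ E]
  [MeasurableSpace E] [BorelSpace E] {n : ℕ}

/-- The matrix with rows `x i`, as an operator. -/
noncomputable def rowOp (x : Fin n → E) : E →L[ℝ] EuclideanSpace ℝ (Fin n) :=
  LinearMap.toContinuousLinearMap
    { toFun := fun v => WithLp.toLp 2 fun i => inner ℝ v (x i)
      map_add' := fun v w => by ext i; simp [inner_add_left]
      map_smul' := fun c v => by ext i; simp [real_inner_smul_left] }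

theorem norm_rowOp_sq (x : Fin n → E) (v : E) : ‖rowOp x v‖ ^ 2 = ∑ i, inner ℝ v (x i) ^ 2 := by
  rw [EuclideanSpace.real_norm_sq_eq]
  rfl

/-- A unit vector is within `1/2` of the net, so the norm is at most `t` plus half of itself. -/
theorem norm_rowOp_le_of_net (x : Fin n → E) {T : Finset E} {t : ℝ} (ht : 0 ≤ t)
    (hT : ∀ v : E, ‖v‖ ≤ 1 → ∃ y ∈ T, ‖v - y‖ ≤ 1 / 2)
    (h : ∀ y ∈ T, ∑ i, inner ℝ y (x i) ^ 2 ≤ t ^ 2) : ‖rowOp x‖ ≤ 2 * t := by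
  have key : ‖rowOp x‖ ≤ t + ‖rowOp x‖ / 2 := by
    refine ContinuousLinearMap.opNorm_le_of_unit_norm (by positivity) fun v hv => ?_
    obtain ⟨y, hy, hvy⟩ := hT v hv.le
    have h1 : ‖rowOp x y‖ ≤ t := by
      refine abs_le_of_sq_le_sq' ?_ ht |>.2
      rw [norm_rowOp_sq]
      exact h y hy
    have h2 : ‖rowOp x (v - y)‖ ≤ ‖rowOp x‖ * (1 / 2) :=
      (ContinuousLinearMap.le_opNorm _ _).trans
        (mul_le_mul_of_nonneg_left hvy (norm_nonneg _))
    have h3 : rowOp x v = rowOp x y + rowOp x (v - y) := by rw [← map_add]; congr 1; abel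
    rw [h3]
    refine (norm_add_le _ _).trans ?_
    linarith
  linarith

/-- Matrices with independent subgaussian rows have operator norm at most `2 t` with high
probability. -/
theorem measure_frame_compl_le (μ : Measure E) [IsProbabilityMeasure μ] {c : ℝ} (hc : 0 < c)
    (hμ : ∀ v : E, ‖v‖ ≤ 1 → SubG μ (fun x => inner ℝ v x) c) {t : ℝ} (ht : 0 ≤ t) :
    (Measure.pi fun _ : Fin n => μ)
        {x | ¬ ∀ v, ∑ i, inner ℝ v (x i) ^ 2 ≤ (2 * t) ^ 2 * ‖v‖ ^ 2} ≤
      ENNReal.ofReal (5 ^ Module.finrank ℝ E * 2 ^ n * Real.exp (-(c * t ^ 2))) := by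
  -- A `1/2`-net of the unit ball has at most `5 ^ dim` points, as `1 + 2 / (1/2) = 5`.
  obtain ⟨T, hT1, hT2, hT3⟩ := exists_net zero_le_one (ε := 1 / 2) (by norm_num)
    {v : E | ‖v‖ ≤ 1} fun _ h => h
  norm_num at hT2
  set P := Measure.pi fun _ : Fin n => μ
  have hsub : {x : Fin n → E | ¬ ∀ v, ∑ i, inner ℝ v (x i) ^ 2 ≤ (2 * t) ^ 2 * ‖v‖ ^ 2} ⊆
      ⋃ y ∈ T, {x | t ^ 2 ≤ ∑ i, inner ℝ y (x i) ^ 2} := by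
    intro x hx
    by_contra hcon
    simp only [Set.mem_iUnion, Set.mem_ofPred_eq, not_exists, not_le] at hcon
    refine hx fun v => ?_
    rw [← norm_rowOp_sq, ← mul_pow]
    refine pow_le_pow_left₀ (norm_nonneg _) ?_ 2
    refine (ContinuousLinearMap.le_opNorm _ _).trans ?_
    exact mul_le_mul_of_nonneg_right
      (norm_rowOp_le_of_net x ht hT3 fun y hy => (hcon y hy).le) (norm_nonneg _)
  -- The Chernoff bound: by independence the exponential moment of the sum of squares is at most `2
  -- ^ n`.
  have hone : ∀ y ∈ T, P {x | t ^ 2 ≤ ∑ i, inner ℝ y (x i) ^ 2} ≤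
      ENNReal.ofReal (2 ^ n * Real.exp (-(c * t ^ 2))) := by
    intro y hy
    have hm : Measurable fun s : E => ENNReal.ofReal (Real.exp (c * inner ℝ y s ^ 2)) := by
      fun_prop
    have h1 : ∫⁻ x, ∏ i, ENNReal.ofReal (Real.exp (c * inner ℝ y (x i) ^ 2)) ∂P ≤ 2 ^ n := by
      rw [lintegral_pi_prod μ hm n]
      exact pow_le_pow_left' (hμ y (hT1 y hy)) n
    have h2 := mul_meas_ge_le_lintegral₀ (μ := P)
      (f := fun x => ∏ i, ENNReal.ofReal (Real.exp (c * inner ℝ y (x i) ^ 2)))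
      (Measurable.aemeasurable (Finset.measurable_prod _ fun i _ =>
        hm.comp (measurable_pi_apply i))) (ENNReal.ofReal (Real.exp (c * t ^ 2)))
    have h3 : {x : Fin n → E | t ^ 2 ≤ ∑ i, inner ℝ y (x i) ^ 2} ⊆
        {x | ENNReal.ofReal (Real.exp (c * t ^ 2)) ≤
          ∏ i, ENNReal.ofReal (Real.exp (c * inner ℝ y (x i) ^ 2))} := by
      intro x hx
      simp only [Set.mem_ofPred_eq] at hx ⊢
      rw [← ENNReal.ofReal_prod_of_nonneg fun i _ => (Real.exp_pos _).le, ← Real.exp_sum,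
        ← Finset.mul_sum]
      exact ENNReal.ofReal_le_ofReal (Real.exp_le_exp.2 (mul_le_mul_of_nonneg_left hx hc.le))
    have h4 : ENNReal.ofReal (Real.exp (c * t ^ 2)) *
        P {x | t ^ 2 ≤ ∑ i, inner ℝ y (x i) ^ 2} ≤ 2 ^ n :=
      (mul_le_mul_right (measure_mono h3) _).trans (h2.trans h1)
    rw [ENNReal.ofReal_mul (by positivity), Real.exp_neg,
      ENNReal.ofReal_inv_of_pos (Real.exp_pos _), ← div_eq_mul_inv,
      ENNReal.le_div_iff_mul_le (Or.inl (by simp [Real.exp_pos])) (Or.inl ENNReal.ofReal_ne_top),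
      mul_comm]
    refine h4.trans (le_of_eq ?_)
    rw [ENNReal.ofReal_pow (by norm_num)]
    norm_num
  calc P _ ≤ P (⋃ y ∈ T, {x | t ^ 2 ≤ ∑ i, inner ℝ y (x i) ^ 2}) := measure_mono hsub
    _ ≤ ∑ y ∈ T, P {x | t ^ 2 ≤ ∑ i, inner ℝ y (x i) ^ 2} := measure_biUnion_finset_le _ _
    _ ≤ ∑ _y ∈ T, ENNReal.ofReal (2 ^ n * Real.exp (-(c * t ^ 2))) := Finset.sum_le_sum hone
    _ = ENNReal.ofReal (T.card * (2 ^ n * Real.exp (-(c * t ^ 2)))) := by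
        rw [Finset.sum_const, nsmul_eq_mul, ENNReal.ofReal_mul (Nat.cast_nonneg _),
          ENNReal.ofReal_natCast]
    _ ≤ _ := by
        rw [mul_assoc]
        gcongr

end OperatorNorm

/-! ### The uniform distribution on the sphere is subgaussian at scale `1/√d`. -/

section Sphere

variable {d : ℕ}

theorem nonempty_uniformSphere_univ (hd : 0 < d) :
    ((volume : Measure (EuclideanSpace ℝ (Fin d))).toSphere Set.univ) ≠ 0 := by
  have : Nontrivial (EuclideanSpace ℝ (Fin d)) := by
    refine Module.nontrivial_of_finrank_pos (R := ℝ) ?_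
    simpa using hd
  rw [Ne, Measure.measure_univ_eq_zero]
  exact Measure.toSphere_ne_zero _

theorem isProbabilityMeasure_uniformSphere (hd : 0 < d) :
    IsProbabilityMeasure (uniformSphere d) := by
  refine ⟨?_⟩
  rw [uniformSphere, Measure.smul_apply, Measure.map_apply measurable_subtype_coe .univ,
    Set.preimage_univ, smul_eq_mul]
  exact ENNReal.inv_mul_cancel (nonempty_uniformSphere_univ hd) (measure_ne_top _ _)

theorem ae_norm_eq_one_uniformSphere : ∀ᵐ w ∂(uniformSphere d), ‖w‖ = 1 := by
  rw [uniformSphere]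
  refine Measure.ae_smul_measure ?_ _
  rw [ae_map_iff measurable_subtype_coe.aemeasurable (by measurability)]
  exact Eventually.of_forall fun w => by simp

/-- The surface measure of a set is defined through the volume of the cone over it, and linear
isometries preserve volume and cones. -/
theorem uniformSphere_map (e : EuclideanSpace ℝ (Fin d) ≃ₗᵢ[ℝ] EuclideanSpace ℝ (Fin d)) :
    (uniformSphere d).map e = uniformSphere d := by
  rw [uniformSphere, Measure.map_smul]
  congr 1
  refine Measure.ext fun B hB => ?_
  have hem : Measurable e := e.continuous.measurable
  rw [Measure.map_apply hem hB, Measure.map_apply measurable_subtype_coe (hem hB),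
    Measure.map_apply measurable_subtype_coe hB,
    Measure.toSphere_apply' _ (measurable_subtype_coe (hem hB)),
    Measure.toSphere_apply' _ (measurable_subtype_coe hB)]
  congr 1
  symm
  rw [← e.measurePreserving.measure_preimage_equiv (f := e.toMeasurableEquiv)]
  congr 1
  ext x
  simp only [Set.mem_preimage, Set.mem_smul, Set.mem_image, Subtype.exists]
  constructor
  · rintro ⟨r, hr, y, ⟨y', hy', h1, rfl⟩, h⟩
    refine ⟨r, hr, e.symm y', ⟨e.symm y', by simpa using hy', by simpa using h1, rfl⟩, ?_⟩
    apply e.injective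
    simpa using h
  · rintro ⟨r, hr, y, ⟨y', hy', h1, rfl⟩, rfl⟩
    exact ⟨r, hr, e y', ⟨e y', by simpa using hy', h1, rfl⟩, by simp⟩

theorem integral_norm_sq_stdGaussian :
    ∫ z, ‖z‖ ^ 2 ∂(stdGaussian (EuclideanSpace ℝ (Fin d))) = d := by
  have h : ∀ z : EuclideanSpace ℝ (Fin d), ‖z‖ ^ 2 = ∑ i,
      inner ℝ (EuclideanSpace.basisFun (Fin d) ℝ i) z *
        inner ℝ (EuclideanSpace.basisFun (Fin d) ℝ i) z := fun z => by
    rw [← OrthonormalBasis.sum_sq_norm_inner_right (EuclideanSpace.basisFun (Fin d) ℝ) z]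
    refine Finset.sum_congr rfl fun i _ => ?_
    rw [Real.norm_eq_abs, sq_abs, sq]
  simp_rw [h]
  have hi : ∀ i, Integrable (fun z => inner ℝ (EuclideanSpace.basisFun (Fin d) ℝ i) z *
      inner ℝ (EuclideanSpace.basisFun (Fin d) ℝ i) z)
      (stdGaussian (EuclideanSpace ℝ (Fin d))) := fun i =>
    (memLp_inner_stdGaussian _).integrable_mul (memLp_inner_stdGaussian _)
  rw [integral_finsetSum _ fun i _ => hi i]
  simp [integral_inner_mul_inner_stdGaussian]

/-- Comparison with a Gaussian `z`. As `E‖z‖² = d`, Jensen bounds `exp (d⟨v, w⟩²/4)` by the mean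
over `z` of `exp (‖z‖²⟨v, w⟩²/4)`. Under the rotation-invariant law of `w`, the vector `‖z‖ v` may
be replaced by `z`. For fixed `w` of norm one, `⟨z, w⟩` is standard Gaussian. -/
theorem subG_uniformSphere (hd : 0 < d) {v : EuclideanSpace ℝ (Fin d)} (hv : ‖v‖ ≤ 1) :
    SubG (uniformSphere d) (fun w => inner ℝ v w) (d / 4) := by
  have := isProbabilityMeasure_uniformSphere hd
  set κ := uniformSphere d
  set γ := stdGaussian (EuclideanSpace ℝ (Fin d))
  have hpt : ∀ w : EuclideanSpace ℝ (Fin d), ENNReal.ofReal (Real.exp (d / 4 * inner ℝ v w ^ 2)) ≤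
      ∫⁻ z, ENNReal.ofReal (Real.exp (1 / 4 * inner ℝ v w ^ 2 * ‖z‖ ^ 2)) ∂γ := by
    intro w
    have h1 := ofReal_exp_integral_le
      ((integrable_norm_sq_stdGaussian (E := EuclideanSpace ℝ (Fin d))).const_mul
        (1 / 4 * inner ℝ v w ^ 2))
    rw [integral_const_mul, integral_norm_sq_stdGaussian] at h1
    refine le_trans (le_of_eq ?_) h1
    congr 2
    ring
  have hrot : ∀ z : EuclideanSpace ℝ (Fin d),
      ∫⁻ w, ENNReal.ofReal (Real.exp (1 / 4 * inner ℝ v w ^ 2 * ‖z‖ ^ 2)) ∂κ ≤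
        ∫⁻ w, ENNReal.ofReal (Real.exp (1 / 4 * inner ℝ z w ^ 2)) ∂κ := by
    intro z
    rcases eq_or_ne v 0 with rfl | hv0
    · refine lintegral_mono fun w => ENNReal.ofReal_le_ofReal (Real.exp_le_exp.2 ?_)
      simp only [inner_zero_left]
      nlinarith [sq_nonneg (inner ℝ z w)]
    · have hv0' : 0 < ‖v‖ := norm_pos_iff.2 hv0
      have hnorm : ‖(‖z‖ / ‖v‖) • v‖ = ‖z‖ := by
        rw [norm_smul, Real.norm_of_nonneg (by positivity)]
        field_simp
      -- The reflection that exchanges `z` with the multiple of `v` of the same norm.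
      set e := Submodule.reflection (ℝ ∙ ((‖z‖ / ‖v‖) • v - z))ᗮ
      have he : e ((‖z‖ / ‖v‖) • v) = z := Submodule.reflection_sub hnorm
      calc _ ≤ ∫⁻ w, ENNReal.ofReal (Real.exp (1 / 4 * inner ℝ ((‖z‖ / ‖v‖) • v) w ^ 2)) ∂κ := by
            refine lintegral_mono fun w => ENNReal.ofReal_le_ofReal (Real.exp_le_exp.2 ?_)
            rw [real_inner_smul_left, mul_pow, div_pow, mul_assoc]
            refine mul_le_mul_of_nonneg_left ?_ (by norm_num)
            rw [mul_comm]
            refine mul_le_mul_of_nonneg_right ?_ (sq_nonneg _)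
            refine le_div_self (sq_nonneg _) (by positivity) ?_
            exact pow_le_one₀ (norm_nonneg _) hv
        _ = ∫⁻ w, ENNReal.ofReal (Real.exp (1 / 4 * inner ℝ z (e w) ^ 2)) ∂κ := by
            refine lintegral_congr fun w => ?_
            rw [← LinearIsometryEquiv.inner_map_map e, he]
        _ = ∫⁻ w, ENNReal.ofReal (Real.exp (1 / 4 * inner ℝ z w ^ 2)) ∂(κ.map e) := by
            rw [lintegral_map (by fun_prop) e.continuous.measurable]
        _ = _ := by rw [uniformSphere_map]
  calc _ ≤ ∫⁻ w, ∫⁻ z, ENNReal.ofReal (Real.exp (1 / 4 * inner ℝ v w ^ 2 * ‖z‖ ^ 2)) ∂γ ∂κ :=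
        lintegral_mono hpt
    _ = ∫⁻ z, ∫⁻ w, ENNReal.ofReal (Real.exp (1 / 4 * inner ℝ v w ^ 2 * ‖z‖ ^ 2)) ∂κ ∂γ :=
        lintegral_lintegral_swap (Measurable.aemeasurable (by fun_prop))
    _ ≤ ∫⁻ z, ∫⁻ w, ENNReal.ofReal (Real.exp (1 / 4 * inner ℝ z w ^ 2)) ∂κ ∂γ :=
        lintegral_mono hrot
    _ = ∫⁻ w, ∫⁻ z, ENNReal.ofReal (Real.exp (1 / 4 * inner ℝ z w ^ 2)) ∂γ ∂κ :=
        lintegral_lintegral_swap (Measurable.aemeasurable (by fun_prop))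
    _ ≤ ∫⁻ _w, 2 ∂κ := by
        refine lintegral_mono_ae ?_
        filter_upwards [ae_norm_eq_one_uniformSphere] with w hw
        have h := subG_inner (a := w) (c := 1 / 4) (by rw [hw]; norm_num)
        refine le_trans (le_of_eq ?_) h
        refine lintegral_congr fun z => ?_
        rw [real_inner_comm]
    _ = 2 := by simp

end Sphere

end RandomFeatures

namespace RandomFeatures

/-! ### Discretization of the training error -/

section Discretization

variable {n p k kstar : ℕ}

/-- The loss of a sample as a function of its projections on the parameters and on the true
parameters. -/
def sampleLoss (ℓ : LossDomain k → ℝ) (η : LossDomain kstar → ℝ) (e : ℝ)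
    (v : Fin k ⊕ Fin kstar → ℝ) : ℝ :=
  ℓ (WithLp.toLp 2 (WithLp.toLp 2 fun l => v (Sum.inl l),
    η (WithLp.toLp 2 (WithLp.toLp 2 fun l => v (Sum.inr l), e))))

/-- The projections of `x` on the parameters and the true parameters. -/
noncomputable def sampleProj (Θs : Params p kstar) (Θ : Params p k) (x : EuclideanSpace ℝ (Fin p)) :
    Fin k ⊕ Fin kstar → ℝ :=
  fun l => inner ℝ (Sum.elim (fun l => Θ l) (fun l => Θs l) l) x

theorem empRisk_labels (ℓ : LossDomain k → ℝ) (η : LossDomain kstar → ℝ) (r : Params p k → ℝ)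
    (Θs : Params p kstar) (X : Fin n → EuclideanSpace ℝ (Fin p)) (ε : Fin n → ℝ)
    (Θ : Params p k) :
    empRisk ℓ r X (labels η Θs X ε) Θ =
      (1 / (n : ℝ)) * ∑ i, sampleLoss ℓ η (ε i) (sampleProj Θs Θ (X i)) + r Θ := rfl

theorem euclidean_norm_le (v : Fin k → ℝ) {b : ℝ} (hb : 0 ≤ b) (h : ∀ l, |v l| ≤ b) :
    ‖(WithLp.toLp 2 v : EuclideanSpace ℝ (Fin k))‖ ≤ √k * b := by
  rw [EuclideanSpace.norm_eq]
  refine Real.sqrt_le_iff.2 ⟨by positivity, ?_⟩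
  calc _ ≤ ∑ _l : Fin k, b ^ 2 :=
        Finset.sum_le_sum fun l _ => pow_le_pow_left₀ (norm_nonneg _) (h l) 2
    _ = _ := by
        rw [Finset.sum_const, Finset.card_univ, Fintype.card_fin, nsmul_eq_mul, mul_pow,
          Real.sq_sqrt (Nat.cast_nonneg _)]

theorem norm_lossDomain_le (q : LossDomain k) : ‖q‖ ≤ ‖q.fst‖ + |q.snd| := by
  rw [WithLp.prod_norm_eq_of_L2]
  refine Real.sqrt_le_iff.2 ⟨by positivity, ?_⟩
  rw [Real.norm_eq_abs]
  nlinarith [mul_nonneg (norm_nonneg q.fst) (abs_nonneg q.snd)]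

/-- The Lipschitz constant of `sampleLoss` for the supremum norm. -/
noncomputable def sampleConst (k kstar : ℕ) (K : ℝ) : ℝ := K * (√k + K * √kstar)

theorem sampleConst_nonneg {K : ℝ} (hK : 0 ≤ K) : 0 ≤ sampleConst k kstar K := by
  unfold sampleConst; positivity

/-- The true projections act through the label, hence the term with `K²`; the noise `e` is the same
on both sides and does not enter the constant. -/
theorem abs_sampleLoss_sub_le {ℓ : LossDomain k → ℝ} {η : LossDomain kstar → ℝ} {K : ℝ≥0}
    (hℓ : LipschitzWith K ℓ) (hη : LipschitzWith K η) (e : ℝ) (u v : Fin k ⊕ Fin kstar → ℝ) :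
    |sampleLoss ℓ η e u - sampleLoss ℓ η e v| ≤ sampleConst k kstar K * ‖u - v‖ := by
  have hb : ∀ l, |u l - v l| ≤ ‖u - v‖ := fun l => norm_le_pi_norm (u - v) l
  have h1 : |η (WithLp.toLp 2 (WithLp.toLp 2 fun l => u (Sum.inr l), e)) -
      η (WithLp.toLp 2 (WithLp.toLp 2 fun l => v (Sum.inr l), e))| ≤ K * (√kstar * ‖u - v‖) := by
    refine (hη.dist_le_mul _ _).trans ?_
    rw [dist_eq_norm]
    refine mul_le_mul_of_nonneg_left ((norm_lossDomain_le _).trans ?_) K.2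
    have := euclidean_norm_le (fun l => u (Sum.inr l) - v (Sum.inr l)) (norm_nonneg (u - v))
      fun l => hb (Sum.inr l)
    simpa [← WithLp.toLp_sub, Pi.sub_def] using this
  refine (hℓ.dist_le_mul _ _).trans ?_
  rw [dist_eq_norm, sampleConst, mul_assoc]
  refine mul_le_mul_of_nonneg_left ((norm_lossDomain_le _).trans ?_) K.2
  have h2 := euclidean_norm_le (fun l => u (Sum.inl l) - v (Sum.inl l)) (norm_nonneg (u - v))
      fun l => hb (Sum.inl l)
  rw [add_mul, mul_assoc]
  refine add_le_add ?_ ?_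
  · simpa [← WithLp.toLp_sub, Pi.sub_def] using h2
  · simpa using h1

/-- The labels do not depend on `Θ`. Cauchy–Schwarz over the samples turns the mean of the `‖(Θ -
Θ')ᵀ x_i‖` into the operator norm of the feature matrix. -/
theorem abs_empRisk_sub_le {ℓ : LossDomain k → ℝ} {K : ℝ≥0} (hℓ : LipschitzWith K ℓ)
    {r : Params p k → ℝ} {D : ℝ} {X : Fin n → EuclideanSpace ℝ (Fin p)} {c : ℝ} (hc : 0 ≤ c)
    (hX : ∀ v, ∑ i, inner ℝ v (X i) ^ 2 ≤ c ^ 2 * n * ‖v‖ ^ 2) (y : Fin n → ℝ)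
    {Θ Θ' : Params p k} (hr : |r Θ - r Θ'| ≤ D * ‖Θ - Θ'‖) :
    |empRisk ℓ r X y Θ - empRisk ℓ r X y Θ'| ≤ (K * c + D) * ‖Θ - Θ'‖ := by
  have h1 : ∀ i, |ℓ (WithLp.toLp 2 (proj Θ (X i), y i)) - ℓ (WithLp.toLp 2 (proj Θ' (X i), y i))| ≤
      K * √(∑ l, inner ℝ ((Θ - Θ') l) (X i) ^ 2) := by
    intro i
    refine (hℓ.dist_le_mul _ _).trans ?_
    rw [dist_eq_norm]
    refine mul_le_mul_of_nonneg_left ((norm_lossDomain_le _).trans ?_) K.2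
    have e : (WithLp.toLp 2 (proj Θ (X i), y i) - WithLp.toLp 2 (proj Θ' (X i), y i) :
      LossDomain k).snd = 0 := by simp
    rw [e, abs_zero, add_zero, EuclideanSpace.norm_eq]
    refine Real.sqrt_le_sqrt (le_of_eq (Finset.sum_congr rfl fun l _ => ?_))
    rw [Real.norm_eq_abs, sq_abs]
    simp [proj, inner_sub_left]
  have h2 : ∑ i, √(∑ l, inner ℝ ((Θ - Θ') l) (X i) ^ 2) ≤ n * (c * ‖Θ - Θ'‖) := by
    have h3 := Finset.sum_mul_sq_le_sq_mul_sq Finset.univ (fun _ : Fin n => (1 : ℝ))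
      fun i => √(∑ l, inner ℝ ((Θ - Θ') l) (X i) ^ 2)
    have h4 : ∑ i, √(∑ l, inner ℝ ((Θ - Θ') l) (X i) ^ 2) ^ 2 ≤ c ^ 2 * n * ‖Θ - Θ'‖ ^ 2 := by
      calc _ = ∑ i, ∑ l, inner ℝ ((Θ - Θ') l) (X i) ^ 2 :=
            Finset.sum_congr rfl fun i _ => Real.sq_sqrt (Finset.sum_nonneg fun _ _ => sq_nonneg _)
        _ = ∑ l, ∑ i, inner ℝ ((Θ - Θ') l) (X i) ^ 2 := Finset.sum_comm
        _ ≤ ∑ l, c ^ 2 * n * ‖(Θ - Θ') l‖ ^ 2 := Finset.sum_le_sum fun l _ => hX _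
        _ = _ := by rw [← Finset.mul_sum, PiLp.norm_sq_eq_of_L2]
    refine abs_le_of_sq_le_sq' ?_ (by positivity) |>.2
    simp only [one_mul, one_pow, Finset.sum_const, Finset.card_univ, Fintype.card_fin,
      nsmul_eq_mul, mul_one] at h3
    refine h3.trans ((mul_le_mul_of_nonneg_left h4 (Nat.cast_nonneg n)).trans (le_of_eq ?_))
    ring
  have h5 : |(1 / (n : ℝ)) * ∑ i, ℓ (WithLp.toLp 2 (proj Θ (X i), y i)) -
      (1 / (n : ℝ)) * ∑ i, ℓ (WithLp.toLp 2 (proj Θ' (X i), y i))| ≤ K * c * ‖Θ - Θ'‖ := by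
    rw [← mul_sub, ← Finset.sum_sub_distrib, abs_mul, abs_of_nonneg (by positivity)]
    calc _ ≤ 1 / (n : ℝ) * (K * (n * (c * ‖Θ - Θ'‖))) := by
          refine mul_le_mul_of_nonneg_left ?_ (by positivity)
          refine (Finset.abs_sum_le_sum_abs _ _).trans ((Finset.sum_le_sum fun i _ => h1 i).trans ?_)
          rw [← Finset.mul_sum]
          exact mul_le_mul_of_nonneg_left h2 K.2
      _ ≤ _ := by
          rcases Nat.eq_zero_or_pos n with rfl | hn
          · simp only [Nat.cast_zero, zero_mul, mul_zero]
            positivity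
          · refine le_of_eq ?_
            field_simp
  unfold empRisk
  rw [add_mul]
  refine le_trans ?_ (add_le_add h5 hr)
  rw [add_sub_add_comm]
  exact abs_add_le _ _

/-- The projections on all parameters in a finite set, and on the true parameters. -/
noncomputable def netProj (Θs : Params p kstar) (N : Finset (Params p k))
    (X : Fin n → EuclideanSpace ℝ (Fin p)) (i : Fin n) (j : N × (Fin k ⊕ Fin kstar)) : ℝ :=
  sampleProj Θs j.1 (X i) j.2

/-- The sum of exponentials lies between its largest term and the number of terms times it. -/
theorem softRisk_le_and_ge {N : Type*} [Fintype N] [Nonempty N] {ι : Type*} [Fintype ι]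
    (hn : 0 < n) {β : ℝ} (hβ : 0 < β)
    (L : Fin n → SmoothLoss ι) (r : N → ℝ) (u : Fin n → N × ι → ℝ) :
    (∀ Θ, softRisk L r β u ≤ (1 / (n : ℝ)) * ∑ i, ((L i).L fun l => u i (Θ, l)) + r Θ) ∧
    ∃ Θ, (1 / (n : ℝ)) * ∑ i, ((L i).L fun l => u i (Θ, l)) + r Θ ≤
      softRisk L r β u + Real.log (Fintype.card N) / (n * β) := by
  have hn' : (0 : ℝ) < n := by exact_mod_cast hn
  set a : N → ℝ := fun Θ => (1 / (n : ℝ)) * ∑ i, ((L i).L fun l => u i (Θ, l)) + r Θ with ha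
  have he : ∀ Θ, -(n * β * r Θ) - β * ∑ i, ((L i).L fun l => u i (Θ, l)) = -(n * β) * a Θ := by
    intro Θ
    simp only [ha]
    field_simp
    ring
  have hs : softRisk L r β u = -(1 / (n * β)) * Real.log (∑ Θ, Real.exp (-(n * β) * a Θ)) := by
    unfold softRisk
    simp_rw [he]
  have hpos : 0 < ∑ Θ, Real.exp (-(n * β) * a Θ) :=
    Finset.sum_pos (fun _ _ => Real.exp_pos _) Finset.univ_nonempty
  have hnβ : 0 < n * β := by positivity
  constructor
  · intro Θ
    have h1 : -(n * β) * a Θ ≤ Real.log (∑ Θ, Real.exp (-(n * β) * a Θ)) := by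
      rw [Real.le_log_iff_exp_le hpos]
      exact Finset.single_le_sum (f := fun Θ => Real.exp (-(n * β) * a Θ))
        (fun _ _ => (Real.exp_pos _).le) (Finset.mem_univ Θ)
    change _ ≤ a Θ
    rw [hs, neg_mul, neg_le, one_div, inv_mul_eq_div, le_div_iff₀ hnβ]
    linarith
  · obtain ⟨Θ, -, hΘ⟩ := Finset.exists_min_image Finset.univ a Finset.univ_nonempty
    refine ⟨Θ, ?_⟩
    have h1 : Real.log (∑ Θ, Real.exp (-(n * β) * a Θ)) ≤
        Real.log (Fintype.card N) + -(n * β) * a Θ := by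
      rw [← Real.log_exp (-(n * β) * a Θ), ← Real.log_mul (by positivity) (Real.exp_pos _).ne']
      refine Real.log_le_log hpos ?_
      have := Finset.sum_le_card_nsmul Finset.univ (fun Θ => Real.exp (-(n * β) * a Θ))
        (Real.exp (-(n * β) * a Θ)) fun Θ' h => Real.exp_le_exp.2 ?_
      · simpa using this
      · exact mul_le_mul_of_nonpos_left (hΘ Θ' h) (by linarith)
    change a Θ ≤ _
    rw [hs]
    have e : -(1 / (n * β)) * Real.log (∑ Θ, Real.exp (-(n * β) * a Θ)) +
        Real.log (Fintype.card N) / (n * β) =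
        (Real.log (Fintype.card N) - Real.log (∑ Θ, Real.exp (-(n * β) * a Θ))) / (n * β) := by
      ring
    rw [e, le_div_iff₀ hnβ]
    linarith

/-- The training error is close to the free energy over a net when the features have a bounded
operator norm. -/
theorem abs_minRisk_sub_softRisk_le {ℓ : LossDomain k → ℝ} {η : LossDomain kstar → ℝ} {K : ℝ≥0}
    (hn : 0 < n) {β : ℝ} (hβ : 0 < β) (hℓ : LipschitzWith K ℓ)
    {r : Params p k → ℝ} {D τ δ c : ℝ} (hc : 0 ≤ c) (hD : 0 ≤ D)
    {S : Set (EuclideanSpace ℝ (Fin p))}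
    (hr : ∀ Θ Θ' : Params p k, (∀ l, Θ l ∈ S) → (∀ l, Θ' l ∈ S) →
      |r Θ - r Θ'| ≤ D * ‖Θ - Θ'‖)
    (Θs : Params p kstar) (ε : Fin n → ℝ) (L : Fin n → SmoothLoss (Fin k ⊕ Fin kstar))
    (hL : ∀ i v, |(L i).L v - sampleLoss ℓ η (ε i) v| ≤ τ)
    (N : Finset (Params p k)) (hN : N.Nonempty) (hNS : ∀ Θ ∈ N, ∀ l, Θ l ∈ S)
    (hnet : ∀ Θ : Params p k, (∀ l, Θ l ∈ S) → ∃ Θ' ∈ N, ‖Θ - Θ'‖ ≤ δ)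
    {X : Fin n → EuclideanSpace ℝ (Fin p)}
    (hX : ∀ v, ∑ i, inner ℝ v (X i) ^ 2 ≤ c ^ 2 * n * ‖v‖ ^ 2) :
    |minRisk ℓ r S X (labels η Θs X ε) -
      softRisk L (fun Θ : N => r Θ) β (netProj Θs N X)| ≤
        τ + Real.log N.card / (n * β) + (K * c + D) * δ := by
  have hn' : (0 : ℝ) < n := by exact_mod_cast hn
  have : Nonempty N := ⟨⟨hN.choose, hN.choose_spec⟩⟩
  obtain ⟨h1, Θ₁, h2⟩ := softRisk_le_and_ge hn hβ L (fun Θ : N => r Θ) (netProj Θs N X)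
  set s := softRisk L (fun Θ : N => r Θ) β (netProj Θs N X)
  rw [Fintype.card_coe] at h2
  have hcl : ∀ Θ : N, |((1 / (n : ℝ)) * ∑ i, ((L i).L fun l => netProj Θs N X i (Θ, l)) + r Θ) -
      empRisk ℓ r X (labels η Θs X ε) Θ| ≤ τ := by
    intro Θ
    rw [empRisk_labels, add_sub_add_right_eq_sub, ← mul_sub, ← Finset.sum_sub_distrib, abs_mul,
      abs_of_nonneg (by positivity), one_div, inv_mul_le_iff₀ hn']
    refine (Finset.abs_sum_le_sum_abs _ _).trans ?_
    have := Finset.sum_le_card_nsmul Finset.univ (fun i => |(L i).L (sampleProj Θs Θ (X i)) -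
      sampleLoss ℓ η (ε i) (sampleProj Θs Θ (X i))|) τ fun i _ => hL i _
    rw [Finset.card_univ, Fintype.card_fin, nsmul_eq_mul] at this
    exact this
  -- Used both as the lower bound of the infimum and for boundedness from below, without which
  -- `sInf` would be a default value.
  have hlow : ∀ Θ : Params p k, (∀ l, Θ l ∈ S) →
      s - τ - (K * c + D) * δ ≤ empRisk ℓ r X (labels η Θs X ε) Θ := by
    intro Θ hΘ
    obtain ⟨Θ', hΘ', hd⟩ := hnet Θ hΘ
    have h3 := abs_empRisk_sub_le hℓ hc hX (labels η Θs X ε) (hr Θ Θ' hΘ (hNS Θ' hΘ'))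
    have h4 := h1 ⟨Θ', hΘ'⟩
    have h5 := abs_le.1 (hcl ⟨Θ', hΘ'⟩)
    have h6 := abs_le.1 h3
    have h7 : (K * c + D) * ‖Θ - Θ'‖ ≤ (K * c + D) * δ :=
      mul_le_mul_of_nonneg_left hd (by have := K.2; positivity)
    linarith [h5.1, h5.2, h6.1, h6.2]
  have hΘ₁ : empRisk ℓ r X (labels η Θs X ε) Θ₁ ∈
      empRisk ℓ r X (labels η Θs X ε) '' {Θ : Params p k | ∀ l, Θ l ∈ S} :=
    ⟨Θ₁, hNS Θ₁ Θ₁.2, rfl⟩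
  have hup : minRisk ℓ r S X (labels η Θs X ε) ≤ empRisk ℓ r X (labels η Θs X ε) Θ₁ := by
    refine csInf_le ⟨s - τ - (K * c + D) * δ, ?_⟩ hΘ₁
    rintro _ ⟨Θ, hΘ, rfl⟩
    exact hlow Θ hΘ
  have hdn : s - τ - (K * c + D) * δ ≤ minRisk ℓ r S X (labels η Θs X ε) := by
    refine le_csInf ⟨_, hΘ₁⟩ ?_
    rintro _ ⟨Θ, hΘ, rfl⟩
    exact hlow Θ hΘ
  have hδ : 0 ≤ δ := by
    obtain ⟨Θ', -, h⟩ := hnet Θ₁ (hNS Θ₁ Θ₁.2)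
    exact (norm_nonneg _).trans h
  have hlog : 0 ≤ Real.log N.card / (n * β) :=
    div_nonneg (Real.log_natCast_nonneg _) (by positivity)
  have hKD : 0 ≤ (K * c + D) * δ := by have := K.2; positivity
  have h5 := abs_le.1 (hcl Θ₁)
  rw [abs_le]
  constructor <;> linarith [h5.1, h5.2]

end Discretization

end RandomFeatures

namespace RandomFeatures

/-! ### Comparison of the training errors for fixed weights and noise -/

section Events

variable {α : Type*} [MeasurableSpace α] {μ : Measure α} [IsProbabilityMeasure μ]

/-- The event `bad` need not be measurable; it is replaced by its measurable hull, which has the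
same measure. -/
theorem abs_integral_le_of_event {f : α → ℝ} {a b q : ℝ} (ha : 0 ≤ a) (hb : 0 ≤ b) (hq : 0 ≤ q)
    {bad : Set α} (hbad : μ bad ≤ ENNReal.ofReal q) (h1 : ∀ᵐ x ∂μ, x ∉ bad → |f x| ≤ a)
    (h2 : ∀ᵐ x ∂μ, |f x| ≤ b) : |∫ x, f x ∂μ| ≤ a + b * q := by
  have h : ‖∫ x, f x ∂μ‖ₑ ≤ ENNReal.ofReal (a + b * q) := by
    calc _ ≤ ∫⁻ x, ‖f x‖ₑ ∂μ := enorm_integral_le_lintegral_enorm _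
      _ ≤ ∫⁻ x, (ENNReal.ofReal a +
          (toMeasurable μ bad).indicator (fun _ => ENNReal.ofReal b) x) ∂μ := by
          refine lintegral_mono_ae ?_
          filter_upwards [h1, h2] with x hx1 hx2
          rw [Real.enorm_eq_ofReal_abs]
          by_cases hx : x ∈ toMeasurable μ bad
          · rw [Set.indicator_of_mem hx]
            exact (ENNReal.ofReal_le_ofReal hx2).trans le_add_self
          · rw [Set.indicator_of_notMem hx, add_zero]
            exact ENNReal.ofReal_le_ofReal (hx1 fun h => hx (subset_toMeasurable μ bad h))
      _ = ENNReal.ofReal a + ENNReal.ofReal b * μ bad := by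
          rw [lintegral_add_left measurable_const, lintegral_const, measure_univ, mul_one,
            lintegral_indicator (measurableSet_toMeasurable μ bad), lintegral_const,
            Measure.restrict_apply_univ, measure_toMeasurable]
      _ ≤ ENNReal.ofReal a + ENNReal.ofReal b * ENNReal.ofReal q := by gcongr
      _ = _ := by
          rw [← ENNReal.ofReal_mul hb, ← ENNReal.ofReal_add ha (mul_nonneg hb hq)]
  rw [Real.enorm_eq_ofReal_abs] at h
  exact (ENNReal.ofReal_le_ofReal_iff (add_nonneg ha (mul_nonneg hb hq))).1 h

theorem SmoothOuter.abs_sub_le (ψ : SmoothOuter) (s t : ℝ) :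
    |ψ.φ s - ψ.φ t| ≤ ψ.M * |s - t| := by
  have := Convex.norm_image_sub_le_of_norm_hasDerivWithin_le (f := ψ.φ) (f' := ψ.φ1) (C := ψ.M)
    (s := Set.univ) (x := t) (y := s) (fun x _ => (ψ.hasDerivAt_φ x).hasDerivWithinAt)
    (fun x _ => ψ.abs_φ1_le x) convex_univ (Set.mem_univ _) (Set.mem_univ _)
  simpa using this

theorem SmoothOuter.continuous_φ (ψ : SmoothOuter) : Continuous ψ.φ :=
  continuous_iff_continuousAt.2 fun t => (ψ.hasDerivAt_φ t).continuousAt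

theorem SmoothOuter.abs_integral_sub_le (ψ : SmoothOuter) {f g : α → ℝ} (hf : Measurable f)
    (hg : Measurable g) {δ q : ℝ} (hδ : 0 ≤ δ) (hq : 0 ≤ q) {bad : Set α}
    (hbad : μ bad ≤ ENNReal.ofReal q) (h : ∀ x, x ∉ bad → |f x - g x| ≤ δ) :
    |∫ x, ψ.φ (f x) ∂μ - ∫ x, ψ.φ (g x) ∂μ| ≤ ψ.M * δ + 2 * ψ.M * q := by
  have hM := ψ.M_nonneg
  have hψ := ψ.continuous_φ.measurable
  have hif : Integrable (fun x => ψ.φ (f x)) μ :=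
    integrable_of_abs_le (hψ.comp hf) fun x => ψ.abs_φ_le _
  have hig : Integrable (fun x => ψ.φ (g x)) μ :=
    integrable_of_abs_le (hψ.comp hg) fun x => ψ.abs_φ_le _
  rw [← integral_sub hif hig]
  refine abs_integral_le_of_event (by positivity) (by positivity) hq hbad
    (Eventually.of_forall fun x hx => ?_) (Eventually.of_forall fun x => ?_)
  · exact (ψ.abs_sub_le _ _).trans (mul_le_mul_of_nonneg_left (h x hx) hM)
  · have h1 := ψ.abs_φ_le (f x)
    have h2 := ψ.abs_φ_le (g x)
    exact (abs_sub _ _).trans (by linarith)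

end Events

theorem norm_params_le_of_mem_linftyBall {p k : ℕ} {R : ℝ} (hR : 0 ≤ R) {Θ : Params p k}
    (h : ∀ l, Θ l ∈ linftyBall p R) : ‖Θ‖ ≤ √k * R := by
  rw [PiLp.norm_eq_of_L2]
  refine Real.sqrt_le_iff.2 ⟨by positivity, ?_⟩
  calc _ ≤ ∑ _l : Fin k, R ^ 2 := Finset.sum_le_sum fun l _ =>
        pow_le_pow_left₀ (norm_nonneg _) (norm_le_of_mem_linftyBall hR (h l)) 2
    _ = _ := by
        rw [Finset.sum_const, Finset.card_univ, Fintype.card_fin, nsmul_eq_mul, mul_pow,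
          Real.sq_sqrt (Nat.cast_nonneg _)]

/-- The deterministic data of a regularized empirical risk minimization problem. -/
structure RiskModel (p k kstar : ℕ) where
  ℓ : LossDomain k → ℝ
  η : LossDomain kstar → ℝ
  r : Params p k → ℝ
  C : Set (EuclideanSpace ℝ (Fin p))
  Θs : Params p kstar
  K : ℝ≥0
  R : ℝ
  D : ℝ
  R_pos : 0 < R
  D_nonneg : 0 ≤ D
  lip_ℓ : LipschitzWith K ℓ
  lip_η : LipschitzWith K η
  isCompact_C : IsCompact C
  C_subset : C ⊆ linftyBall p R
  Θs_mem : ∀ l, Θs l ∈ linftyBall p R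
  abs_r_sub_le : ∀ Θ Θ' : Params p k, (∀ l, Θ l ∈ C) → (∀ l, Θ' l ∈ C) →
    |r Θ - r Θ'| ≤ D * ‖Θ - Θ'‖
  continuous_r : Continuous r

namespace RiskModel

variable {n p k kstar : ℕ} (m : RiskModel p k kstar)

/-- The training error as a function of the features and the noise. -/
noncomputable def risk (X : Fin n → EuclideanSpace ℝ (Fin p)) (ε : Fin n → ℝ) : ℝ :=
  minRisk m.ℓ m.r m.C X (labels m.η m.Θs X ε)

theorem isCompact_params : IsCompact {Θ : Params p k | ∀ l, Θ l ∈ m.C} := by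
  have h : IsCompact (Set.pi Set.univ fun _ : Fin k => m.C) :=
    isCompact_univ_pi fun _ => m.isCompact_C
  have h2 := h.image (PiLp.continuous_toLp 2 fun _ : Fin k => EuclideanSpace ℝ (Fin p))
  convert h2 using 1
  ext Θ
  simp only [Set.mem_ofPred_eq, Set.mem_image, Set.mem_pi, Set.mem_univ, true_implies]
  constructor
  · intro h
    exact ⟨WithLp.ofLp Θ, h, rfl⟩
  · rintro ⟨v, hv, rfl⟩ l
    exact hv l

/-- An infimum over a compact set of a jointly continuous function; this gives the measurability of
the training error. -/
theorem continuous_risk : Continuous fun q : (Fin n → EuclideanSpace ℝ (Fin p)) × (Fin n → ℝ) =>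
    m.risk q.1 q.2 := by
  have h1 := m.lip_ℓ.continuous
  have h2 := m.lip_η.continuous
  have h3 := m.continuous_r
  refine m.isCompact_params.continuous_sInf (f := fun
    (q : (Fin n → EuclideanSpace ℝ (Fin p)) × (Fin n → ℝ)) (Θ : Params p k) =>
    empRisk m.ℓ m.r q.1 (labels m.η m.Θs q.1 q.2) Θ) ?_
  unfold Function.HasUncurry.uncurry
  simp only [Function.hasUncurryInduction]
  unfold empRisk labels proj
  refine (continuous_const.mul (continuous_finsetSum _ fun i _ => h1.comp ?_)).add
    (h3.comp continuous_snd)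
  have hX : Continuous fun q : ((Fin n → EuclideanSpace ℝ (Fin p)) × (Fin n → ℝ)) × Params p k =>
      q.1.1 i := (continuous_apply i).comp (continuous_fst.comp continuous_fst)
  have hε : Continuous fun q : ((Fin n → EuclideanSpace ℝ (Fin p)) × (Fin n → ℝ)) × Params p k =>
      q.1.2 i := (continuous_apply i).comp (continuous_snd.comp continuous_fst)
  refine (WithLp.prod_continuous_toLp 2 _ _).comp (Continuous.prodMk ?_ (h2.comp ?_))
  · refine (PiLp.continuous_toLp 2 _).comp (continuous_pi fun l => ?_)
    exact Continuous.inner ((PiLp.continuous_apply 2 _ l).comp continuous_snd) hX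
  · refine (WithLp.prod_continuous_toLp 2 _ _).comp (Continuous.prodMk ?_ hε)
    exact (PiLp.continuous_toLp 2 _).comp (continuous_pi fun l => continuous_const.inner hX)

theorem norm_params_le {Θ : Params p k} (h : ∀ l, Θ l ∈ m.C) : ‖Θ‖ ≤ √k * m.R :=
  norm_params_le_of_mem_linftyBall m.R_pos.le fun l => m.C_subset (h l)

theorem finrank_params : Module.finrank ℝ (Params p k) = k * p := by
  rw [(WithLp.linearEquiv 2 ℝ (Fin k → EuclideanSpace ℝ (Fin p))).finrank_eq,
    Module.finrank_pi_fintype]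
  simp

/-- The entropy of the net is linear in `p`, hence comparable with `n`, so that dividing it by `nβ`
leaves a quantity controlled by `β`. -/
theorem exists_params_net {δ : ℝ} (hδ : 0 < δ) (hC : m.C.Nonempty) :
    ∃ N : Finset (Params p k), N.Nonempty ∧ (∀ Θ ∈ N, ∀ l, Θ l ∈ m.C) ∧
      (∀ Θ : Params p k, (∀ l, Θ l ∈ m.C) → ∃ Θ' ∈ N, ‖Θ - Θ'‖ ≤ δ) ∧
      Real.log N.card ≤ k * p * Real.log (1 + 2 * (√k * m.R) / δ) := by
  have hR := m.R_pos
  obtain ⟨N, h1, h2, h3⟩ := exists_net (R := √k * m.R) (by positivity) hδ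
    {Θ : Params p k | ∀ l, Θ l ∈ m.C} fun Θ hΘ => m.norm_params_le hΘ
  have hne : N.Nonempty := by
    obtain ⟨θ, hθ⟩ := hC
    obtain ⟨Θ', hΘ', -⟩ := h3 (WithLp.toLp 2 fun _ => θ) fun _ => hθ
    exact ⟨Θ', hΘ'⟩
  refine ⟨N, hne, h1, h3, ?_⟩
  rw [finrank_params] at h2
  have hpos : (0 : ℝ) < N.card := by exact_mod_cast hne.card_pos
  have := Real.log_le_log hpos h2
  rwa [Real.log_pow, Nat.cast_mul] at this

/-- The error of the approximation of the training error by the free energy. -/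
noncomputable def approxError (n : ℕ) (β τ δ c : ℝ) : ℝ :=
  τ + k * p * Real.log (1 + 2 * (√k * m.R) / δ) / (n * β) + (m.K * c + m.D) * δ

theorem approxError_nonneg {β τ δ c : ℝ} (hβ : 0 < β) (hτ : 0 ≤ τ) (hδ : 0 < δ) (hc : 0 ≤ c) :
    0 ≤ m.approxError n β τ δ c := by
  have hR := m.R_pos
  have hD := m.D_nonneg
  have := m.K.2
  have : 0 ≤ Real.log (1 + 2 * (√k * m.R) / δ) := by
    refine Real.log_nonneg ?_
    have : 0 ≤ 2 * (√k * m.R) / δ := by positivity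
    linarith
  unfold approxError
  positivity

/-- The bound of the probability that the operator norm of the features is large. -/
noncomputable def badProb (n p : ℕ) (b c : ℝ) : ℝ :=
  5 ^ p * 2 ^ n * Real.exp (-(b * (c ^ 2 * n / 4)))

/-- Stated for any law of the rows with subgaussian projections, to serve for the random features
and for the Gaussian ones with the same net and the same losses. -/
theorem abs_integral_risk_sub_softRisk_le (hn : 0 < n) {β τ δ c b : ℝ} (hβ : 0 < β) (hτ : 0 ≤ τ)
    (hδ : 0 < δ) (hc : 0 ≤ c) (hb : 0 < b) (ψ : SmoothOuter) (ε : Fin n → ℝ)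
    (L : Fin n → SmoothLoss (Fin k ⊕ Fin kstar))
    (hL : ∀ i v, |(L i).L v - sampleLoss m.ℓ m.η (ε i) v| ≤ τ)
    {N : Finset (Params p k)} (hN : N.Nonempty) (hNS : ∀ Θ ∈ N, ∀ l, Θ l ∈ m.C)
    (hnet : ∀ Θ : Params p k, (∀ l, Θ l ∈ m.C) → ∃ Θ' ∈ N, ‖Θ - Θ'‖ ≤ δ)
    (hcard : Real.log N.card ≤ k * p * Real.log (1 + 2 * (√k * m.R) / δ))
    (μ : Measure (EuclideanSpace ℝ (Fin p))) [IsProbabilityMeasure μ]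
    (hμ : ∀ v : EuclideanSpace ℝ (Fin p), ‖v‖ ≤ 1 → SubG μ (fun x => inner ℝ v x) b) :
    |∫ X, ψ.φ (m.risk X ε) ∂(Measure.pi fun _ : Fin n => μ) -
      ∫ X, ψ.φ (softRisk L (fun Θ : N => m.r Θ) β (netProj m.Θs N X))
        ∂(Measure.pi fun _ : Fin n => μ)| ≤
      ψ.M * m.approxError n β τ δ c + 2 * ψ.M * badProb n p b c := by
  have hn' : (0 : ℝ) < n := by exact_mod_cast hn
  have hm1 : Measurable fun X : Fin n → EuclideanSpace ℝ (Fin p) => m.risk X ε :=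
    (m.continuous_risk.comp (continuous_id.prodMk continuous_const)).measurable
  have hm2 : Measurable fun X : Fin n → EuclideanSpace ℝ (Fin p) =>
      softRisk L (fun Θ : N => m.r Θ) β (netProj m.Θs N X) := by
    refine (measurable_softRisk L _ β).comp ?_
    refine measurable_pi_lambda _ fun i => measurable_pi_lambda _ fun j => ?_
    exact Measurable.const_inner (measurable_pi_apply i)
  -- The level `t = c√n/2` makes `(2t)² = c² n`, the frame bound needed for the discretization.
  have hbad := measure_frame_compl_le (n := n) μ hb hμ (t := c * √n / 2) (by positivity)
  have e1 : (c * √n / 2) ^ 2 = c ^ 2 * n / 4 := by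
    rw [div_pow, mul_pow, Real.sq_sqrt hn'.le]; norm_num
  have e2 : (2 * (c * √n / 2)) ^ 2 = c ^ 2 * n := by
    rw [mul_pow, e1]; ring
  rw [e1, e2, finrank_euclideanSpace_fin] at hbad
  refine ψ.abs_integral_sub_le hm1 hm2 (m.approxError_nonneg hβ hτ hδ hc)
    (by unfold badProb; positivity) hbad fun X hX => ?_
  simp only [Set.mem_ofPred_eq, not_not] at hX
  refine (abs_minRisk_sub_softRisk_le hn hβ m.lip_ℓ hc m.D_nonneg m.abs_r_sub_le m.Θs ε L hL N hN
    hNS hnet hX).trans ?_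
  unfold approxError
  gcongr

/-- The bound of the difference of the expectations for good weights. -/
noncomputable def compError (n : ℕ) (Λ M : ℝ) (ψ : SmoothOuter) (K' β τ δ c : ℝ) : ℝ :=
  compConst (k + kstar) (Λ * M * m.R) K' ψ.M β * (Λ ^ 2 * M * (m.R / √p)) +
    2 * (ψ.M * m.approxError n β τ δ c +
      2 * ψ.M * badProb n p (1 / (4 * Real.pi ^ 2 * (Λ * M) ^ 2)) c)

theorem compError_nonneg {Λ M : ℝ} (hΛ : 0 < Λ) (hM : 0 < M) (ψ : SmoothOuter) {K' β τ δ c : ℝ}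
    (hβ : 0 < β) (hτ : 0 ≤ τ) (hδ : 0 < δ) (hc : 0 ≤ c) (hK' : 0 ≤ K') :
    0 ≤ m.compError n Λ M ψ K' β τ δ c := by
  have hψ := ψ.M_nonneg
  have hR := m.R_pos
  have hae := m.approxError_nonneg (n := n) hβ hτ hδ hc
  unfold compError compConst expConst badProb
  positivity

end RiskModel

/-! ### Both kinds of feature rows are subgaussian for good weights. -/

section SubGaussianRows

variable {d p : ℕ} {σ : ℝ → ℝ} {M Λ : ℝ} {W : Fin p → EuclideanSpace ℝ (Fin d)}

theorem IsActivation.continuous_feature (hσ : IsActivation σ M) : Continuous (feature σ W) := by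
  have := hσ.contDiff.continuous
  unfold feature
  exact (PiLp.continuous_toLp 2 _).comp (by fun_prop)

theorem IsActivation.subG_feature (hσ : IsActivation σ M) (hW : IsGoodWeights W Λ)
    {v : EuclideanSpace ℝ (Fin p)} (hv : ‖v‖ ≤ 1) :
    SubG ((stdGaussian (EuclideanSpace ℝ (Fin d))).map (feature σ W)) (fun x => inner ℝ v x)
      (1 / (4 * Real.pi ^ 2 * (Λ * M) ^ 2)) := by
  have h := (featuresOf hσ hW (fun _ : Unit => v) one_pos one_pos (fun _ => hv)
    fun _ a => (PiLp.norm_apply_le v a).trans hv).subG_F ()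
  unfold SubG at h ⊢
  rw [lintegral_map (by fun_prop) hσ.continuous_feature.measurable]
  simpa only [featuresOf, projFeature, mul_one] using h

theorem IsActivation.subG_gaussian (hσ : IsActivation σ M) (hW : IsGoodWeights W Λ)
    {v : EuclideanSpace ℝ (Fin p)} (hv : ‖v‖ ≤ 1) :
    SubG (multivariateGaussian 0 (condCov σ W)) (fun x => inner ℝ v x)
      (1 / (4 * Real.pi ^ 2 * (Λ * M) ^ 2)) := by
  have h := (featuresOf hσ hW (fun _ : Unit => v) one_pos one_pos (fun _ => hv)
    fun _ a => (PiLp.norm_apply_le v a).trans hv).subG_inner_a ()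
  unfold SubG at h ⊢
  rw [multivariateGaussian_condCov, lintegral_map (by fun_prop) (by fun_prop)]
  simpa only [featuresOf, inner_covRoot_left, mul_one] using h

end SubGaussianRows

/-- A triangle inequality through the two free energies. The outer differences are discretization
errors, the middle one is the exchange, with `A = ΛMR` and `B = Λ²MR/√p`. -/
theorem RiskModel.abs_integral_risk_sub_le {n p k kstar d : ℕ} (m : RiskModel p k kstar)
    (hn : 0 < n) (hp : 0 < p) (hk : 0 < k) {σ : ℝ → ℝ} {M Λ : ℝ} (hσ : IsActivation σ M)
    {W : Fin p → EuclideanSpace ℝ (Fin d)} (hW : IsGoodWeights W Λ) (ψ : SmoothOuter)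
    {K' β τ δ c : ℝ} (hβ : 0 < β) (hτ : 0 ≤ τ) (hδ : 0 < δ) (hc : 0 ≤ c) (hK' : 0 ≤ K')
    (hL : ∀ e, ∃ L : SmoothLoss (Fin k ⊕ Fin kstar), L.K = K' ∧
      ∀ v, |L.L v - sampleLoss m.ℓ m.η e v| ≤ τ) (ε : Fin n → ℝ) :
    |∫ z, ψ.φ (m.risk (fun i => feature σ W (z i)) ε)
        ∂(Measure.pi fun _ : Fin n => stdGaussian (EuclideanSpace ℝ (Fin d))) -
      ∫ g, ψ.φ (m.risk g ε)
        ∂(Measure.pi fun _ : Fin n => multivariateGaussian 0 (condCov σ W))| ≤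
      m.compError n Λ M ψ K' β τ δ c := by
  have hM := ψ.M_nonneg
  have hR := m.R_pos
  have hσ0 := hσ.pos
  have hΛ0 := hW.pos
  -- Without feasible parameters both training errors are `sInf ∅ = 0`.
  rcases m.C.eq_empty_or_nonempty with hC | hC
  · have hz : ∀ (X : Fin n → EuclideanSpace ℝ (Fin p)), m.risk X ε = 0 := by
      intro X
      have : {Θ : Params p k | ∀ l, Θ l ∈ m.C} = ∅ := by
        refine Set.eq_empty_of_forall_notMem fun Θ hΘ => ?_
        have := hΘ ⟨0, hk⟩
        rw [hC] at this
        exact this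
      simp [RiskModel.risk, minRisk, this]
    simp only [hz, integral_const, probReal_univ, sub_self, abs_zero]
    exact m.compError_nonneg hΛ0 hσ0 ψ hβ hτ hδ hc hK'
  choose Lf hLK hLf using hL
  obtain ⟨N, hN, hNS, hnet, hcard⟩ := m.exists_params_net hδ hC
  -- One smooth loss for each value of the noise, all with the same constant `K'`.
  set L : Fin n → SmoothLoss (Fin k ⊕ Fin kstar) := fun i => Lf (ε i) with hLdef
  have hfm : Measurable (feature σ W) := hσ.continuous_feature.measurable
  have : IsProbabilityMeasure ((stdGaussian (EuclideanSpace ℝ (Fin d))).map (feature σ W)) :=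
    Measure.isProbabilityMeasure_map hfm.aemeasurable
  have hψ := ψ.continuous_φ.measurable
  have hrm : Measurable fun X : Fin n → EuclideanSpace ℝ (Fin p) => ψ.φ (m.risk X ε) :=
    hψ.comp (m.continuous_risk.comp (continuous_id.prodMk continuous_const)).measurable
  have hsm : Measurable fun X : Fin n → EuclideanSpace ℝ (Fin p) =>
      ψ.φ (softRisk L (fun Θ : N => m.r Θ) β (netProj m.Θs N X)) := by
    refine hψ.comp ((measurable_softRisk L _ β).comp ?_)
    refine measurable_pi_lambda _ fun i => measurable_pi_lambda _ fun j => ?_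
    exact Measurable.const_inner (measurable_pi_apply i)
  have hX := m.abs_integral_risk_sub_softRisk_le hn hβ hτ hδ hc
    (b := 1 / (4 * Real.pi ^ 2 * (Λ * M) ^ 2)) (by positivity) ψ ε L (fun i v => hLf _ v) hN hNS
    hnet hcard _ fun v hv => hσ.subG_feature hW hv
  have hG := m.abs_integral_risk_sub_softRisk_le hn hβ hτ hδ hc
    (b := 1 / (4 * Real.pi ^ 2 * (Λ * M) ^ 2)) (by positivity) ψ ε L (fun i v => hLf _ v) hN hNS
    hnet hcard _ fun v hv => hσ.subG_gaussian hW hv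
  have eX : (Measure.pi fun _ : Fin n =>
      (stdGaussian (EuclideanSpace ℝ (Fin d))).map (feature σ W)) =
      (Measure.pi fun _ : Fin n => stdGaussian (EuclideanSpace ℝ (Fin d))).map
        fun z i => feature σ W (z i) := (Measure.pi_map_pi fun _ => hfm.aemeasurable).symm
  have mX : Measurable fun (z : Fin n → EuclideanSpace ℝ (Fin d)) (i : Fin n) =>
      feature σ W (z i) := measurable_pi_lambda _ fun i => hfm.comp (measurable_pi_apply i)
  rw [eX, integral_map mX.aemeasurable hrm.aestronglyMeasurable,
    integral_map mX.aemeasurable hsm.aestronglyMeasurable] at hX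
  have hθ : ∀ j : N × (Fin k ⊕ Fin kstar),
      Sum.elim (fun l => j.1.1 l) (fun l => m.Θs l) j.2 ∈ linftyBall p m.R := by
    rintro ⟨Θ, l | l⟩
    · exact m.C_subset (hNS Θ Θ.2 l)
    · exact m.Θs_mem l
  have : Nonempty N := ⟨⟨hN.choose, hN.choose_spec⟩⟩
  have : Nonempty (Fin k ⊕ Fin kstar) := ⟨Sum.inl ⟨0, hk⟩⟩
  -- The true parameters are among the projected directions, so the exchange treats losses and
  -- labels together.
  have key := (featuresOf hσ hW (fun j : N × (Fin k ⊕ Fin kstar) =>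
    Sum.elim (fun l => j.1.1 l) (fun l => m.Θs l) j.2) hR (T := m.R / √p) (by positivity)
    (fun j => norm_le_of_mem_linftyBall hR.le (hθ j)) hθ).abs_integral_softRisk_sub_le ψ hβ hn L
    (fun i => hLK _) fun Θ : N => m.r Θ
  have eG : (Measure.pi fun _ : Fin n => multivariateGaussian 0 (condCov σ W)) =
      (Measure.pi fun _ : Fin n => stdGaussian (EuclideanSpace ℝ (Fin p))).map
        fun ξ i => covRoot σ W (ξ i) := by
    rw [multivariateGaussian_condCov]
    exact (Measure.pi_map_pi fun _ => (covRoot σ W).continuous.measurable.aemeasurable).symm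
  have mG : Measurable fun (ξ : Fin n → EuclideanSpace ℝ (Fin p)) (i : Fin n) =>
      covRoot σ W (ξ i) := measurable_pi_lambda _ fun i =>
        (covRoot σ W).continuous.measurable.comp (measurable_pi_apply i)
  -- Self-adjointness moves the square root from the Gaussian vector to the parameters, which
  -- identifies the projections with `⟨a j, ξ⟩`.
  have hGs : ∫ X, ψ.φ (softRisk L (fun Θ : N => m.r Θ) β (netProj m.Θs N X))
        ∂(Measure.pi fun _ : Fin n => multivariateGaussian 0 (condCov σ W)) =
      ∫ ξ, ψ.φ (softRisk L (fun Θ : N => m.r Θ) β fun i j => inner ℝ (covRoot σ W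
        (Sum.elim (fun l => j.1.1 l) (fun l => m.Θs l) j.2)) (ξ i))
        ∂(Measure.pi fun _ : Fin n => stdGaussian (EuclideanSpace ℝ (Fin p))) := by
    rw [eG, integral_map mG.aemeasurable hsm.aestronglyMeasurable]
    simp only [inner_covRoot_left]
    rfl
  rw [hGs] at hG
  rw [Fintype.card_sum, Fintype.card_fin, Fintype.card_fin] at key
  rw [abs_sub_comm] at hG
  refine (abs_sub_le _ _ _).trans ((add_le_add hX ((abs_sub_le _ _ _).trans
    (add_le_add key hG))).trans (le_of_eq ?_))
  simp only [RiskModel.compError, featuresOf]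
  ring

end RandomFeatures

namespace RandomFeatures

/-! ### Averaging over the weights and the noise -/

section Averaging

theorem ae_isGoodWeights {d p : ℕ} (hd : 0 < d) :
    ∀ᵐ W ∂(Measure.pi fun _ : Fin p => uniformSphere d), ∀ a, ‖W a‖ = 1 := by
  have := isProbabilityMeasure_uniformSphere hd
  refine ae_all_iff.2 fun a => ?_
  exact (measurePreserving_eval (fun _ : Fin p => uniformSphere d) a).quasiMeasurePreserving.ae
    ae_norm_eq_one_uniformSphere

/-- The bound of the probability that the weights have a large frame constant. -/
noncomputable def badWeights (d p : ℕ) (Λ : ℝ) : ℝ :=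
  5 ^ d * 2 ^ p * Real.exp (-(d / 4 * (Λ / 2) ^ 2))

theorem measure_badWeights_le {d p : ℕ} (hd : 0 < d) {Λ : ℝ} (hΛ : 0 ≤ Λ) :
    (Measure.pi fun _ : Fin p => uniformSphere d)
      {W | ¬ ∀ v, ∑ a, inner ℝ v (W a) ^ 2 ≤ Λ ^ 2 * ‖v‖ ^ 2} ≤
        ENNReal.ofReal (badWeights d p Λ) := by
  have := isProbabilityMeasure_uniformSphere hd
  have h := measure_frame_compl_le (n := p) (uniformSphere d) (c := d / 4) (by positivity)
    (fun v hv => subG_uniformSphere hd hv) (t := Λ / 2) (by positivity)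
  rwa [mul_div_cancel₀ _ two_ne_zero, finrank_euclideanSpace_fin] at h

variable {Ω : Type*} [MeasurableSpace Ω] {P : Measure Ω} [IsProbabilityMeasure P]

theorem integral_comp_pair {A B C : Type*} [MeasurableSpace A] [MeasurableSpace B]
    [MeasurableSpace C] {a : Ω → A} {b : Ω → B} {e : Ω → C} (ha : Measurable a)
    (hb : Measurable b) (he : Measurable e) (hi : IndepFun (fun ω => (a ω, b ω)) e P)
    {F : (A × B) × C → ℝ} (hF : Measurable F) {M : ℝ} (hM : ∀ x, |F x| ≤ M) :
    Integrable (fun y => ∫ x, F (x, y) ∂(P.map fun ω => (a ω, b ω))) (P.map e) ∧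
    ∫ ω, F ((a ω, b ω), e ω) ∂P =
      ∫ y, ∫ x, F (x, y) ∂(P.map fun ω => (a ω, b ω)) ∂(P.map e) := by
  have hab : Measurable fun ω => (a ω, b ω) := ha.prodMk hb
  have p1 : IsProbabilityMeasure (P.map fun ω => (a ω, b ω)) :=
    Measure.isProbabilityMeasure_map hab.aemeasurable
  have p2 : IsProbabilityMeasure (P.map e) := Measure.isProbabilityMeasure_map he.aemeasurable
  have hlaw := (indepFun_iff_map_prod_eq_prod_map_map hab.aemeasurable he.aemeasurable).1 hi
  have hFi : Integrable F ((P.map fun ω => (a ω, b ω)).prod (P.map e)) :=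
    integrable_of_abs_le hF hM
  refine ⟨hFi.integral_prod_right, ?_⟩
  have h1 : ∫ ω, F ((a ω, b ω), e ω) ∂P = ∫ x, F x ∂(P.map fun ω => ((a ω, b ω), e ω)) := by
    rw [integral_map (hab.prodMk he).aemeasurable hF.aestronglyMeasurable]
  rw [h1, hlaw, integral_prod_symm _ hFi]

theorem IsActivation.continuous_features {n p d : ℕ} {σ : ℝ → ℝ} {M : ℝ}
    (hσ : IsActivation σ M) :
    Continuous fun q : (Fin p → EuclideanSpace ℝ (Fin d)) ×
      (Fin n → EuclideanSpace ℝ (Fin d)) => fun i => feature σ q.1 (q.2 i) := by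
  have := hσ.contDiff.continuous
  unfold feature
  refine continuous_pi fun i => (PiLp.continuous_toLp 2 _).comp ?_
  fun_prop

theorem RiskModel.continuous_risk_left {n p k kstar : ℕ} (m : RiskModel p k kstar)
    (e : Fin n → ℝ) : Continuous fun X : Fin n → EuclideanSpace ℝ (Fin p) => m.risk X e := by
  have := m.continuous_risk (n := n)
  fun_prop

theorem RiskModel.abs_integral_weights_sub_le {n p k kstar d : ℕ} (m : RiskModel p k kstar)
    (hn : 0 < n) (hp : 0 < p) (hd : 0 < d) (hk : 0 < k) {σ : ℝ → ℝ} {M Λ : ℝ}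
    (hσ : IsActivation σ M) (hΛ : 0 < Λ) (ψ : SmoothOuter)
    {K' β τ δ c : ℝ} (hβ : 0 < β) (hτ : 0 ≤ τ) (hδ : 0 < δ) (hc : 0 ≤ c) (hK' : 0 ≤ K')
    (hL : ∀ e, ∃ L : SmoothLoss (Fin k ⊕ Fin kstar), L.K = K' ∧
      ∀ v, |L.L v - sampleLoss m.ℓ m.η e v| ≤ τ)
    (κ : Kernel (Fin p → EuclideanSpace ℝ (Fin d)) (Fin n → EuclideanSpace ℝ (Fin p)))
    [IsMarkovKernel κ]
    (hκ : κ =ᵐ[Measure.pi fun _ : Fin p => uniformSphere d]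
      fun W => Measure.pi (fun _ : Fin n => multivariateGaussian 0 (condCov σ W)))
    (e : Fin n → ℝ) :
    |∫ q, ψ.φ (m.risk (fun i => feature σ q.1 (q.2 i)) e)
        ∂((Measure.pi fun _ : Fin p => uniformSphere d).prod
          (Measure.pi fun _ : Fin n => stdGaussian (EuclideanSpace ℝ (Fin d)))) -
      ∫ q, ψ.φ (m.risk q.2 e) ∂((Measure.pi fun _ : Fin p => uniformSphere d) ⊗ₘ κ)| ≤
      m.compError n Λ M ψ K' β τ δ c + 2 * ψ.M * badWeights d p Λ := by
  have hM := ψ.M_nonneg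
  have pS := isProbabilityMeasure_uniformSphere hd
  have hrc : Continuous fun X : Fin n → EuclideanSpace ℝ (Fin p) => ψ.φ (m.risk X e) :=
    ψ.continuous_φ.comp (m.continuous_risk_left e)
  have mXe : Measurable fun q : (Fin p → EuclideanSpace ℝ (Fin d)) ×
      (Fin n → EuclideanSpace ℝ (Fin d)) => ψ.φ (m.risk (fun i => feature σ q.1 (q.2 i)) e) :=
    (hrc.comp hσ.continuous_features).measurable
  have mGe : Measurable fun q : (Fin p → EuclideanSpace ℝ (Fin d)) ×
      (Fin n → EuclideanSpace ℝ (Fin p)) => ψ.φ (m.risk q.2 e) :=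
    hrc.measurable.comp measurable_snd
  have iXe : Integrable (fun q : (Fin p → EuclideanSpace ℝ (Fin d)) ×
      (Fin n → EuclideanSpace ℝ (Fin d)) => ψ.φ (m.risk (fun i => feature σ q.1 (q.2 i)) e))
      ((Measure.pi fun _ : Fin p => uniformSphere d).prod
        (Measure.pi fun _ : Fin n => stdGaussian (EuclideanSpace ℝ (Fin d)))) :=
    integrable_of_abs_le mXe fun _ => ψ.abs_φ_le _
  have iGe : Integrable (fun q : (Fin p → EuclideanSpace ℝ (Fin d)) ×
      (Fin n → EuclideanSpace ℝ (Fin p)) => ψ.φ (m.risk q.2 e))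
      ((Measure.pi fun _ : Fin p => uniformSphere d) ⊗ₘ κ) :=
    integrable_of_abs_le mGe fun _ => ψ.abs_φ_le _
  have iK : Integrable (fun W => ∫ y, ψ.φ (m.risk y e) ∂(κ W))
      (Measure.pi fun _ : Fin p => uniformSphere d) :=
    integrable_of_abs_le (StronglyMeasurable.integral_kernel
      hrc.measurable.stronglyMeasurable).measurable
      fun _ => abs_integral_le_of_abs_le fun _ => ψ.abs_φ_le _
  rw [integral_prod _ iXe, Measure.integral_compProd iGe,
    ← integral_sub iXe.integral_prod_left iK]
  -- For weights with the frame bound the comparison for fixed weights applies; otherwise the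
  -- difference is at most `2 * ψ.M`.
  refine abs_integral_le_of_event ?_ (by positivity) (by unfold badWeights; positivity)
    (measure_badWeights_le hd hΛ.le) ?_ ?_
  · exact m.compError_nonneg hΛ hσ.pos ψ hβ hτ hδ hc hK'
  · filter_upwards [ae_isGoodWeights hd, hκ] with W hW hWκ hbad
    simp only [not_not] at hbad
    rw [hWκ]
    exact m.abs_integral_risk_sub_le hn hp hk hσ ⟨hW, hΛ, hbad⟩ ψ hβ hτ hδ hc hK' hL e
  · refine Eventually.of_forall fun W => ?_
    have h1 : |∫ y, ψ.φ (m.risk (fun i => feature σ W (y i)) e)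
        ∂(Measure.pi fun _ : Fin n => stdGaussian (EuclideanSpace ℝ (Fin d)))| ≤ ψ.M :=
      abs_integral_le_of_abs_le fun _ => ψ.abs_φ_le _
    have h2 : |∫ y, ψ.φ (m.risk y e) ∂(κ W)| ≤ ψ.M :=
      abs_integral_le_of_abs_le fun _ => ψ.abs_φ_le _
    exact (abs_sub _ _).trans (by linarith)

/-- The noise is independent of `(W, z)` and of `(W, g)`, so its value can be frozen in both
expectations at once; the bound for a frozen value does not depend on it. -/
theorem RiskModel.abs_expectation_sub_le {n p k kstar d : ℕ} (m : RiskModel p k kstar)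
    (hn : 0 < n) (hp : 0 < p) (hd : 0 < d) (hk : 0 < k) {σ : ℝ → ℝ} {M Λ : ℝ}
    (hσ : IsActivation σ M) (hΛ : 0 < Λ) (ψ : SmoothOuter)
    {K' β τ δ c : ℝ} (hβ : 0 < β) (hτ : 0 ≤ τ) (hδ : 0 < δ) (hc : 0 ≤ c) (hK' : 0 ≤ K')
    (hL : ∀ e, ∃ L : SmoothLoss (Fin k ⊕ Fin kstar), L.K = K' ∧
      ∀ v, |L.L v - sampleLoss m.ℓ m.η e v| ≤ τ)
    {w : Fin p → Ω → EuclideanSpace ℝ (Fin d)} {z : Fin n → Ω → EuclideanSpace ℝ (Fin d)}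
    {ε : Fin n → Ω → ℝ} {g : Fin n → Ω → EuclideanSpace ℝ (Fin p)}
    (hw_meas : ∀ j, Measurable (w j)) (hz_meas : ∀ i, Measurable (z i))
    (hε_meas : ∀ i, Measurable (ε i)) (hg_meas : ∀ i, Measurable (g i))
    (hw_law : ∀ j, P.map (w j) = uniformSphere d) (hw_indep : iIndepFun w P)
    (hz_law : ∀ i, P.map (z i) = stdGaussian (EuclideanSpace ℝ (Fin d)))
    (hz_indep : iIndepFun z P)
    (hwz_indep : IndepFun (fun ω j => w j ω) (fun ω i => z i ω) P)
    (hwzε_indep : IndepFun (fun ω => ((fun j => w j ω), (fun i => z i ω))) (fun ω i => ε i ω) P)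
    (hg_law : condDistrib (fun ω i => g i ω) (fun ω j => w j ω) P
      =ᵐ[P.map (fun ω j => w j ω)]
        fun W => Measure.pi (fun _ : Fin n => multivariateGaussian 0 (condCov σ W)))
    (hwgε_indep :
      IndepFun (fun ω => ((fun j => w j ω), (fun i => g i ω))) (fun ω i => ε i ω) P) :
    |∫ ω, ψ.φ (m.risk (fun i => feature σ (fun j => w j ω) (z i ω)) fun i => ε i ω) ∂P -
      ∫ ω, ψ.φ (m.risk (fun i => g i ω) fun i => ε i ω) ∂P| ≤
      m.compError n Λ M ψ K' β τ δ c + 2 * ψ.M * badWeights d p Λ := by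
  have pS := isProbabilityMeasure_uniformSphere hd
  have hwm : Measurable fun ω j => w j ω := measurable_pi_lambda _ hw_meas
  have hzm : Measurable fun ω i => z i ω := measurable_pi_lambda _ hz_meas
  have hεm : Measurable fun ω i => ε i ω := measurable_pi_lambda _ hε_meas
  have hgm : Measurable fun ω i => g i ω := measurable_pi_lambda _ hg_meas
  have lw : P.map (fun ω j => w j ω) = Measure.pi fun _ : Fin p => uniformSphere d := by
    rw [(iIndepFun_iff_map_fun_eq_pi_map fun j => (hw_meas j).aemeasurable).1 hw_indep]
    simp_rw [hw_law]
  have lz : P.map (fun ω i => z i ω) =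
      Measure.pi fun _ : Fin n => stdGaussian (EuclideanSpace ℝ (Fin d)) := by
    rw [(iIndepFun_iff_map_fun_eq_pi_map fun i => (hz_meas i).aemeasurable).1 hz_indep]
    simp_rw [hz_law]
  have lwz := (indepFun_iff_map_prod_eq_prod_map_map hwm.aemeasurable hzm.aemeasurable).1 hwz_indep
  rw [lw, lz] at lwz
  -- The joint law of weights and Gaussian features is disintegrated over the weights.
  have lwg := compProd_map_condDistrib (μ := P) (mβ := MeasurableSpace.pi)
    (X := fun ω j => w j ω) hgm.aemeasurable
  set κ := condDistrib (fun ω i => g i ω) (fun ω j => w j ω) P with hκ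
  rw [lw] at lwg hg_law
  have hrm := m.continuous_risk (n := n)
  have hψ := ψ.continuous_φ
  have mX : Measurable fun q : ((Fin p → EuclideanSpace ℝ (Fin d)) ×
      (Fin n → EuclideanSpace ℝ (Fin d))) × (Fin n → ℝ) =>
      ψ.φ (m.risk (fun i => feature σ q.1.1 (q.1.2 i)) q.2) :=
    (hψ.comp (hrm.comp ((hσ.continuous_features.comp continuous_fst).prodMk
      continuous_snd))).measurable
  have mG : Measurable fun q : ((Fin p → EuclideanSpace ℝ (Fin d)) ×
      (Fin n → EuclideanSpace ℝ (Fin p))) × (Fin n → ℝ) => ψ.φ (m.risk q.1.2 q.2) :=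
    (hψ.comp (hrm.comp (continuous_fst.snd.prodMk continuous_snd))).measurable
  obtain ⟨iX, eX⟩ := integral_comp_pair hwm hzm hεm hwzε_indep mX fun _ => ψ.abs_φ_le _
  obtain ⟨iG, eG⟩ := integral_comp_pair hwm hgm hεm hwgε_indep mG fun _ => ψ.abs_φ_le _
  have pε : IsProbabilityMeasure (P.map fun ω i => ε i ω) :=
    Measure.isProbabilityMeasure_map hεm.aemeasurable
  simp only at eX eG
  rw [eX, eG, ← integral_sub iX iG]
  refine abs_integral_le_of_abs_le fun e => ?_
  rw [lwz, ← lwg]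
  exact m.abs_integral_weights_sub_le hn hp hd hk hσ hΛ ψ hβ hτ hδ hc hK' hL κ hg_law e

end Averaging

end RandomFeatures

namespace RandomFeatures

/-! ### Proportional asymptotics -/

section Asymptotics

variable {p d : ℕ → ℕ} {γ γ' : ℝ}

theorem tendsto_dim (hγ : 0 < γ)
    (hp : Tendsto (fun n => (p n : ℝ) / (n : ℝ)) atTop (𝓝 γ)) :
    Tendsto (fun n => (p n : ℝ)) atTop atTop := by
  have h := hp.pos_mul_atTop hγ (tendsto_natCast_atTop_atTop (R := ℝ))
  refine h.congr' ?_
  filter_upwards [eventually_ne_atTop 0] with n hn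
  have : (n : ℝ) ≠ 0 := by exact_mod_cast hn
  field_simp

/-- Puts the failure probabilities in the form `exp (b · rate)`, so that they vanish as soon as the
limiting rate is negative. -/
theorem pow_mul_pow_mul_exp_eq (a b : ℕ) (s : ℝ) (hb : (b : ℝ) ≠ 0) :
    (5 : ℝ) ^ a * 2 ^ b * Real.exp s =
      Real.exp (b * ((a : ℝ) / b * Real.log 5 + Real.log 2 + s / b)) := by
  have h5 : (5 : ℝ) ^ a = Real.exp (a * Real.log 5) := by
    rw [Real.exp_nat_mul, Real.exp_log (by norm_num)]
  have h2 : (2 : ℝ) ^ b = Real.exp (b * Real.log 2) := by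
    rw [Real.exp_nat_mul, Real.exp_log (by norm_num)]
  rw [h5, h2, ← Real.exp_add, ← Real.exp_add]
  congr 1
  field_simp

theorem tendsto_badProb (hp : Tendsto (fun n => (p n : ℝ) / (n : ℝ)) atTop (𝓝 γ)) {b c : ℝ}
    (h : γ * Real.log 5 + Real.log 2 - b * c ^ 2 / 4 < 0) :
    Tendsto (fun n => RiskModel.badProb n (p n) b c) atTop (𝓝 0) := by
  have h1 : Tendsto (fun n : ℕ => (p n : ℝ) / n * Real.log 5 + Real.log 2 - b * c ^ 2 / 4) atTop
      (𝓝 (γ * Real.log 5 + Real.log 2 - b * c ^ 2 / 4)) :=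
    ((hp.mul_const _).add_const _).sub_const _
  have h2 := (tendsto_natCast_atTop_atTop (R := ℝ)).atTop_mul_neg h h1
  refine (Real.tendsto_exp_atBot.comp h2).congr' ?_
  filter_upwards [eventually_ne_atTop 0] with n hn
  have hn' : (n : ℝ) ≠ 0 := by exact_mod_cast hn
  rw [RiskModel.badProb, pow_mul_pow_mul_exp_eq _ _ _ hn', Function.comp_apply]
  congr 1
  field_simp
  ring

theorem tendsto_badWeights (hp : Tendsto (fun n => (p n : ℝ)) atTop atTop)
    (hd : Tendsto (fun n => (d n : ℝ) / (p n : ℝ)) atTop (𝓝 γ')) {Λ : ℝ}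
    (h : γ' * Real.log 5 + Real.log 2 - γ' * Λ ^ 2 / 16 < 0) :
    Tendsto (fun n => badWeights (d n) (p n) Λ) atTop (𝓝 0) := by
  have h1 : Tendsto (fun n : ℕ => (d n : ℝ) / p n * Real.log 5 + Real.log 2 -
      (d n : ℝ) / p n * Λ ^ 2 / 16) atTop
      (𝓝 (γ' * Real.log 5 + Real.log 2 - γ' * Λ ^ 2 / 16)) :=
    ((hd.mul_const _).add_const _).sub ((hd.mul_const _).div_const _)
  have h2 := hp.atTop_mul_neg h h1
  refine (Real.tendsto_exp_atBot.comp h2).congr' ?_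
  filter_upwards [hp.eventually_gt_atTop 0] with n hn
  rw [badWeights, pow_mul_pow_mul_exp_eq _ _ _ hn.ne', Function.comp_apply]
  congr 1
  field_simp
  ring

/-- All constants are chosen before `n`: `Λ`, then `c` in terms of `Λ`, the smoothing scale with its
`K'`, then `δ` in terms of `c`, then `β` in terms of `δ`. As `n → ∞` the exchange error and the bad
probabilities vanish, and the approximation error tends to a small constant. -/
theorem eventually_compError_le {k kstar : ℕ} (hγ : 0 < γ) (hγ' : 0 < γ')
    (hp : Tendsto (fun n => (p n : ℝ) / (n : ℝ)) atTop (𝓝 γ))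
    (hd : Tendsto (fun n => (d n : ℝ) / (p n : ℝ)) atTop (𝓝 γ'))
    (m : ∀ n, RiskModel (p n) k kstar) {K : ℝ≥0} {R D : ℝ} (hK : ∀ n, (m n).K = K)
    (hR : ∀ n, (m n).R = R) (hD : ∀ n, (m n).D = D) {M : ℝ} (hM : 0 < M) (ψ : SmoothOuter)
    {e : ℝ} (he : 0 < e) :
    ∃ Λ K' β τ δ c : ℝ, 0 < Λ ∧ 0 ≤ K' ∧ 0 < β ∧ 0 ≤ τ ∧ 0 < δ ∧ 0 ≤ c ∧
      (∀ n t, ∃ L : SmoothLoss (Fin k ⊕ Fin kstar), L.K = K' ∧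
        ∀ v, |L.L v - sampleLoss (m n).ℓ (m n).η t v| ≤ τ) ∧
      ∀ᶠ n in atTop, (m n).compError n Λ M ψ K' β τ δ c +
        2 * ψ.M * badWeights (d n) (p n) Λ ≤ e := by
  have hψ := ψ.M_nonneg
  have hR0 : 0 < R := hR 0 ▸ (m 0).R_pos
  have hD0 : 0 ≤ D := hD 0 ▸ (m 0).D_nonneg
  have hK0 : (0 : ℝ) ≤ K := K.2
  have hl5 : 0 < Real.log 5 := Real.log_pos (by norm_num)
  have hl2 : 0 < Real.log 2 := Real.log_pos (by norm_num)
  -- The choice makes the exponential rate equal to `-1`; `c` below is chosen in the same way.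
  obtain ⟨Λ, hΛ, hΛ'⟩ : ∃ Λ : ℝ, 0 < Λ ∧
      γ' * Real.log 5 + Real.log 2 - γ' * Λ ^ 2 / 16 < 0 := by
    refine ⟨√(16 / γ' * (γ' * Real.log 5 + Real.log 2 + 1)), by positivity, ?_⟩
    rw [Real.sq_sqrt (by positivity)]
    field_simp
    linarith
  set b := 1 / (4 * Real.pi ^ 2 * (Λ * M) ^ 2) with hb
  have hb0 : 0 < b := by have := Real.pi_pos; positivity
  obtain ⟨c, hc, hc'⟩ : ∃ c : ℝ, 0 < c ∧ γ * Real.log 5 + Real.log 2 - b * c ^ 2 / 4 < 0 := by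
    refine ⟨√(4 / b * (γ * Real.log 5 + Real.log 2 + 1)), by positivity, ?_⟩
    rw [Real.sq_sqrt (by positivity)]
    field_simp
    linarith
  set Kf := sampleConst k kstar K with hKf
  have hKf0 : 0 ≤ Kf := sampleConst_nonneg hK0
  set s := e / (8 * (ψ.M + 1) * (Kf + 1)) with hs
  have hs0 : 0 < s := by positivity
  obtain ⟨K', hK', hL⟩ := exists_smoothLoss (Fin k ⊕ Fin kstar) hKf0 hs0
  set δ := e / (8 * (ψ.M + 1) * (K * c + D + 1)) with hδ
  have hδ0 : 0 < δ := by positivity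
  set l := Real.log (1 + 2 * (√k * R) / δ) with hl
  have hl0 : 0 ≤ l := by
    refine Real.log_nonneg ?_
    have : 0 ≤ 2 * (√k * R) / δ := by positivity
    linarith
  -- Chosen against the limit `kγl` of the entropy of the net per sample.
  set β := 8 * (ψ.M + 1) * (k * γ * l + 1) / e with hβ
  have hβ0 : 0 < β := by positivity
  refine ⟨Λ, K', β, Kf * s, δ, c, hΛ, hK', hβ0, by positivity, hδ0, hc.le, fun n t => ?_, ?_⟩
  · refine hL _ fun u v => ?_
    have := abs_sampleLoss_sub_le (m n).lip_ℓ (m n).lip_η t u v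
    rwa [hK n] at this
  have hpt := tendsto_dim hγ hp
  have t1 : Tendsto (fun n => compConst (k + kstar) (Λ * M * R) K' ψ.M β *
      (Λ ^ 2 * M * (R / √(p n)))) atTop (𝓝 (compConst (k + kstar) (Λ * M * R) K' ψ.M β *
      (Λ ^ 2 * M * 0))) :=
    ((tendsto_const_nhds.div_atTop (Real.tendsto_sqrt_atTop.comp hpt)).const_mul _).const_mul _
  have t2 : Tendsto (fun n : ℕ => Kf * s + k * p n * l / (n * β) + (K * c + D) * δ) atTop
      (𝓝 (Kf * s + γ * (k * l / β) + (K * c + D) * δ)) := by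
    refine ((tendsto_const_nhds.add ((hp.mul_const (k * l / β)).congr fun n => ?_)).add_const _)
    ring_nf
  have t3 := tendsto_badProb hp hc'
  have t4 := tendsto_badWeights hpt hd hΛ'
  have t := (t1.add (((t2.const_mul ψ.M).add (t3.const_mul (2 * ψ.M))).const_mul 2)).add
    (t4.const_mul (2 * ψ.M))
  have hM1 : ψ.M / (ψ.M + 1) ≤ 1 := div_le_one_of_le₀ (by linarith) (by linarith)
  -- The denominators of `s` and `δ` and the numerator of `β` are shaped so that each of the three
  -- approximation errors, times `ψ.M`, is at most `e/8`.
  have frac : ∀ x : ℝ, 0 ≤ x → ψ.M * (x * (e / (8 * (ψ.M + 1) * (x + 1)))) ≤ e / 8 := by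
    intro x hx
    rw [← mul_assoc, mul_div_assoc', div_le_div_iff₀ (by positivity) (by norm_num)]
    nlinarith [mul_nonneg hψ hx, mul_nonneg he.le hψ, mul_nonneg he.le hx]
  have b1 := frac Kf hKf0
  have b3 := frac (K * c + D) (by positivity)
  have b2 : ψ.M * (γ * (k * l / β)) ≤ e / 8 := by
    have h := frac (k * γ * l) (by positivity)
    refine le_trans (le_of_eq ?_) h
    rw [hβ]
    field_simp
  -- The three errors occur twice, once for each kind of features: in total at most `6e/8`.
  have hlim : compConst (k + kstar) (Λ * M * R) K' ψ.M β * (Λ ^ 2 * M * 0) +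
      2 * (ψ.M * (Kf * s + γ * (k * l / β) + (K * c + D) * δ) + 2 * ψ.M * 0) +
      2 * ψ.M * 0 < e := by
    have : ψ.M * (Kf * s + γ * (k * l / β) + (K * c + D) * δ) =
      ψ.M * (Kf * s) + ψ.M * (γ * (k * l / β)) + ψ.M * ((K * c + D) * δ) := by ring
    rw [this]
    linarith
  filter_upwards [t.eventually (gt_mem_nhds hlim)] with n hn
  unfold RiskModel.compError RiskModel.approxError
  rw [hR n, hK n, hD n]
  exact hn.le

end Asymptotics

/-! ### Consequences of the convergence of expectations -/

section Consequences

variable {Ω : Type*} [MeasurableSpace Ω] {P : Measure Ω} [IsProbabilityMeasure P]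

/-- A test function between the indicators of `A` and `B` passes the comparison of expectations on
to probabilities. -/
theorem measureReal_le_add_of_expectation {X Y : ℕ → Ω → ℝ} (hX : ∀ n, Measurable (X n))
    (hY : ∀ n, Measurable (Y n))
    {ψ : ℝ → ℝ} (h0 : ∀ t, 0 ≤ ψ t) (h1 : ∀ t, ψ t ≤ 1) (hψ : Measurable ψ) {A B : Set ℝ}
    (hA : MeasurableSet A) (hB : MeasurableSet B)
    (hψA : ∀ t ∈ A, ψ t = 1) (hψB : ∀ t, t ∉ B → ψ t = 0)
    (h : Tendsto (fun n => |∫ ω, ψ (X n ω) ∂P - ∫ ω, ψ (Y n ω) ∂P|) atTop (𝓝 0))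
    {τ : ℝ} (hτ : 0 < τ) :
    ∀ᶠ n in atTop, P.real {ω | X n ω ∈ A} ≤ P.real {ω | Y n ω ∈ B} + τ := by
  filter_upwards [h.eventually (gt_mem_nhds hτ)] with n hn
  have hi : ∀ Z : Ω → ℝ, Measurable Z → Integrable (fun ω => ψ (Z ω)) P := fun Z hZ =>
    integrable_of_abs_le (hψ.comp hZ) (M := 1) fun ω => by rw [abs_of_nonneg (h0 _)]; exact h1 _
  have e1 : P.real {ω | X n ω ∈ A} ≤ ∫ ω, ψ (X n ω) ∂P := by
    have hm : MeasurableSet {ω | X n ω ∈ A} := hX n hA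
    rw [← integral_indicator_one hm]
    refine integral_mono ((integrable_const (1 : ℝ)).indicator hm) (hi _ (hX n)) fun ω => ?_
    by_cases hω : ω ∈ {ω | X n ω ∈ A}
    · rw [Set.indicator_of_mem hω, hψA _ hω]; rfl
    · rw [Set.indicator_of_notMem hω]; exact h0 _
  have e2 : ∫ ω, ψ (Y n ω) ∂P ≤ P.real {ω | Y n ω ∈ B} := by
    have hm : MeasurableSet {ω | Y n ω ∈ B} := hY n hB
    rw [← integral_indicator_one hm]
    refine integral_mono (hi _ (hY n)) ((integrable_const (1 : ℝ)).indicator hm) fun ω => ?_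
    by_cases hω : ω ∈ {ω | Y n ω ∈ B}
    · rw [Set.indicator_of_mem hω]; exact h1 _
    · rw [Set.indicator_of_notMem hω]; exact (hψB _ hω).le
  have := abs_lt.1 hn
  linarith

/-- The ramp function equal to `0` on `(-∞, 0]` and to `1` on `[δ, ∞)`. -/
noncomputable def ramp (δ t : ℝ) : ℝ := min 1 (max 0 (t / δ))

theorem ramp_nonneg (δ t : ℝ) : 0 ≤ ramp δ t := le_min zero_le_one (le_max_left _ _)

theorem ramp_le_one (δ t : ℝ) : ramp δ t ≤ 1 := min_le_left _ _

theorem ramp_eq_one {δ t : ℝ} (hδ : 0 < δ) (h : δ ≤ t) : ramp δ t = 1 :=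
  min_eq_left (le_max_of_le_right ((one_le_div hδ).2 h))

theorem ramp_eq_zero {δ t : ℝ} (hδ : 0 < δ) (h : t ≤ 0) : ramp δ t = 0 := by
  unfold ramp
  rw [max_eq_left (div_nonpos_of_nonpos_of_nonneg h hδ.le), min_eq_right zero_le_one]

theorem abs_ramp_sub_le {δ : ℝ} (hδ : 0 < δ) (s t : ℝ) :
    |ramp δ s - ramp δ t| ≤ (1 / δ) * |s - t| := by
  unfold ramp
  have h1 := abs_min_sub_min_le_max 1 (max 0 (s / δ)) 1 (max 0 (t / δ))
  have h2 := abs_max_sub_max_le_max 0 (s / δ) 0 (t / δ)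
  rw [sub_self, abs_zero] at h1 h2
  rw [max_eq_right (abs_nonneg (max 0 (s / δ) - max 0 (t / δ)))] at h1
  rw [max_eq_right (abs_nonneg (s / δ - t / δ))] at h2
  refine (h1.trans h2).trans (le_of_eq ?_)
  rw [← sub_div, abs_div, abs_of_pos hδ]
  ring

theorem lipschitzWith_of_abs_le {ψ : ℝ → ℝ} {C : ℝ} (hC : 0 ≤ C)
    (h : ∀ s t, |ψ s - ψ t| ≤ C * |s - t|) : LipschitzWith ⟨C, hC⟩ ψ :=
  LipschitzWith.of_dist_le_mul fun s t => by rw [Real.dist_eq, Real.dist_eq]; exact h s t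

/-- Convergence of the differences of the expectations of bounded Lipschitz functions. -/
def WeaklyClose (P : Measure Ω) (X Y : ℕ → Ω → ℝ) : Prop :=
  ∀ ψ : ℝ → ℝ, (∃ M : ℝ, ∀ t, |ψ t| ≤ M) → (∃ L : ℝ≥0, LipschitzWith L ψ) →
    Tendsto (fun n => |∫ ω, ψ (X n ω) ∂P - ∫ ω, ψ (Y n ω) ∂P|) atTop (𝓝 0)

theorem WeaklyClose.symm {X Y : ℕ → Ω → ℝ} (h : WeaklyClose P X Y) : WeaklyClose P Y X :=
  fun ψ h1 h2 => by simpa only [abs_sub_comm] using h ψ h1 h2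

theorem WeaklyClose.eventually_measureReal_ge_le {X Y : ℕ → Ω → ℝ} (h : WeaklyClose P X Y)
    (hX : ∀ n, Measurable (X n)) (hY : ∀ n, Measurable (Y n)) (ρ : ℝ) {δ τ : ℝ} (hδ : 0 < δ)
    (hτ : 0 < τ) :
    ∀ᶠ n in atTop, P.real {ω | ρ + δ ≤ X n ω} ≤ P.real {ω | ρ ≤ Y n ω} + τ := by
  have hlip : ∀ s t, |ramp δ (s - ρ) - ramp δ (t - ρ)| ≤ 1 / δ * |s - t| := fun s t => by
    simpa using abs_ramp_sub_le hδ (s - ρ) (t - ρ)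
  have hL := lipschitzWith_of_abs_le (one_div_pos.2 hδ).le hlip
  refine measureReal_le_add_of_expectation hX hY (ψ := fun t => ramp δ (t - ρ))
    (A := Set.Ici (ρ + δ)) (B := Set.Ici ρ)
    (fun t => ramp_nonneg _ _) (fun t => ramp_le_one _ _) hL.continuous.measurable
    measurableSet_Ici measurableSet_Ici (fun t ht => ramp_eq_one hδ ?_)
    (fun t ht => ramp_eq_zero hδ ?_) (h _ ⟨1, fun t => ?_⟩ ⟨_, hL⟩) hτ
  · have : ρ + δ ≤ t := ht
    linarith
  · have : t < ρ := not_le.1 ht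
    linarith
  · rw [abs_of_nonneg (ramp_nonneg _ _)]; exact ramp_le_one _ _

theorem WeaklyClose.eventually_measureReal_le_le {X Y : ℕ → Ω → ℝ} (h : WeaklyClose P X Y)
    (hX : ∀ n, Measurable (X n)) (hY : ∀ n, Measurable (Y n)) (ρ : ℝ) {δ τ : ℝ} (hδ : 0 < δ)
    (hτ : 0 < τ) :
    ∀ᶠ n in atTop, P.real {ω | X n ω ≤ ρ - δ} ≤ P.real {ω | Y n ω ≤ ρ} + τ := by
  have hlip : ∀ s t, |ramp δ (ρ - s) - ramp δ (ρ - t)| ≤ 1 / δ * |s - t| := fun s t => by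
    have := abs_ramp_sub_le hδ (ρ - s) (ρ - t)
    rwa [sub_sub_sub_cancel_left, abs_sub_comm t s] at this
  have hL := lipschitzWith_of_abs_le (one_div_pos.2 hδ).le hlip
  refine measureReal_le_add_of_expectation hX hY (ψ := fun t => ramp δ (ρ - t))
    (A := Set.Iic (ρ - δ)) (B := Set.Iic ρ)
    (fun t => ramp_nonneg _ _) (fun t => ramp_le_one _ _) hL.continuous.measurable
    measurableSet_Iic measurableSet_Iic (fun t ht => ramp_eq_one hδ ?_)
    (fun t ht => ramp_eq_zero hδ ?_) (h _ ⟨1, fun t => ?_⟩ ⟨_, hL⟩) hτ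
  · have : t ≤ ρ - δ := ht
    linarith
  · have : ρ < t := not_le.1 ht
    linarith
  · rw [abs_of_nonneg (ramp_nonneg _ _)]; exact ramp_le_one _ _

/-- The event that `Y` is at distance `ε` from `ρ` is split into two tails; each is compared, at the
cost of `ε/2`, with a tail of `X`. -/
theorem WeaklyClose.tendstoInMeasure {X Y : ℕ → Ω → ℝ} (h : WeaklyClose P X Y)
    (hX : ∀ n, Measurable (X n)) (hY : ∀ n, Measurable (Y n)) {ρ : ℝ}
    (hXρ : TendstoInMeasure P X atTop fun _ => ρ) : TendstoInMeasure P Y atTop fun _ => ρ := by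
  rw [tendstoInMeasure_iff_measureReal_dist] at hXρ ⊢
  intro ε hε
  rw [Metric.tendsto_nhds]
  intro τ hτ
  filter_upwards [h.symm.eventually_measureReal_ge_le hY hX (ρ + ε / 2) (half_pos hε)
      (show 0 < τ / 4 by positivity),
    h.symm.eventually_measureReal_le_le hY hX (ρ - ε / 2) (half_pos hε)
      (show 0 < τ / 4 by positivity),
    (hXρ (ε / 2) (half_pos hε)).eventually (gt_mem_nhds (show 0 < τ / 4 by positivity))]
    with n h1 h2 h3
  have e1 : P.real {ω | ρ + ε / 2 ≤ X n ω} ≤ P.real {ω | ε / 2 ≤ dist (X n ω) ρ} := by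
    refine measureReal_mono fun ω (hω : ρ + ε / 2 ≤ X n ω) => ?_
    exact le_trans (by linarith) (le_abs_self (X n ω - ρ))
  have e2 : P.real {ω | X n ω ≤ ρ - ε / 2} ≤ P.real {ω | ε / 2 ≤ dist (X n ω) ρ} := by
    refine measureReal_mono fun ω (hω : X n ω ≤ ρ - ε / 2) => ?_
    exact le_trans (by linarith) (neg_le_abs (X n ω - ρ))
  have e3 : P.real {ω | ε ≤ dist (Y n ω) ρ} ≤
      P.real {ω | ρ + ε / 2 + ε / 2 ≤ Y n ω} + P.real {ω | Y n ω ≤ ρ - ε / 2 - ε / 2} := by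
    refine (measureReal_mono fun ω (hω : ε ≤ |Y n ω - ρ|) => ?_).trans (measureReal_union_le _ _)
    rcases le_abs.1 hω with hω | hω
    · exact Or.inl (show ρ + ε / 2 + ε / 2 ≤ Y n ω by linarith)
    · exact Or.inr (show Y n ω ≤ ρ - ε / 2 - ε / 2 by linarith)
  rw [Real.dist_eq, sub_zero, abs_of_nonneg measureReal_nonneg]
  linarith

/-- Bounded Lipschitz functions are uniform limits of smooth ones, and a uniform error in the test
function passes to both expectations. -/
theorem weaklyClose_of_smoothOuter {X Y : ℕ → Ω → ℝ} (hX : ∀ n, Measurable (X n))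
    (hY : ∀ n, Measurable (Y n))
    (h : ∀ (φ : SmoothOuter) (e : ℝ), 0 < e →
      ∀ᶠ n in atTop, |∫ ω, φ.φ (X n ω) ∂P - ∫ ω, φ.φ (Y n ω) ∂P| ≤ e) : WeaklyClose P X Y := by
  rintro ψ ⟨M, hM⟩ ⟨L, hL⟩
  rw [Metric.tendsto_nhds]
  intro e he
  have hlip : ∀ s t, |ψ s - ψ t| ≤ L * |s - t| := fun s t => hL.dist_le_mul s t
  obtain ⟨φ, hφ⟩ := exists_smoothOuter L.2 hlip hM (s := e / (4 * (L + 1))) (by positivity)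
  have hs : (L : ℝ) * (e / (4 * (L + 1))) ≤ e / 4 := by
    have := L.2
    rw [mul_div_assoc', div_le_div_iff₀ (by positivity) (by norm_num)]
    nlinarith
  have hcl : ∀ Z : Ω → ℝ, Measurable Z → |∫ ω, φ.φ (Z ω) ∂P - ∫ ω, ψ (Z ω) ∂P| ≤ e / 4 := by
    intro Z hZ
    have i1 : Integrable (fun ω => φ.φ (Z ω)) P :=
      integrable_of_abs_le (φ.continuous_φ.measurable.comp hZ) fun _ => φ.abs_φ_le _
    have i2 : Integrable (fun ω => ψ (Z ω)) P :=
      integrable_of_abs_le (hL.continuous.measurable.comp hZ) fun _ => hM _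
    rw [← integral_sub i1 i2]
    exact abs_integral_le_of_abs_le fun ω => (hφ _).trans hs
  filter_upwards [h φ (e / 4) (by positivity)] with n hn
  have h1 := abs_le.1 (hcl _ (hX n))
  have h2 := abs_le.1 (hcl _ (hY n))
  have h3 := abs_le.1 hn
  rw [Real.dist_eq, sub_zero, abs_abs]
  refine abs_lt.2 ⟨?_, ?_⟩ <;> linarith

end Consequences

/-! ### Construction of the models -/

theorem exists_isActivation {σ : ℝ → ℝ} (hσ : ContDiff ℝ 3 σ)
    (hσ_bdd : ∀ m : ℕ, 1 ≤ m → m ≤ 3 → ∃ M : ℝ, ∀ t, |iteratedDeriv m σ t| ≤ M)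
    (hσ_mean : ∫ t, σ t ∂(gaussianReal 0 1) = 0) : ∃ M, IsActivation σ M := by
  obtain ⟨M₁, h₁⟩ := hσ_bdd 1 le_rfl (by norm_num)
  obtain ⟨M₂, h₂⟩ := hσ_bdd 2 (by norm_num) (by norm_num)
  simp only [iteratedDeriv_succ, iteratedDeriv_zero] at h₁ h₂
  have hM₁ : 0 ≤ M₁ := (abs_nonneg _).trans (h₁ 0)
  have hM₂ : 0 ≤ M₂ := (abs_nonneg _).trans (h₂ 0)
  exact ⟨M₁ + M₂ + 1, hσ, by positivity, fun t => (h₁ t).trans (by linarith),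
    fun t => (h₂ t).trans (by linarith), hσ_mean⟩

/-- Near `x` both points lie in the ball of radius `‖x‖ + 1`, where a single constant applies. -/
theorem continuous_of_locally_lipschitz {E : Type*} [NormedAddCommGroup E] {r : E → ℝ}
    {κ : ℝ → ℝ} (h : ∀ B : ℝ, 0 < B → ∀ x y : E, ‖x‖ ≤ B → ‖y‖ ≤ B → |r x - r y| ≤ κ B * ‖x - y‖) :
    Continuous r := by
  refine continuous_iff_continuousAt.2 fun x => ?_
  rw [ContinuousAt, tendsto_iff_dist_tendsto_zero]
  have hlim : Tendsto (fun y => κ (‖x‖ + 1) * ‖y - x‖) (𝓝 x) (𝓝 0) := by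
    have hc : Continuous fun y => κ (‖x‖ + 1) * ‖y - x‖ := by fun_prop
    have := hc.tendsto x
    rwa [sub_self, norm_zero, mul_zero] at this
  refine squeeze_zero' (Eventually.of_forall fun _ => dist_nonneg) ?_ hlim
  filter_upwards [Metric.ball_mem_nhds x one_pos] with y hy
  rw [Metric.mem_ball, dist_eq_norm] at hy
  refine h _ (by positivity) y x ?_ (by linarith)
  have := norm_add_le (y - x) x
  rw [sub_add_cancel] at this
  linarith

end RandomFeatures

open RandomFeatures in
theorem corollary3p2
    -- the activation function
    (σ : ℝ → ℝ) (hσ : ContDiff ℝ 3 σ)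
    (hσ_bdd : ∀ m : ℕ, 1 ≤ m → m ≤ 3 → ∃ M : ℝ, ∀ t, |iteratedDeriv m σ t| ≤ M)
    (hσ_mean : ∫ t, σ t ∂(gaussianReal 0 1) = 0)
    -- the fixed constants
    (R : ℝ) (hR : 0 < R) (K : ℝ≥0) (hK : 0 < K) (k kstar : ℕ) (hk : 0 < k) (hkstar : 0 < kstar)
    (Kr : ℝ → ℝ) (hKr : ∀ B, 0 ≤ B → 0 < Kr B)
    -- proportional asymptotics
    (γ γ' : ℝ) (hγ : 0 < γ) (hγ' : 0 < γ') (p d : ℕ → ℕ) (hd : ∀ n, 0 < d n)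
    (hp_lim : Tendsto (fun n => (p n : ℝ) / (n : ℝ)) atTop (𝓝 γ))
    (hd_lim : Tendsto (fun n => (d n : ℝ) / (p n : ℝ)) atTop (𝓝 γ'))
    -- loss and labeling functions
    (ℓ : ℕ → LossDomain k → ℝ) (hℓ_nonneg : ∀ n v, 0 ≤ ℓ n v) (hℓ : ∀ n, LipschitzWith K (ℓ n))
    (η : ℕ → LossDomain kstar → ℝ) (hη : ∀ n, LipschitzWith K (η n))
    -- constraint sets, true parameters and regularizers
    (C : ∀ n, Set (EuclideanSpace ℝ (Fin (p n)))) (hC_compact : ∀ n, IsCompact (C n))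
    (hC : ∀ n, C n ⊆ linftyBall (p n) R)
    (Θs : ∀ n, Params (p n) kstar) (hΘs : ∀ n l, Θs n l ∈ linftyBall (p n) R)
    (r : ∀ n, Params (p n) k → ℝ)
    (hr : ∀ n (B : ℝ), 0 < B → ∀ Θ₀ Θ₁ : Params (p n) k, ‖Θ₀‖ ≤ B → ‖Θ₁‖ ≤ B →
      |r n Θ₀ - r n Θ₁| ≤ Kr B * ‖Θ₀ - Θ₁‖)
    -- weights, covariates, noise and Gaussian features
    {Ω : Type*} [MeasurableSpace Ω] (P : Measure Ω) [IsProbabilityMeasure P]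
    (w : ∀ n, Fin (p n) → Ω → EuclideanSpace ℝ (Fin (d n)))
    (z : ∀ n, Fin n → Ω → EuclideanSpace ℝ (Fin (d n)))
    (ε : ∀ n, Fin n → Ω → ℝ)
    (g : ∀ n, Fin n → Ω → EuclideanSpace ℝ (Fin (p n)))
    (hw_meas : ∀ n j, Measurable (w n j)) (hz_meas : ∀ n i, Measurable (z n i))
    (hε_meas : ∀ n i, Measurable (ε n i)) (hg_meas : ∀ n i, Measurable (g n i))
    (hw_law : ∀ n j, P.map (w n j) = uniformSphere (d n)) (hw_indep : ∀ n, iIndepFun (w n) P)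
    (hz_law : ∀ n i, P.map (z n i) = stdGaussian (EuclideanSpace ℝ (Fin (d n))))
    (hz_indep : ∀ n, iIndepFun (z n) P)
    (hε_ident : ∀ n i i', IdentDistrib (ε n i) (ε n i') P P) (hε_indep : ∀ n, iIndepFun (ε n) P)
    (hε_psi : ∀ n i, psiTwoNorm P (ε n i) ≤ K)
    (hwz_indep : ∀ n, IndepFun (fun ω j => w n j ω) (fun ω i => z n i ω) P)
    (hwzε_indep : ∀ n,
      IndepFun (fun ω => ((fun j => w n j ω), (fun i => z n i ω))) (fun ω i => ε n i ω) P)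
    (hg_law : ∀ n, condDistrib (fun ω i => g n i ω) (fun ω j => w n j ω) P
      =ᵐ[P.map (fun ω j => w n j ω)]
        fun W => Measure.pi (fun _ : Fin n => multivariateGaussian 0 (condCov σ W)))
    (hwgε_indep : ∀ n,
      IndepFun (fun ω => ((fun j => w n j ω), (fun i => g n i ω))) (fun ω i => ε n i ω) P)
    -- the training errors with random features and with Gaussian features
    (RX RG : ℕ → Ω → ℝ)
    (hRX : ∀ n ω, RX n ω =
      let X : Fin n → EuclideanSpace ℝ (Fin (p n)) :=
        fun i => feature σ (fun j => w n j ω) (z n i ω)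
      minRisk (ℓ n) (r n) (C n) X (labels (η n) (Θs n) X (fun i => ε n i ω)))
    (hRG : ∀ n ω, RG n ω =
      let G : Fin n → EuclideanSpace ℝ (Fin (p n)) := fun i => g n i ω
      minRisk (ℓ n) (r n) (C n) G (labels (η n) (Θs n) G (fun i => ε n i ω))) :
    (∀ ψ : ℝ → ℝ, (∃ M : ℝ, ∀ t, |ψ t| ≤ M) → (∃ L : ℝ≥0, LipschitzWith L ψ) →
      Tendsto (fun n => |∫ ω, ψ (RX n ω) ∂P - ∫ ω, ψ (RG n ω) ∂P|) atTop (𝓝 0)) ∧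
    (∀ ρ δ : ℝ, 0 < δ →
      (∀ τ : ℝ, 0 < τ → ∀ᶠ n in atTop,
        P.real {ω | ρ + δ ≤ RX n ω} ≤ P.real {ω | ρ ≤ RG n ω} + τ) ∧
      (∀ τ : ℝ, 0 < τ → ∀ᶠ n in atTop,
        P.real {ω | RX n ω ≤ ρ - δ} ≤ P.real {ω | RG n ω ≤ ρ} + τ)) ∧
    (∀ ρ : ℝ, TendstoInMeasure P RX atTop (fun _ => ρ) ↔
      TendstoInMeasure P RG atTop (fun _ => ρ)) := by
  obtain ⟨M, hM⟩ := exists_isActivation hσ hσ_bdd hσ_mean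
  -- Feasible parameters have Frobenius norm at most `√k * R`, which is positive and independent of
  -- `n`; so the single constant `Kr (√k * R)` controls all regularizers.
  let m : ∀ n, RiskModel (p n) k kstar := fun n =>
    { ℓ := ℓ n, η := η n, r := r n, C := C n, Θs := Θs n, K := K, R := R, D := Kr (√k * R)
      R_pos := hR, D_nonneg := (hKr _ (by positivity)).le, lip_ℓ := hℓ n, lip_η := hη n
      isCompact_C := hC_compact n, C_subset := hC n, Θs_mem := hΘs n
      abs_r_sub_le := fun Θ Θ' h h' => hr n _ (by positivity) Θ Θ'
        (norm_params_le_of_mem_linftyBall hR.le fun l => hC n (h l))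
        (norm_params_le_of_mem_linftyBall hR.le fun l => hC n (h' l))
      continuous_r := continuous_of_locally_lipschitz (hr n) }
  have eX : ∀ n, RX n = fun ω =>
      (m n).risk (fun i => feature σ (fun j => w n j ω) (z n i ω)) fun i => ε n i ω :=
    fun n => funext (hRX n)
  have eG : ∀ n, RG n = fun ω => (m n).risk (fun i => g n i ω) fun i => ε n i ω :=
    fun n => funext (hRG n)
  have mε : ∀ n, Measurable fun ω i => ε n i ω := fun n => measurable_pi_lambda _ (hε_meas n)
  have mX : ∀ n, Measurable (RX n) := fun n => by
    have h : Measurable fun ω => ((fun j => w n j ω), fun i => z n i ω) :=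
      (measurable_pi_lambda _ (hw_meas n)).prodMk (measurable_pi_lambda _ (hz_meas n))
    have h2 := (hM.continuous_features (n := n)).measurable.comp h
    have h3 := (m n).continuous_risk.measurable.comp (h2.prodMk (mε n))
    rw [eX n]
    simpa only [Function.comp_def] using h3
  have mG : ∀ n, Measurable (RG n) := fun n => by
    have h3 := (m n).continuous_risk.measurable.comp
      ((measurable_pi_lambda _ (hg_meas n)).prodMk (mε n))
    rw [eG n]
    simpa only [Function.comp_def] using h3
  -- Everything else follows from this; as the relation is symmetric, both directions of the last
  -- equivalence are instances of one lemma.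
  have main : WeaklyClose P RX RG := by
    refine weaklyClose_of_smoothOuter mX mG fun φ e he => ?_
    obtain ⟨Λ, K', β, τ, δ, c, hΛ, hK', hβ, hτ, hδ, hc, hL, hlim⟩ :=
      eventually_compError_le hγ hγ' hp_lim hd_lim m (fun _ => rfl) (fun _ => rfl) (fun _ => rfl)
        hM.pos φ he
    filter_upwards [hlim, eventually_gt_atTop 0, (tendsto_dim hγ hp_lim).eventually_gt_atTop 0]
      with n hn hn0 hp0
    rw [eX n, eG n]
    exact ((m n).abs_expectation_sub_le hn0 (Nat.cast_pos.1 hp0) (hd n) hk hM hΛ φ hβ hτ hδ hc hK'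
      (hL n) (hw_meas n) (hz_meas n) (hε_meas n) (hg_meas n) (hw_law n) (hw_indep n) (hz_law n)
      (hz_indep n) (hwz_indep n) (hwzε_indep n) (hg_law n) (hwgε_indep n)).trans hn
  exact ⟨main, fun ρ δ hδ => ⟨fun τ hτ => main.eventually_measureReal_ge_le mX mG ρ hδ hτ,
    fun τ hτ => main.eventually_measureReal_le_le mX mG ρ hδ hτ⟩,
    fun ρ => ⟨main.tendstoInMeasure mX mG, main.symm.tendstoInMeasure mG mX⟩⟩
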